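/- **Conventions.** For a finite root system with simple roots $\alpha_1,\dots,\alpha_r$, let $\Phi^+$ be the set of positive roots, $s_i$ the simple reflections, $W$ the reflection group they generate, and $\mathrm{Red}(w)$ the set of reduced words of $w\in W$. The inversion set of $w\in W$ is $\mathrm{Inv}(w)=\Phi^+\cap(-w(\Phi^+))$. In crystallographic types $\Phi^+$ is ordered by $\beta\preceq\gamma$ iff $\gamma-\beta$ is a nonnegative integer combination of simple roots. Simple roots are numbered as follows. $B_m$: the chain $1-2-\cdots-m$ with double edge $1-2$ and $\alpha_1$ short. $D_n$: the chain $3-4-\cdots-n$ with nodes $1$ and $2$ both joined to $3$ only ($D_2$ is two unconnected nodes). $E_7$: the chain $1-3-4-5-6-7$ with node $2$ joined to $5$. $H_3$: the chain $1-2-3$ with the edge $1-2$ labelled $5$. $I_2(m)$: nodes $1,2$ with an edge labelled $m$. **Minuscule posets.** $\Lambda_Z=\{\alpha\in\Phi^+ : \text{the coefficient of }\alpha_i\text{ in }\alpha\text{ is nonzero}\}$ with the induced order, where (type, $i$) is $(D_n,1)$ for $Z=\mathsf{OG}(n,2n)$, $(E_7,1)$ for $Z=\mathsf G_\omega(\mathbb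 O^3,\mathbb O^6)$, and $(D_{2n},2n)$ for $Z=\mathbb Q^{4n-2}$. $W(Z)$ is the Weyl group of that type. A straight shape is an order ideal of $\Lambda_Z$. **Root posets $\Phi^+_Y$ and elements $w_\circ(Y)$.** * $Y=B_{k,n}$, $1\le k$, $2k\le n$: $w_\circ(Y)=b_{k,n}=(s_1s_2\cdots s_{n-k})^k\in W(B_{n-k})$, and $\Phi^+_Y$ is the subposet of the root poset $\Phi^+$ of type $B_{n-k}$ consisting of the positive roots $\alpha$ for which $b_{k,n}(\alpha)$ is negative. * For a word $s_{i_1}\cdots s_{i_j}$, its $p$-th letter is labelled by the root $s_{i_1}\cdots s_{i_{p-1}}(\alpha_{i_p})$, and the heap order on the labels is generated by: the label of letter $p$ is below that of letter $q$ if $p<q$ and $s_{i_p},s_{i_q}$ do not commute. For a pair of simple reflections $(s,t)$ with edge label $m$, the dihedral relations of $(s,t)$ are those of the heap of $sts\cdots$ ($m-1$ letters), together with $\alpha_t\prec s(\alpha_t)$. * $Y=I_2(2n)$, $n\ge2$: $\Phi^+_Y$ is the set of positive roots of $I_2(2n)$, ordered by the reflexive transitive closure of the dihedral relations of $(s_1,s_2)$.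 * $Y=H_3$: $\Phi^+_Y$ is the set of positive roots of $H_3$, ordered by the reflexive transitive closure of the dihedral relations of $(s_2,s_1)$ (with $m=5$), the heap relations of $s_3s_2s_1s_2s_1s_3s_2s_1s_2s_3$, and $\beta\prec s_3(\beta)$ for every positive root $\beta$ in the span of $\alpha_1,\alpha_2$ with $s_3(\beta)\ne\beta$. * For $Y\in\{H_3,I_2(2n)\}$, $w_\circ(Y)$ is the longest element of $W(Y)$. **Proposition.** For each pair $(Y,Z)$ among $(B_{k,n},\mathsf{OG}(n,2n))$ with $1\le k$ and $2k\le n$; $(H_3,\mathsf G_\omega(\mathbb O^3,\mathbb O^6))$; and $(I_2(2n),\mathbb Q^{4n-2})$ with $n\ge2$, let $w\in W(Z)$ be, respectively, $$w=\prod_{j=1}^{k}\Big(s_{1,2}(j)\prod_{i=3}^{n-2j+2}s_i\Big),\quad s_{1,2}(j)=\begin{cases}s_1& j\text{ odd}\\ s_2& j\text{ even,}\end{cases}$$ $$w=s_1s_3s_4s_5s_6s_7s_2s_5s_6s_4s_5s_2s_3s_4s_1,\qquad w=s_{2n}s_{2n-1}\cdots s_3\,s_1s_2 .$$ Then there is an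 injective map $\chi:\Phi^+_Y\to\Lambda_Z$ that embeds the dual of the poset $\Phi^+_Y$ (that is, $\beta\preceq\gamma$ in $\Phi^+_Y$ if and only if $\chi(\gamma)\preceq\chi(\beta)$), whose image is an order ideal of $\Lambda_Z$ and equals $\mathrm{Inv}(w)$. Moreover there is a bijection $\mathrm{Red}(w_\circ(Y))\simeq\mathrm{Red}(w)$. -/

import Mathlib

/-!
Finite root systems and their reflection groups are realised in the basis of simple roots: a vector
`v : Fin n → R` stands for `∑ i, v i • α i`.  Simple roots are numbered as follows (the node with
number `i` is the index `i - 1` of `Fin n`):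
* `B n`: a chain `1 - 2 - ⋯ - n`, the edge `1 - 2` is double and `α 1` is the short simple root;
* `D n`: a chain `3 - 4 - ⋯ - n`, the nodes `1` and `2` are both joined to `3` and to nothing else;
* `E 7`: a chain `1 - 3 - 4 - 5 - 6 - 7`, the node `2` is joined to `5`;
* `H 3`: a chain `1 - 2 - 3`, the edge `1 - 2` has label `5`;
* `I 2 m`: two nodes, the edge has label `m`.
-/

namespace RootPosetEmbedding

/-- A generalised Cartan matrix with diagonal entries `2`; the entry at `i, j` is the pairing
of the simple root `α i` with the simple coroot `α j ^ ∨`. -/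
structure CartanDatum (n : ℕ) (R : Type) [CommRing R] where
  A : Matrix (Fin n) (Fin n) R
  diag : ∀ i, A i i = 2

section General

variable {n : ℕ} {R : Type} [CommRing R]

/-- The simple root `α i`. -/
def simpleRoot (R : Type) [CommRing R] (i : Fin n) : Fin n → R := Pi.single i 1

/-- The simple coroot, as the functional `v ↦ ∑ j, v j * A j i`. -/
def CartanDatum.simpleCoroot (C : CartanDatum n R) (i : Fin n) : Module.Dual R (Fin n → R) :=
  ∑ j, C.A j i • (LinearMap.proj j : (Fin n → R) →ₗ[R] R)

theorem CartanDatum.simpleCoroot_simpleRoot (C : CartanDatum n R) (i : Fin n) :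
    C.simpleCoroot i (simpleRoot R i) = 2 := by
  simp [CartanDatum.simpleCoroot, simpleRoot, Pi.single_apply, C.diag]

/-- The simple reflection `s i`, `v ↦ v - ⟨v, α i ^ ∨⟩ α i`. -/
def CartanDatum.refl (C : CartanDatum n R) (i : Fin n) : (Fin n → R) ≃ₗ[R] (Fin n → R) :=
  Module.reflection (C.simpleCoroot_simpleRoot i)

/-- The reflection group `W`. -/
def CartanDatum.W (C : CartanDatum n R) : Subgroup ((Fin n → R) ≃ₗ[R] (Fin n → R)) :=
  Subgroup.closure (Set.range C.refl)

/-- The product `s i₁ * s i₂ * ⋯` along a word. -/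
def CartanDatum.wordProd (C : CartanDatum n R) (l : List (Fin n)) :
    (Fin n → R) ≃ₗ[R] (Fin n → R) :=
  (l.map C.refl).prod

/-- The length of `w`: the least number of letters of a word in the simple reflections for `w`. -/
noncomputable def CartanDatum.len (C : CartanDatum n R)
    (w : (Fin n → R) ≃ₗ[R] (Fin n → R)) : ℕ :=
  sInf {j | ∃ l : List (Fin n), C.wordProd l = w ∧ l.length = j}

/-- The set of reduced words of `w`. -/
def CartanDatum.Red (C : CartanDatum n R) (w : (Fin n → R) ≃ₗ[R] (Fin n → R)) :
    Set (List (Fin n)) :=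
  {l | C.wordProd l = w ∧ l.length = C.len w}

/-- `w` is the longest element of `W` (every other element is strictly shorter). -/
def CartanDatum.IsLongest (C : CartanDatum n R) (w : (Fin n → R) ≃ₗ[R] (Fin n → R)) : Prop :=
  w ∈ C.W ∧ ∀ v ∈ C.W, v ≠ w → C.len v < C.len w

/-- The root system: all images of simple roots under the reflection group. -/
def CartanDatum.roots (C : CartanDatum n R) : Set (Fin n → R) :=
  {β | ∃ w ∈ C.W, ∃ i, β = w (simpleRoot R i)}

/-- The simple reflection whose node has number `i`, where `1 ≤ i ≤ n` (the value at other `i` is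
irrelevant). -/
def CartanDatum.s (C : CartanDatum n R) (i : ℕ) : (Fin n → R) ≃ₗ[R] (Fin n → R) :=
  if h : 1 ≤ i ∧ i ≤ n then C.refl ⟨i - 1, by omega⟩ else 1

/-- The group element spelled by a list of node numbers. -/
def CartanDatum.elt (C : CartanDatum n R) (l : List ℕ) : (Fin n → R) ≃ₗ[R] (Fin n → R) :=
  (l.map C.s).prod

variable [PartialOrder R]

/-- The positive roots: the roots with nonnegative coordinates in the basis of simple roots. As a
subtype of `Fin n → R` with its coordinatewise order, this is the positive root poset when the
root system is crystallographic (`R = ℤ`). -/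
def CartanDatum.posRoots (C : CartanDatum n R) : Set (Fin n → R) :=
  {β | β ∈ C.roots ∧ 0 ≤ β}

/-- The inversion set of `w`, i.e. `(-w(Φ⁺)) ∩ Φ⁺`. -/
def CartanDatum.inversions (C : CartanDatum n R) (w : (Fin n → R) ≃ₗ[R] (Fin n → R)) :
    Set (Fin n → R) :=
  {β | β ∈ C.posRoots ∧ ∃ γ ∈ C.posRoots, β = -(w γ)}

/-- The poset of positive roots in which the simple root `α i` occurs, i.e. the order filter of
the positive root poset generated by `α i`; a minuscule poset when the fundamental coweight with
index `i` is minuscule. -/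
def CartanDatum.rootFilter (C : CartanDatum n R) (i : Fin n) : Set (Fin n → R) :=
  {β | β ∈ C.posRoots ∧ β i ≠ 0}

end General

section Heaps

variable {n : ℕ} {R : Type} [CommRing R]

/-- The root `s i₁ ⋯ s iₚ (α iₚ₊₁)` that labels the letter at position `p` (counted from `0`). -/
def CartanDatum.letterRoot (C : CartanDatum n R) (l : List (Fin n)) (p : Fin l.length) :
    Fin n → R :=
  C.wordProd (l.take p) (simpleRoot R (l.get p))

/-- The relations that generate the heap of a word, transported to the roots labelling its letters:
an earlier letter lies below a later one if the two reflections do not commute. -/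
def CartanDatum.heapRel (C : CartanDatum n R) (l : List (Fin n)) (β γ : Fin n → R) : Prop :=
  ∃ p q : Fin l.length, p < q ∧
    C.refl (l.get p) * C.refl (l.get q) ≠ C.refl (l.get q) * C.refl (l.get p) ∧
    β = C.letterRoot l p ∧ γ = C.letterRoot l q

/-- The word `a b a b ⋯` with `m` letters. -/
def alternatingWord (a b : Fin n) (m : ℕ) : List (Fin n) :=
  (List.range m).map fun j => if Even j then a else b

/-- The relations that generate the root poset of the dihedral parabolic subgroup with simple
reflections `s a`, `s b` and label `m` on the edge: the chain given by the heap of `s a * s b * ⋯`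
(`m - 1` letters), and `α b` below `s a (α b)`. -/
def CartanDatum.dihedralRel (C : CartanDatum n R) (a b : Fin n) (m : ℕ) (β γ : Fin n → R) : Prop :=
  C.heapRel (alternatingWord a b (m - 1)) β γ ∨
    (β = simpleRoot R b ∧ γ = C.refl a (simpleRoot R b))

end Heaps

/-- The geometric representation of a Coxeter group: `A i j = -2 cos (π / M i j)`. -/
noncomputable def ofCoxeter {n : ℕ} (M : CoxeterMatrix (Fin n)) : CartanDatum n ℝ where
  A := Matrix.of fun i j => -2 * Real.cos (Real.pi / M i j)
  diag i := by simp

/-- Type `B n`. -/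
def typeB (n : ℕ) : CartanDatum n ℤ where
  A := (CartanMatrix.B n).submatrix Fin.rev Fin.rev
  diag i := by simp

/-- Type `D n`. -/
def typeD (n : ℕ) : CartanDatum n ℤ where
  A := (CartanMatrix.D n).submatrix Fin.rev Fin.rev
  diag i := by simp

/-- Type `E 7`; the nodes `1, …, 7` here are the nodes `7, 2, 6, 5, 4, 3, 1` of Bourbaki. -/
def typeE7 : CartanDatum 7 ℤ where
  A := CartanMatrix.E₇.submatrix ![6, 1, 5, 4, 3, 2, 0] ![6, 1, 5, 4, 3, 2, 0]
  diag i := by simp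

/-- Type `H 3`. -/
noncomputable def typeH3 : CartanDatum 3 ℝ := ofCoxeter (CoxeterMatrix.H₃.reindex Fin.revPerm)

/-- Type `I 2 m` for `m ≥ 2` (`CoxeterMatrix.I k` has the label `k + 2`). -/
noncomputable def typeI (m : ℕ) : CartanDatum 2 ℝ := ofCoxeter (CoxeterMatrix.I (m - 2))

/-- The element `b k n = (s 1 * s 2 * ⋯ * s (n - k)) ^ k` of the Weyl group of type `B (n - k)`. -/
def bElt (k n : ℕ) : (Fin (n - k) → ℤ) ≃ₗ[ℤ] (Fin (n - k) → ℤ) :=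
  (typeB (n - k)).elt (List.range' 1 (n - k)) ^ k

/-- The subposet of the positive root poset of type `B (n - k)` that consists of the positive roots
which `b k n` sends to negative roots. -/
def trapezoid (k n : ℕ) : Set (Fin (n - k) → ℤ) :=
  {β | β ∈ (typeB (n - k)).posRoots ∧ -(bElt k n β) ∈ (typeB (n - k)).posRoots}

/-- The order of the root poset of type `I 2 m`. -/
def rootLeI (m : ℕ) : (Fin 2 → ℝ) → (Fin 2 → ℝ) → Prop :=
  Relation.ReflTransGen ((typeI m).dihedralRel 0 1 m)

/-- The relations that generate the root poset of type `H 3`: those of the root poset of the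
parabolic subgroup of type `I 2 5` generated by `s 1, s 2`, whose chain starts
`α 2 < s 2 (α 1) < ⋯`, with `α 1` below `s 2 (α 1)`; those of the heap of the word
`s₃ s₂ s₁ s₂ s₁ s₃ s₂ s₁ s₂ s₃` of the longest element of the parabolic quotient; and `β` below
`s 3 β` for the positive roots `β` of the parabolic subgroup that `s 3` moves. -/
def rootRelH3 (β γ : Fin 3 → ℝ) : Prop :=
  typeH3.dihedralRel 1 0 5 β γ ∨
  typeH3.heapRel [2, 1, 0, 1, 0, 2, 1, 0, 1, 2] β γ ∨
  (β ∈ typeH3.posRoots ∧ β 2 = 0 ∧ typeH3.refl 2 β ≠ β ∧ γ = typeH3.refl 2 β)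

/-- The order of the root poset of type `H 3`. -/
def rootLeH3 : (Fin 3 → ℝ) → (Fin 3 → ℝ) → Prop := Relation.ReflTransGen rootRelH3

/-- The word `∏ j = 1, …, k, (s₁ or s₂ according as j is odd or even) * ∏ i = 3, …, n - 2 j + 2, sᵢ`;
below, `j` starts from `0` instead. -/
def wordB (k n : ℕ) : List ℕ :=
  (List.range k).flatMap fun j => (if Even j then 1 else 2) :: List.range' 3 (n - 2 * (j + 1))

/-- A word for type `E 7`. -/
def wordH : List ℕ := [1, 3, 4, 5, 6, 7, 2, 5, 6, 4, 5, 2, 3, 4, 1]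

/-- The word `s₂ₙ ⋯ s₄ s₃ s₁ s₂`. -/
def wordI (n : ℕ) : List ℕ := (List.range' 3 (2 * n - 2)).reverse ++ [1, 2]

/-- There is an injection `χ` of `P`, with the order relation `le`, into the poset `Λ`, which is an
isomorphism of the dual of `P` with its image, and whose image is the order ideal (straight shape)
`I` of `Λ`. -/
def DualEmbedsAsIdeal {V V' : Type} [LE V'] (P : Set V) (le : V → V → Prop) (Λ I : Set V') : Prop :=
  ∃ χ : P → Λ, Function.Injective χ ∧ (∀ a b : P, le a b ↔ χ b ≤ χ a) ∧
    IsLowerSet (Set.range χ) ∧ Set.range (fun a => (χ a : V')) = I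

end RootPosetEmbedding

set_option linter.unusedSectionVars false

namespace RootPosetEmbedding

namespace CartanDatum

/-! ### Reduced words, left descents and the recursion for their number -/

section Words

variable {n : ℕ} {R : Type} [CommRing R] (C : CartanDatum n R)

/-! The order statements are computations in coordinates. In types B and D the roots are e_a + e_b
with e_{-a} = -e_a, group elements act as signed permutations of the indices, and such a root is
positive exactly when a + b is. The inversions of w are then read off from the signed permutation of
w⁻¹, and one index set parametrises both posets with opposite orders. For H_3 everything takes place
in ℤ[φ] and is a finite check. In the dihedral case the roots are numbered by integers on which the
simple reflections act as p ↦ m - p and p ↦ m - 2 - p.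

The sets of reduced words are finite, so a bijection between them is an equality of cardinalities.
The tool is the recursion N(w) = ∑ N(s_i w) over the left descents i (`numRed_eq_sum`). For I_2(2n)
both counts are 2. For H_3 both are 286, computed with the numbers game, in which the position
records the heights of the roots w⁻¹ α_j (`numRed_eq_gameCount`).

The series B_{k,n} carries the real content. For a linear functional c, let S_c(w) be the sum of
c(β) N(w t_β) over the Bruhat covers w t_β of w. Stripping first letters gives the Chevalley-type
recursion S_c(w) = ∑ S_c(s_i w) + N(w) c(w⁻¹ ∑ α_i) (`coverSum_eq`). In type B_m the sum of the
simple roots is e_m. So if w fixes e_m and c is another coordinate, S_c(w) = 0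
(`coverSum_coordB_eq_zero`). When only two covers have nonzero weight, of opposite signs, their
numbers of reduced words agree (`numRed_typeB_eq`).

The inverse of b_{k,n} is the signed permutation -(c+1), …, -(c+k), 1, 2, … with c = n - 2k. It is
placed in rank n, so that the last value is fixed. Moves that replace the pair x, x + 1 by x + 2, x
in the sequence 1, …, k turn this sequence into 2k - 1, 2k - 3, …, 1 and preserve N
(`IsStageB.step`, `IsStageB.exists_stageSeq`). The result is increasing at positive arguments, with
negative values -(n-1), -(n-3), …. Such an element is determined by a strict partition, and so is
the inverse of the type D element, with the same parts. Descents are removable boxes of the shifted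
diagram in both types, so the counts agree (`GrassRel.numRed_eq`). -/

theorem inv_apply_apply (w : (Fin n → R) ≃ₗ[R] (Fin n → R)) (x : Fin n → R) : w⁻¹ (w x) = x :=
  w.symm_apply_apply x

theorem apply_inv_apply (w : (Fin n → R) ≃ₗ[R] (Fin n → R)) (x : Fin n → R) : w (w⁻¹ x) = x :=
  w.apply_symm_apply x

theorem refl_apply (i : Fin n) (v : Fin n → R) :
    C.refl i v = v - C.simpleCoroot i v • simpleRoot R i :=
  Module.reflection_apply _ _

theorem simpleCoroot_apply (i : Fin n) (v : Fin n → R) :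
    C.simpleCoroot i v = ∑ j, C.A j i * v j := by
  simp [simpleCoroot]

theorem simpleCoroot_simpleRoot_eq (i j : Fin n) :
    C.simpleCoroot i (simpleRoot R j) = C.A j i := by
  simp [simpleCoroot_apply, simpleRoot, Pi.single_apply]

theorem refl_refl (i : Fin n) (v : Fin n → R) : C.refl i (C.refl i v) = v :=
  Module.involutive_reflection (C.simpleCoroot_simpleRoot i) v

@[simp] theorem refl_mul_self (i : Fin n) : C.refl i * C.refl i = 1 :=
  LinearEquiv.ext (C.refl_refl i)

@[simp] theorem refl_inv (i : Fin n) : (C.refl i)⁻¹ = C.refl i :=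
  inv_eq_of_mul_eq_one_right (C.refl_mul_self i)

@[simp] theorem refl_mul_cancel (i : Fin n) (w : (Fin n → R) ≃ₗ[R] (Fin n → R)) :
    C.refl i * (C.refl i * w) = w := by
  rw [← mul_assoc, refl_mul_self, one_mul]

@[simp] theorem refl_simpleRoot_self (i : Fin n) :
    C.refl i (simpleRoot R i) = -simpleRoot R i := by
  rw [refl_apply, simpleCoroot_simpleRoot, two_smul]
  abel

theorem refl_apply_of_ne {i j : Fin n} (h : j ≠ i) (v : Fin n → R) : C.refl i v j = v j := by
  simp [refl_apply, simpleRoot, h]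

theorem refl_mem_W (i : Fin n) : C.refl i ∈ C.W := Subgroup.subset_closure ⟨i, rfl⟩

@[simp] theorem wordProd_nil : C.wordProd [] = 1 := rfl

@[simp] theorem wordProd_cons (i : Fin n) (l : List (Fin n)) :
    C.wordProd (i :: l) = C.refl i * C.wordProd l := by
  simp [wordProd]

theorem wordProd_append (l l' : List (Fin n)) :
    C.wordProd (l ++ l') = C.wordProd l * C.wordProd l' := by
  simp [wordProd]

theorem wordProd_reverse (l : List (Fin n)) : C.wordProd l.reverse = (C.wordProd l)⁻¹ := by
  induction l with
  | nil => simp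
  | cons i l ih => simp [wordProd_append, ih]

theorem wordProd_mem_W (l : List (Fin n)) : C.wordProd l ∈ C.W := by
  induction l with
  | nil => exact C.W.one_mem
  | cons i l ih => simpa using C.W.mul_mem (C.refl_mem_W i) ih

variable {C} {w : (Fin n → R) ≃ₗ[R] (Fin n → R)}

theorem refl_mul_mem_W (i : Fin n) (hw : w ∈ C.W) : C.refl i * w ∈ C.W :=
  C.W.mul_mem (C.refl_mem_W i) hw

theorem exists_word (hw : w ∈ C.W) : ∃ l, C.wordProd l = w := by
  induction hw using Subgroup.closure_induction with
  | mem x hx =>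
    obtain ⟨i, rfl⟩ := hx
    exact ⟨[i], by simp⟩
  | one => exact ⟨[], rfl⟩
  | mul x y _ _ hx hy =>
    obtain ⟨l, rfl⟩ := hx
    obtain ⟨l', rfl⟩ := hy
    exact ⟨l ++ l', C.wordProd_append l l'⟩
  | inv x _ hx =>
    obtain ⟨l, rfl⟩ := hx
    exact ⟨l.reverse, C.wordProd_reverse l⟩

theorem len_wordProd_le (l : List (Fin n)) : C.len (C.wordProd l) ≤ l.length :=
  Nat.sInf_le ⟨l, rfl, rfl⟩

theorem exists_reduced (hw : w ∈ C.W) : ∃ l, C.wordProd l = w ∧ l.length = C.len w := by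
  obtain ⟨l, hl⟩ := exists_word hw
  exact Nat.sInf_mem (s := {j | ∃ l : List (Fin n), C.wordProd l = w ∧ l.length = j})
    ⟨_, l, hl, rfl⟩

theorem len_one : C.len 1 = 0 := Nat.le_zero.mp (C.len_wordProd_le [])

theorem eq_one_of_len_eq_zero (hw : w ∈ C.W) (h : C.len w = 0) : w = 1 := by
  obtain ⟨l, hl, hl'⟩ := exists_reduced hw
  rw [h, List.length_eq_zero_iff] at hl'
  rw [← hl, hl', wordProd_nil]

theorem len_refl_mul_le (hw : w ∈ C.W) (i : Fin n) : C.len (C.refl i * w) ≤ C.len w + 1 := by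
  obtain ⟨l, rfl, hl'⟩ := exists_reduced hw
  rw [← hl', ← wordProd_cons]
  exact C.len_wordProd_le (i :: l)

theorem len_le_refl_mul (hw : w ∈ C.W) (i : Fin n) : C.len w ≤ C.len (C.refl i * w) + 1 := by
  simpa using len_refl_mul_le (refl_mul_mem_W i hw) i

variable (C) in
theorem Red_finite (w : (Fin n → R) ≃ₗ[R] (Fin n → R)) : (C.Red w).Finite :=
  (List.finite_length_eq (Fin n) (C.len w)).subset fun _ h => h.2

variable (C) in
/-- The number of reduced words. -/
noncomputable def numRed (w : (Fin n → R) ≃ₗ[R] (Fin n → R)) : ℕ := (C.Red w).ncard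

variable (C) in
/-- The left descents. -/
noncomputable def desc (w : (Fin n → R) ≃ₗ[R] (Fin n → R)) : Finset (Fin n) :=
  Finset.univ.filter fun i => C.len (C.refl i * w) < C.len w

theorem mem_desc {i : Fin n} : i ∈ C.desc w ↔ C.len (C.refl i * w) < C.len w := by
  simp [desc]

theorem mem_desc_iff_len (hw : w ∈ C.W) {i : Fin n} :
    i ∈ C.desc w ↔ C.len (C.refl i * w) + 1 = C.len w := by
  rw [mem_desc]
  have := len_le_refl_mul hw i
  omega

theorem mem_Red_nil_iff (hw : w ∈ C.W) : [] ∈ C.Red w ↔ w = 1 := by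
  constructor
  · rintro ⟨h, -⟩
    exact h.symm
  · rintro rfl
    exact ⟨rfl, len_one.symm⟩

/-- A reduced word is a choice of left descent followed by a reduced word of what remains; the
recursion for `numRed` is this fact in cardinalities. -/
theorem cons_mem_Red_iff (hw : w ∈ C.W) {i : Fin n} {l : List (Fin n)} :
    i :: l ∈ C.Red w ↔ i ∈ C.desc w ∧ l ∈ C.Red (C.refl i * w) := by
  rw [mem_desc_iff_len hw]
  constructor
  · rintro ⟨rfl, h2⟩
    have h3 := len_le_refl_mul hw i
    simp only [wordProd_cons, refl_mul_cancel, List.length_cons] at h2 h3 ⊢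
    have h4 := C.len_wordProd_le l
    exact ⟨by omega, rfl, by omega⟩
  · rintro ⟨h1, h2, h3⟩
    exact ⟨by rw [wordProd_cons, h2, refl_mul_cancel], by rw [List.length_cons, h3, h1]⟩

theorem numRed_one : C.numRed 1 = 1 := by
  rw [numRed, Set.ncard_eq_one]
  refine ⟨[], Set.eq_singleton_iff_unique_mem.mpr ⟨⟨rfl, len_one.symm⟩, ?_⟩⟩
  rintro l ⟨-, h⟩
  rwa [len_one, List.length_eq_zero_iff] at h

theorem numRed_eq_sum (hw : w ∈ C.W) (h1 : w ≠ 1) :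
    C.numRed w = ∑ i ∈ C.desc w, C.numRed (C.refl i * w) := by
  have h : C.Red w = ⋃ i ∈ (C.desc w : Set (Fin n)), List.cons i '' C.Red (C.refl i * w) := by
    ext l
    cases l with
    | nil => simp [mem_Red_nil_iff hw, h1]
    | cons i l => simp [cons_mem_Red_iff hw, and_comm]
  rw [numRed, h, Set.Finite.ncard_biUnion (Finset.finite_toSet _), finsum_mem_coe_finset]
  · exact Finset.sum_congr rfl fun i _ => Set.ncard_image_of_injective _ List.cons_injective
  · exact fun i _ => (C.Red_finite _).image _
  · intro i _ j _ hij
    refine Set.disjoint_left.mpr ?_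
    rintro _ ⟨l, -, rfl⟩ ⟨l', -, h'⟩
    exact hij (List.cons.inj h').1.symm

theorem desc_nonempty (hw : w ∈ C.W) (h1 : w ≠ 1) : (C.desc w).Nonempty := by
  obtain ⟨l, hl⟩ := exists_reduced hw
  cases l with
  | nil => exact absurd hl.1.symm h1
  | cons i l => exact ⟨i, ((cons_mem_Red_iff hw).mp hl).1⟩

theorem len_inv (w : (Fin n → R) ≃ₗ[R] (Fin n → R)) : C.len w⁻¹ = C.len w := by
  have h : ∀ v j, (∃ l : List (Fin n), C.wordProd l = v ∧ l.length = j) →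
      ∃ l : List (Fin n), C.wordProd l = v⁻¹ ∧ l.length = j := by
    rintro v j ⟨l, rfl, rfl⟩
    exact ⟨l.reverse, C.wordProd_reverse l, by simp⟩
  exact congrArg sInf (Set.ext fun j => ⟨fun hj => by simpa using h _ _ hj, h w j⟩)

theorem numRed_inv (w : (Fin n → R) ≃ₗ[R] (Fin n → R)) : C.numRed w⁻¹ = C.numRed w := by
  have h : C.Red w⁻¹ = List.reverse '' C.Red w := by
    ext l
    constructor
    · rintro ⟨h1, h2⟩
      exact ⟨l.reverse, ⟨by rw [wordProd_reverse, h1, inv_inv], by simp [h2, len_inv]⟩, by simp⟩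
    · rintro ⟨l, ⟨h1, h2⟩, rfl⟩
      exact ⟨by rw [wordProd_reverse, h1], by simp [h2, len_inv]⟩
  rw [numRed, h, Set.ncard_image_of_injective _ List.reverse_injective, numRed]

/-- All bijections of the main theorem arise here, from equality of two finite cardinalities; no
explicit correspondence of words is constructed. -/
theorem nonempty_Red_equiv {m : ℕ} {S : Type} [CommRing S] {C' : CartanDatum m S}
    {w' : (Fin m → S) ≃ₗ[S] (Fin m → S)} (h : C.numRed w = C'.numRed w') :
    Nonempty (C.Red w ≃ C'.Red w') := by
  have := (C.Red_finite w).to_subtype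
  have := (C'.Red_finite w').to_subtype
  exact Finite.card_eq.mp h

/-- Elements of two reflection groups have equally many reduced words if their descents are matched
by a relation that is compatible with the removal of descents. -/
theorem numRed_eq_of_rel {m : ℕ} {S : Type} [CommRing S] {C' : CartanDatum m S}
    (Rel : ((Fin n → R) ≃ₗ[R] (Fin n → R)) → ((Fin m → S) ≃ₗ[S] (Fin m → S)) → Prop)
    (hW : ∀ w w', Rel w w' → w ∈ C.W ∧ w' ∈ C'.W)
    (hdesc : ∀ w w', Rel w w' → ∃ f : Fin n → Fin m, Set.BijOn f (C.desc w) (C'.desc w') ∧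
      ∀ i ∈ C.desc w, Rel (C.refl i * w) (C'.refl (f i) * w'))
    {w : (Fin n → R) ≃ₗ[R] (Fin n → R)} {w' : (Fin m → S) ≃ₗ[S] (Fin m → S)} (h : Rel w w') :
    C.numRed w = C'.numRed w' := by
  induction hk : C.len w using Nat.strong_induction_on generalizing w w' with
  | _ k ih =>
    obtain ⟨hw, hw'⟩ := hW w w' h
    obtain ⟨f, hf, hr⟩ := hdesc w w' h
    by_cases h1 : w = 1
    · have h1' : w' = 1 := by
        by_contra h'
        obtain ⟨j, hj⟩ := desc_nonempty hw' h'
        obtain ⟨i, hi, -⟩ := hf.2.2 hj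
        rw [h1, Finset.mem_coe, mem_desc, len_one] at hi
        omega
      rw [h1, h1', numRed_one, numRed_one]
    · have h1' : w' ≠ 1 := by
        rintro rfl
        obtain ⟨i, hi⟩ := desc_nonempty hw h1
        have hj := hf.1 hi
        rw [Finset.mem_coe, mem_desc, len_one] at hj
        omega
      rw [numRed_eq_sum hw h1, numRed_eq_sum hw' h1']
      refine Finset.sum_bij (fun i _ => f i) (fun i hi => hf.1 hi)
        (fun i hi j hj hij => hf.2.1 hi hj hij) (fun j hj => ?_) (fun i hi => ?_)
      · obtain ⟨i, hi, hij⟩ := hf.2.2 hj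
        exact ⟨i, hi, hij⟩
      · exact ih _ (hk ▸ mem_desc.mp hi) (hr i hi) rfl

end Words

/-! ### Reflections, signs of roots and the exchange property -/

section Roots

variable {n : ℕ} {R : Type} [CommRing R] {C : CartanDatum n R}
  {w : (Fin n → R) ≃ₗ[R] (Fin n → R)} {β : Fin n → R}

theorem simpleRoot_mem_roots (i : Fin n) : simpleRoot R i ∈ C.roots :=
  ⟨1, C.W.one_mem, i, rfl⟩

theorem apply_mem_roots (hw : w ∈ C.W) (hβ : β ∈ C.roots) : w β ∈ C.roots := by
  obtain ⟨u, hu, i, rfl⟩ := hβ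
  exact ⟨w * u, C.W.mul_mem hw hu, i, rfl⟩

theorem inv_apply_mem_roots (hw : w ∈ C.W) (hβ : β ∈ C.roots) : w⁻¹ β ∈ C.roots :=
  apply_mem_roots (C.W.inv_mem hw) hβ

theorem neg_mem_roots (hβ : β ∈ C.roots) : -β ∈ C.roots := by
  obtain ⟨u, hu, i, rfl⟩ := hβ
  exact ⟨u * C.refl i, C.W.mul_mem hu (C.refl_mem_W i), i, by simp⟩

/-- To bound the set of roots, it suffices to find a set that contains the simple roots and is
stable under the simple reflections. -/
theorem roots_subset {S : Set (Fin n → R)} (h1 : ∀ i, simpleRoot R i ∈ S)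
    (h2 : ∀ i, ∀ β ∈ S, C.refl i β ∈ S) : C.roots ⊆ S := by
  rintro _ ⟨w, hw, j, rfl⟩
  obtain ⟨l, rfl⟩ := exists_word hw
  induction l with
  | nil => exact h1 j
  | cons i l ih =>
    rw [wordProd_cons]
    exact h2 i _ (ih (C.wordProd_mem_W l))

variable (C) in
/-- `t` is an element of the reflection group that acts as a reflection with root `β`. -/
def IsReflection (β : Fin n → R) (t : (Fin n → R) ≃ₗ[R] (Fin n → R)) : Prop :=
  t ∈ C.W ∧ ∃ f : Module.Dual R (Fin n → R), f β = 2 ∧ ∀ x, t x = x - f x • β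

theorem isReflection_refl (i : Fin n) : C.IsReflection (simpleRoot R i) (C.refl i) :=
  ⟨C.refl_mem_W i, C.simpleCoroot i, C.simpleCoroot_simpleRoot i, C.refl_apply i⟩

theorem IsReflection.conj {t : (Fin n → R) ≃ₗ[R] (Fin n → R)} (h : C.IsReflection β t)
    (hw : w ∈ C.W) : C.IsReflection (w β) (w * t * w⁻¹) := by
  obtain ⟨ht, f, hf, hx⟩ := h
  refine ⟨C.W.mul_mem (C.W.mul_mem hw ht) (C.W.inv_mem hw), f ∘ₗ (w⁻¹).toLinearMap, ?_, ?_⟩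
  · simp [hf]
  · intro x
    simp [hx]

theorem IsReflection.neg {t : (Fin n → R) ≃ₗ[R] (Fin n → R)} (h : C.IsReflection β t) :
    C.IsReflection (-β) t := by
  obtain ⟨ht, f, hf, hx⟩ := h
  exact ⟨ht, -f, by simp [hf], by simp [hx]⟩

variable (C) in
open Classical in
/-- The reflection with root `β`. -/
noncomputable def rho (β : Fin n → R) : (Fin n → R) ≃ₗ[R] (Fin n → R) :=
  if h : ∃ t, C.IsReflection β t then h.choose else 1

theorem exists_isReflection (hβ : β ∈ C.roots) : ∃ t, C.IsReflection β t := by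
  obtain ⟨w, hw, i, rfl⟩ := hβ
  exact ⟨_, (isReflection_refl i).conj hw⟩

theorem isReflection_rho (hβ : β ∈ C.roots) : C.IsReflection β (C.rho β) := by
  have h := exists_isReflection hβ
  rw [rho, dif_pos h]
  exact h.choose_spec

theorem rho_mem_W (hβ : β ∈ C.roots) : C.rho β ∈ C.W := (isReflection_rho hβ).1

theorem rho_apply_self (hβ : β ∈ C.roots) : C.rho β β = -β := by
  obtain ⟨-, f, hf, hx⟩ := isReflection_rho hβ
  rw [hx, hf, two_smul]
  abel

theorem rho_rho (hβ : β ∈ C.roots) (x : Fin n → R) : C.rho β (C.rho β x) = x := by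
  obtain ⟨-, f, hf, hx⟩ := isReflection_rho hβ
  simp only [hx, map_sub, map_smul, hf, smul_eq_mul]
  rw [sub_smul, mul_two, add_smul]
  abel

theorem rho_mul_self (hβ : β ∈ C.roots) : C.rho β * C.rho β = 1 :=
  LinearEquiv.ext (rho_rho hβ)

variable [LinearOrder R] [IsStrictOrderedRing R]

variable (C) in
/-- The datum is of finite type. -/
structure IsFiniteType : Prop where
  finite : C.roots.Finite
  sign : ∀ β ∈ C.roots, 0 ≤ β ∨ β ≤ 0
  reduced : ∀ i, ∀ c : R, 0 ≤ c → c • simpleRoot R i ∈ C.roots → c = 1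

theorem simpleRoot_nonneg (i : Fin n) : 0 ≤ simpleRoot R i := by
  simp [simpleRoot]

theorem simpleRoot_ne_zero (i : Fin n) : simpleRoot R i ≠ 0 := by
  simp [simpleRoot]

theorem ne_zero_of_mem_roots (hβ : β ∈ C.roots) : β ≠ 0 := by
  obtain ⟨w, hw, i, rfl⟩ := hβ
  simpa using simpleRoot_ne_zero i

theorem not_nonneg_neg (hβ : β ∈ C.roots) (h : 0 ≤ β) : ¬ 0 ≤ -β := fun h' =>
  ne_zero_of_mem_roots hβ (le_antisymm (neg_nonneg.mp h') h)

namespace IsFiniteType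

variable (H : C.IsFiniteType)
include H

theorem neg_nonneg_iff (hβ : β ∈ C.roots) : 0 ≤ -β ↔ ¬ 0 ≤ β := by
  constructor
  · intro h h'
    exact not_nonneg_neg hβ h' h
  · intro h
    exact neg_nonneg.mpr ((H.sign β hβ).resolve_left h)

/-- A simple reflection changes only the `i`-th coordinate. If the sign flips, all other coordinates
of `β` vanish, so `β` is a multiple of the simple root, and the system is reduced. -/
theorem refl_nonneg (hβ : β ∈ C.roots) (h0 : 0 ≤ β) {i : Fin n} (hi : β ≠ simpleRoot R i) :
    0 ≤ C.refl i β := by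
  by_contra h
  have h' : C.refl i β ≤ 0 :=
    (H.sign _ (apply_mem_roots (C.refl_mem_W i) hβ)).resolve_left h
  have hj : ∀ j, j ≠ i → β j = 0 := fun j hj =>
    le_antisymm ((C.refl_apply_of_ne hj β) ▸ h' j) (h0 j)
  have hβ' : β = β i • simpleRoot R i := by
    ext j
    by_cases hji : j = i
    · subst hji
      simp [simpleRoot]
    · simp [simpleRoot, hji, hj j hji]
  have := H.reduced i (β i) (h0 i) (hβ' ▸ hβ)
  rw [this, one_smul] at hβ'
  exact hi hβ'

/-- Two reflections with the same root that both preserve a finite spanning set coincide. Hence the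
choice made in `rho` is immaterial and `rho` is compatible with conjugation and with sign. -/
theorem isReflection_unique {t t' : (Fin n → R) ≃ₗ[R] (Fin n → R)}
    (h : C.IsReflection β t) (h' : C.IsReflection β t') : t = t' := by
  obtain ⟨ht, f, hf, hx⟩ := h
  obtain ⟨ht', f', hf', hx'⟩ := h'
  have hspan : Submodule.span R C.roots = ⊤ := by
    rw [eq_top_iff, ← (Pi.basisFun R (Fin n)).span_eq]
    refine Submodule.span_mono ?_
    rintro _ ⟨i, rfl⟩
    rw [Pi.basisFun_apply]
    exact simpleRoot_mem_roots i
  have hff : f = f' := by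
    refine Module.Dual.eq_of_preReflection_mapsTo H.finite hspan hf ?_ hf' ?_
    · intro x hx0
      rw [Module.preReflection_apply, ← hx]
      exact apply_mem_roots ht hx0
    · intro x hx0
      rw [Module.preReflection_apply, ← hx']
      exact apply_mem_roots ht' hx0
  ext1 x
  rw [hx, hx', hff]

theorem rho_eq {t : (Fin n → R) ≃ₗ[R] (Fin n → R)} (h : C.IsReflection β t) : C.rho β = t := by
  have h' : ∃ t, C.IsReflection β t := ⟨t, h⟩
  rw [rho, dif_pos h']
  exact H.isReflection_unique h'.choose_spec h

theorem rho_simpleRoot (i : Fin n) : C.rho (simpleRoot R i) = C.refl i :=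
  H.rho_eq (isReflection_refl i)

theorem rho_conj (hw : w ∈ C.W) (hβ : β ∈ C.roots) : C.rho (w β) = w * C.rho β * w⁻¹ :=
  H.rho_eq ((isReflection_rho hβ).conj hw)

theorem rho_neg (hβ : β ∈ C.roots) : C.rho (-β) = C.rho β :=
  H.rho_eq (isReflection_rho hβ).neg

theorem mul_rho_inv_simpleRoot (hw : w ∈ C.W) (i : Fin n) :
    w * C.rho (w⁻¹ (simpleRoot R i)) = C.refl i * w := by
  rw [H.rho_conj (C.W.inv_mem hw) (simpleRoot_mem_roots i), H.rho_simpleRoot]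
  group

/-- The strong exchange property. -/
theorem exists_shorter_word (hβ : β ∈ C.roots) (h0 : 0 ≤ β) (l : List (Fin n))
    (hl : ¬ 0 ≤ C.wordProd l β) :
    ∃ l' : List (Fin n), l'.length < l.length ∧ C.wordProd l' = C.wordProd l * C.rho β := by
  induction l with
  | nil => exact absurd h0 hl
  | cons i l ih =>
    -- Reading the word from the right, the positive root `β` must change sign at some letter `i`.
    -- Just before that letter it has become the `i`-th simple root, so deleting the letter amounts
    -- to multiplying by `rho β` on the right.
    by_cases h : 0 ≤ C.wordProd l β
    · have hw := C.wordProd_mem_W l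
      have hi : C.wordProd l β = simpleRoot R i := by
        by_contra hne
        exact hl (by simpa using H.refl_nonneg (apply_mem_roots hw hβ) h hne)
      refine ⟨l, by simp, ?_⟩
      have := H.rho_conj hw hβ
      rw [hi, H.rho_simpleRoot] at this
      rw [wordProd_cons, this]
      rw [inv_mul_cancel_right, mul_assoc, rho_mul_self hβ, mul_one]
    · obtain ⟨l', h1, h2⟩ := ih h
      exact ⟨i :: l', by simpa using h1, by simp [h2, mul_assoc]⟩

theorem len_mul_rho_lt (hw : w ∈ C.W) (hβ : β ∈ C.roots) (h0 : 0 ≤ β) (h : ¬ 0 ≤ w β) :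
    C.len (w * C.rho β) < C.len w := by
  obtain ⟨l, rfl, hl⟩ := exists_reduced hw
  obtain ⟨l', h1, h2⟩ := H.exists_shorter_word hβ h0 l h
  rw [← h2, ← hl]
  exact (C.len_wordProd_le l').trans_lt h1

theorem lt_len_mul_rho (hw : w ∈ C.W) (hβ : β ∈ C.roots) (h0 : 0 ≤ β) (h : 0 ≤ w β) :
    C.len w < C.len (w * C.rho β) := by
  have hw' : w * C.rho β ∈ C.W := C.W.mul_mem hw (rho_mem_W hβ)
  have h' : ¬ 0 ≤ (w * C.rho β) β := by
    rw [LinearEquiv.mul_apply, rho_apply_self hβ, map_neg]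
    exact not_nonneg_neg (apply_mem_roots hw hβ) h
  have := H.len_mul_rho_lt hw' hβ h0 h'
  rwa [mul_assoc, rho_mul_self hβ, mul_one] at this

theorem lt_len_mul_rho_iff (hw : w ∈ C.W) (hβ : β ∈ C.roots) (h0 : 0 ≤ β) :
    C.len w < C.len (w * C.rho β) ↔ 0 ≤ w β := by
  refine ⟨fun h => ?_, H.lt_len_mul_rho hw hβ h0⟩
  by_contra h'
  exact lt_asymm h (H.len_mul_rho_lt hw hβ h0 h')

/-- Left multiplication by s_i is right multiplication by the reflection in w⁻¹ α_i, so the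
criterion for right multiplication applies, to the opposite root if w⁻¹ α_i is negative. -/
theorem lt_len_refl_mul_iff (hw : w ∈ C.W) (i : Fin n) :
    C.len w < C.len (C.refl i * w) ↔ 0 ≤ w⁻¹ (simpleRoot R i) := by
  have hβ := inv_apply_mem_roots hw (simpleRoot_mem_roots (C := C) i)
  have e := apply_inv_apply w (simpleRoot R i)
  rw [← H.mul_rho_inv_simpleRoot hw]
  constructor
  · intro h
    by_contra h'
    have h2 := H.len_mul_rho_lt hw (neg_mem_roots hβ) ((H.neg_nonneg_iff hβ).mpr h') (by
      rw [map_neg, e]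
      exact not_nonneg_neg (simpleRoot_mem_roots (C := C) i) (simpleRoot_nonneg i))
    rw [H.rho_neg hβ] at h2
    exact lt_asymm h h2
  · intro h
    exact H.lt_len_mul_rho hw hβ h (by rw [e]; exact simpleRoot_nonneg i)

/-- Replacing w by s_i w negates w⁻¹ α_i, so at equal lengths the sign criterion would answer the
same question in two opposite ways. -/
theorem len_refl_mul_ne (hw : w ∈ C.W) (i : Fin n) : C.len (C.refl i * w) ≠ C.len w := by
  intro h
  have h1 := H.lt_len_refl_mul_iff hw i
  have h2 := H.lt_len_refl_mul_iff (refl_mul_mem_W i hw) i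
  rw [refl_mul_cancel] at h2
  rw [h] at h1 h2
  have e : (C.refl i * w)⁻¹ (simpleRoot R i) = -(w⁻¹ (simpleRoot R i)) := by
    simp [mul_inv_rev]
  rw [e, H.neg_nonneg_iff (inv_apply_mem_roots hw (simpleRoot_mem_roots i)), ← h1] at h2
  exact (h2.mpr (lt_irrefl _)).false

theorem mem_desc_iff (hw : w ∈ C.W) (i : Fin n) :
    i ∈ C.desc w ↔ ¬ 0 ≤ w⁻¹ (simpleRoot R i) := by
  rw [mem_desc, ← H.lt_len_refl_mul_iff hw]
  have := H.len_refl_mul_ne hw i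
  omega

theorem eq_one_of_nonneg (hw : w ∈ C.W) (h : ∀ i, 0 ≤ w⁻¹ (simpleRoot R i)) : w = 1 := by
  by_contra h1
  obtain ⟨i, hi⟩ := desc_nonempty hw h1
  exact (H.mem_desc_iff hw i).mp hi (h i)

theorem W_finite : (C.W : Set ((Fin n → R) ≃ₗ[R] (Fin n → R))).Finite := by
  refine Set.Finite.of_finite_image (f := fun w i => w (simpleRoot R i))
    ((Set.Finite.pi' fun _ : Fin n => H.finite).subset ?_) ?_
  · rintro _ ⟨w, hw, rfl⟩ i
    exact apply_mem_roots hw (simpleRoot_mem_roots i)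
  · intro w _ w' _ h
    refine LinearEquiv.toLinearMap_injective (LinearMap.pi_ext' fun i => ?_)
    ext
    exact congrFun (congrFun h i) _

/-- If `-1` is in the reflection group then it is the longest element. -/
theorem isLongest_neg_one {w₀ : (Fin n → R) ≃ₗ[R] (Fin n → R)} (hw₀ : w₀ ∈ C.W)
    (hneg : ∀ x, w₀ x = -x) : C.IsLongest w₀ := by
  -- If no letter lengthens v, every v⁻¹ α_i is negative. Since w₀ = -1, every (w₀ v)⁻¹ α_i is then
  -- positive, so w₀ v has no descent and equals 1. Only w₀ can therefore have maximal length, and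
  -- the maximum exists because the group is finite.
  have key : ∀ v ∈ C.W, v ≠ w₀ → ∃ i, C.len v < C.len (C.refl i * v) := by
    intro v hv hne
    by_contra! h
    have h2 : w₀ * v = 1 := by
      refine H.eq_one_of_nonneg (C.W.mul_mem hw₀ hv) fun i => ?_
      have h3 := mt (H.lt_len_refl_mul_iff hv i).mpr (not_lt.mpr (h i))
      have e : (w₀ * v)⁻¹ (simpleRoot R i) = -(v⁻¹ (simpleRoot R i)) := by
        have : w₀⁻¹ (simpleRoot R i) = -simpleRoot R i := by
          have hx : w₀ (-simpleRoot R i) = simpleRoot R i := by simp [hneg]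
          conv_lhs => rw [← hx]
          rw [inv_apply_apply]
        rw [mul_inv_rev, LinearEquiv.mul_apply, this, map_neg]
      rw [e, H.neg_nonneg_iff (inv_apply_mem_roots hv (simpleRoot_mem_roots i))]
      exact h3
    apply hne
    have h4 : w₀ * w₀ = 1 := LinearEquiv.ext fun x => by simp [hneg]
    exact mul_left_cancel (h2.trans h4.symm)
  obtain ⟨v₁, hv₁, hmax⟩ := Set.exists_max_image _ C.len H.W_finite ⟨1, C.W.one_mem⟩
  have h1 : v₁ = w₀ := by
    by_contra hne
    obtain ⟨i, hi⟩ := key v₁ hv₁ hne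
    exact absurd (hmax _ (refl_mul_mem_W i hv₁)) (not_le.mpr hi)
  subst h1
  refine ⟨hw₀, fun v hv hne => ?_⟩
  obtain ⟨i, hi⟩ := key v hv hne
  exact hi.trans_le (hmax _ (refl_mul_mem_W i hv))

/-- Conjugate `γ` to a simple root: a root negated by a simple reflection is plus or minus that
simple root, because all other roots keep their sign. -/
theorem rho_injOn {γ : Fin n → R} (hβ : β ∈ C.roots) (hγ : γ ∈ C.roots)
    (h : C.rho β = C.rho γ) : β = γ ∨ β = -γ := by
  obtain ⟨u, hu, i, rfl⟩ := hγ
  have hδ := inv_apply_mem_roots hu hβ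
  have e : C.refl i (u⁻¹ β) = -(u⁻¹ β) := by
    have h1 := rho_apply_self hδ
    rwa [H.rho_conj (C.W.inv_mem hu) hβ, h, H.rho_conj hu (simpleRoot_mem_roots i),
      H.rho_simpleRoot, inv_inv, show u⁻¹ * (u * C.refl i * u⁻¹) * u = C.refl i by group] at h1
  have e2 := apply_inv_apply u β
  rcases H.sign _ hδ with hs | hs
  · left
    by_contra hne
    have := H.refl_nonneg hδ hs (i := i) (fun h' => hne (by rw [← h', e2]))
    rw [e] at this
    exact not_nonneg_neg hδ hs this
  · right
    by_contra hne
    have hs' := neg_nonneg.mpr hs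
    have := H.refl_nonneg (neg_mem_roots hδ) hs' (i := i)
      (fun h' => hne (by rw [← h', map_neg, e2, neg_neg]))
    rw [map_neg, e, neg_neg] at this
    exact not_nonneg_neg (neg_mem_roots hδ) hs' (by rwa [neg_neg])

end IsFiniteType

end Roots

end CartanDatum

namespace CartanDatum

/-! ### A Chevalley-type identity for the reduced words of Bruhat covers -/

section Chevalley

variable {n : ℕ} {R : Type} [CommRing R] {C : CartanDatum n R}
  {w : (Fin n → R) ≃ₗ[R] (Fin n → R)} {β : Fin n → R}
  [LinearOrder R] [IsStrictOrderedRing R]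

namespace IsFiniteType

variable (H : C.IsFiniteType)
include H

theorem posRoots_finite : C.posRoots.Finite := H.finite.subset fun _ h => h.1

/-- The positive roots as a finite set. -/
noncomputable def posFinset : Finset (Fin n → R) := H.posRoots_finite.toFinset

theorem mem_posFinset : β ∈ H.posFinset ↔ β ∈ C.roots ∧ 0 ≤ β := by
  rw [posFinset, Set.Finite.mem_toFinset]
  rfl

open Classical in
/-- The sum over the covers `w * t` of `w` in the Bruhat order of the numbers of their reduced words,
weighted by the value of a functional at the root of `t`. -/
noncomputable def coverSum (c : Module.Dual R (Fin n → R)) (w : (Fin n → R) ≃ₗ[R] (Fin n → R)) :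
    R :=
  ∑ β ∈ H.posFinset,
    if C.len (w * C.rho β) = C.len w + 1 then c β * (C.numRed (w * C.rho β) : R) else 0

/-- This is the lifting property. If the two conditions disagreed, the roots w β and s_i w β would
have opposite signs, so w β would be plus or minus α_i. Then w t_β = s_i w, which is excluded by
`hne`. -/
theorem desc_iff_of_ne (hw : w ∈ C.W) (hβ : β ∈ C.roots) (h0 : 0 ≤ β) {i : Fin n}
    (hlen : C.len (C.refl i * (w * C.rho β)) = C.len w) (hne : C.refl i * (w * C.rho β) ≠ w) :
    C.len (w * C.rho β) = C.len w + 1 ↔ C.len (C.refl i * w) + 1 = C.len w := by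
  have hr := rho_mem_W hβ
  have h1 := len_refl_mul_le (C.W.mul_mem hw hr) i
  have h2 := len_le_refl_mul (C.W.mul_mem hw hr) i
  have h3 := len_refl_mul_le hw i
  have h4 := len_le_refl_mul hw i
  have h5 := H.len_refl_mul_ne (C.W.mul_mem hw hr) i
  have h6 := H.len_refl_mul_ne hw i
  have hb := H.lt_len_mul_rho_iff hw hβ h0
  have hb' := H.lt_len_mul_rho_iff (refl_mul_mem_W i hw) hβ h0
  rw [mul_assoc, LinearEquiv.mul_apply] at hb'
  have hwβ := apply_mem_roots hw hβ
  by_contra hcon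
  have hcase : (C.len (w * C.rho β) = C.len w + 1 ∧ C.len (C.refl i * w) = C.len w + 1) ∨
      (C.len (w * C.rho β) + 1 = C.len w ∧ C.len (C.refl i * w) + 1 = C.len w) := by
    omega
  have hi : w β = simpleRoot R i ∨ -w β = simpleRoot R i := by
    rcases hcase with ⟨ha, hb2⟩ | ⟨ha, hb2⟩
    · left
      by_contra h'
      have := H.refl_nonneg hwβ (hb.mp (by omega)) h'
      have := hb'.mpr this
      omega
    · right
      by_contra h'
      have h7 : ¬ 0 ≤ w β := fun h => by
        have := hb.mpr h
        omega
      have := H.refl_nonneg (neg_mem_roots hwβ) ((H.neg_nonneg_iff hwβ).mpr h7) h'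
      rw [map_neg, H.neg_nonneg_iff (apply_mem_roots (C.refl_mem_W i) hwβ)] at this
      exact this (hb'.mp (by omega))
  have hri : C.rho (w β) = C.refl i := by
    rcases hi with hi | hi
    · rw [hi, H.rho_simpleRoot]
    · rw [← H.rho_neg hwβ, hi, H.rho_simpleRoot]
  apply hne
  rw [← hri, H.rho_conj hw hβ]
  simp only [mul_assoc, inv_mul_cancel_left]
  rw [rho_mul_self hβ, mul_one]

/-- Chevalley's formula, at the level of numbers of reduced words: the recursion. -/
theorem coverSum_eq (c : Module.Dual R (Fin n → R)) (hw : w ∈ C.W) :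
    H.coverSum c w = ∑ i ∈ C.desc w, H.coverSum c (C.refl i * w) +
      C.numRed w * c (w⁻¹ (∑ i, simpleRoot R i)) := by
  classical
  -- `T β i` is the contribution of `β` after its first letter `i` is removed. The two sums over
  -- covers are sums of the same `T β i`, once over the pairs with w t_β covering w and once over
  -- those with s_i w covered by w.
  let T : (Fin n → R) → Fin n → R := fun β i =>
    if C.len (C.refl i * (w * C.rho β)) = C.len w then
      c β * (C.numRed (C.refl i * (w * C.rho β)) : R) else 0
  have e1 : H.coverSum c w = ∑ i, ∑ β ∈ H.posFinset,
      if C.len (w * C.rho β) = C.len w + 1 then T β i else 0 := by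
    rw [Finset.sum_comm]
    refine Finset.sum_congr rfl fun β hβ => ?_
    obtain ⟨hβ, h0⟩ := H.mem_posFinset.mp hβ
    split_ifs with h
    · have hwr := C.W.mul_mem hw (rho_mem_W hβ)
      have hne : w * C.rho β ≠ 1 := by
        intro h1
        rw [h1, len_one] at h
        omega
      rw [numRed_eq_sum hwr hne, Nat.cast_sum, Finset.mul_sum, desc, Finset.sum_filter]
      refine Finset.sum_congr rfl fun i _ => ?_
      have h2 := len_le_refl_mul hwr i
      have h3 : C.len (C.refl i * (w * C.rho β)) < C.len (w * C.rho β) ↔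
        C.len (C.refl i * (w * C.rho β)) = C.len w := by omega
      simp only [T, h3]
    · simp
  have e2 : ∑ i ∈ C.desc w, H.coverSum c (C.refl i * w) = ∑ i, ∑ β ∈ H.posFinset,
      if C.len (C.refl i * w) + 1 = C.len w then T β i else 0 := by
    rw [desc, Finset.sum_filter]
    refine Finset.sum_congr rfl fun i _ => ?_
    by_cases h : C.len (C.refl i * w) + 1 = C.len w
    · rw [if_pos (by omega), coverSum]
      refine Finset.sum_congr rfl fun β _ => ?_
      rw [if_pos h, h, mul_assoc]
    · have := len_le_refl_mul hw i
      rw [if_neg (by omega)]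
      simp [h]
  rw [e1, e2, map_sum, map_sum, Finset.mul_sum, ← Finset.sum_add_distrib]
  refine Finset.sum_congr rfl fun i _ => ?_
  have hα := inv_apply_mem_roots hw (simpleRoot_mem_roots (C := C) i)
  rw [← sub_eq_iff_eq_add', ← Finset.sum_sub_distrib]
  -- For fixed `i` the two conditions differ at a single root: the positive one among ±w⁻¹ α_i, for
  -- which s_i w t_γ = w. It enters one sum or the other according to its sign, which yields N(w)
  -- c(w⁻¹ α_i) in both cases.
  obtain ⟨γ, hγ, hγ0, hγ'⟩ : ∃ γ ∈ C.roots, 0 ≤ γ ∧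
      (w⁻¹ (simpleRoot R i) = γ ∨ w⁻¹ (simpleRoot R i) = -γ) := by
    rcases H.sign _ hα with h | h
    · exact ⟨_, hα, h, Or.inl rfl⟩
    · exact ⟨_, neg_mem_roots hα, neg_nonneg.mpr h, Or.inr (neg_neg _).symm⟩
  have hργ : w * C.rho γ = C.refl i * w := by
    rw [← H.mul_rho_inv_simpleRoot hw]
    rcases hγ' with h | h
    · rw [h]
    · rw [h, H.rho_neg hγ]
  rw [Finset.sum_eq_single γ]
  · have hT : T γ i = c γ * C.numRed w := by
      simp only [T, hργ, refl_mul_cancel, if_true]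
    rw [hT, hργ]
    have h1 := len_refl_mul_le hw i
    have h2 := len_le_refl_mul hw i
    have h3 := H.len_refl_mul_ne hw i
    have h4 := H.lt_len_refl_mul_iff hw i
    rcases hγ' with h | h
    · have := h4.mpr (h ▸ hγ0)
      rw [if_pos (by omega), if_neg (by omega), h]
      ring
    · have := mt h4.mp (h ▸ not_nonneg_neg hγ hγ0)
      rw [if_neg (by omega), if_pos (by omega), h, map_neg]
      ring
  · intro β hβ hne
    obtain ⟨hβ, h0⟩ := H.mem_posFinset.mp hβ
    by_cases hT : C.len (C.refl i * (w * C.rho β)) = C.len w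
    · have hw' : C.refl i * (w * C.rho β) ≠ w := by
        intro h
        have h5 : w * C.rho β = w * C.rho γ := by
          rw [hργ]
          conv_rhs => rw [← h]
          rw [refl_mul_cancel]
        rcases H.rho_injOn hβ hγ (mul_left_cancel h5) with h6 | h6
        · exact hne h6
        · rw [h6] at h0
          exact not_nonneg_neg hγ hγ0 h0
      simp only [H.desc_iff_of_ne hw hβ h0 hT hw', sub_self]
    · simp [T, hT]
  · exact fun h => absurd (H.mem_posFinset.mpr ⟨hγ, hγ0⟩) h

/-- A functional that vanishes on `w⁻¹` applied to the sum of the simple roots, and does so hereditarily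
in the left weak order, has cover sum zero. -/
theorem coverSum_eq_zero (c : Module.Dual R (Fin n → R))
    (p : ((Fin n → R) ≃ₗ[R] (Fin n → R)) → Prop)
    (hp : ∀ w ∈ C.W, p w → ∀ i ∈ C.desc w, p (C.refl i * w))
    (hc : ∀ w ∈ C.W, p w → c (w⁻¹ (∑ i, simpleRoot R i)) = 0) (hw : w ∈ C.W) (h : p w) :
    H.coverSum c w = 0 := by
  induction hk : C.len w using Nat.strong_induction_on generalizing w with
  | _ k ih =>
    rw [H.coverSum_eq c hw, hc w hw h, mul_zero, add_zero]
    exact Finset.sum_eq_zero fun i hi =>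
      ih _ (hk ▸ mem_desc.mp hi) (refl_mul_mem_W i hw) (hp w hw h i hi) rfl

/-- If a positive root is the sum of two positive roots of a subsystem of type `A₂`, all of which `w`
preserves the positivity of, then it does not give a cover. -/
theorem len_mul_rho_ne_of_add {γ δ : Fin n → R} (hw : w ∈ C.W)
    (hγ : γ ∈ C.roots) (hδ : δ ∈ C.roots) (hγ0 : 0 ≤ γ) (hδ0 : 0 ≤ δ)
    (hγδ : C.rho γ δ = γ + δ) (h1 : 0 ≤ w γ) (h2 : 0 ≤ w δ)
    (hδγ : C.rho δ γ = γ + δ) :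
    C.len (w * C.rho (γ + δ)) ≠ C.len w + 1 := by
  have hrγ := rho_mem_W hγ
  have hrδ := rho_mem_W hδ
  -- Each of the three reflections increases the length when multiplied on in turn, so the total
  -- increase is at least 3.
  have e1 : C.rho (γ + δ) = C.rho γ * C.rho δ * C.rho γ := by
    rw [← hγδ, H.rho_conj hrγ hδ]
    congr 1
    exact inv_eq_of_mul_eq_one_right (rho_mul_self hγ)
  have h3 := H.lt_len_mul_rho hw hγ hγ0 h1
  have h4 := H.lt_len_mul_rho (C.W.mul_mem hw hrγ) hδ hδ0 (by
    rw [LinearEquiv.mul_apply, hγδ, map_add]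
    exact add_nonneg h1 h2)
  have h5 := H.lt_len_mul_rho (C.W.mul_mem (C.W.mul_mem hw hrγ) hrδ) hγ hγ0 (by
    rw [LinearEquiv.mul_apply, LinearEquiv.mul_apply, hδγ, ← hγδ, rho_rho hγ]
    exact h2)
  rw [e1, ← mul_assoc, ← mul_assoc]
  omega

end IsFiniteType

end Chevalley

end CartanDatum

open CartanDatum

/-! ### Type B: roots as e_a + e_b, reflections as signed permutations -/

/-- The extension of a vector by zero. -/
def extZero {m : ℕ} (v : Fin m → ℤ) (p : ℕ) : ℤ := if h : p < m then v ⟨p, h⟩ else 0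

theorem sum_ite_val_eq {m : ℕ} (v : Fin m → ℤ) (p : ℕ) :
    ∑ j : Fin m, (if (j : ℕ) = p then v j else 0) = extZero v p := by
  unfold extZero
  split_ifs with h
  · rw [Finset.sum_eq_single ⟨p, h⟩]
    · simp
    · intro j _ hj
      rw [if_neg]
      exact fun h' => hj (Fin.ext h')
    · simp
  · refine Finset.sum_eq_zero fun j _ => if_neg ?_
    have := j.2
    omega

theorem extZero_val {m : ℕ} (v : Fin m → ℤ) (i : Fin m) : extZero v i = v i := by
  simp [extZero]

/-- The coordinates of `e a` in type `B`, where `e (-a) = -e a`. -/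
def unitB (a : ℤ) (p : ℕ) : ℤ := if (p : ℤ) < a then 1 else if a < -(p : ℤ) then -1 else 0

/-- The vector `e a` in type `B`, where `e (-a) = -e a`. -/
def vecB (m : ℕ) (a : ℤ) : Fin m → ℤ := fun i => unitB a i

/-- The simple reflections in type `B` as permutations of the indices of the vectors `e a`. -/
def tauB (y : ℕ) (a : ℤ) : ℤ :=
  if y = 0 then (if a = 1 then -1 else if a = -1 then 1 else a)
  else if a = y then y + 1 else if a = y + 1 then y else if a = -y then -(y + 1)
  else if a = -(y + 1) then -y else a

theorem unitB_neg (a : ℤ) (p : ℕ) : unitB (-a) p = -unitB a p := by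
  unfold unitB
  split_ifs <;> omega

theorem vecB_neg (m : ℕ) (a : ℤ) : vecB m (-a) = -vecB m a :=
  funext fun _ => unitB_neg _ _

theorem tauB_neg (y : ℕ) (a : ℤ) : tauB y (-a) = -tauB y a := by
  unfold tauB
  split_ifs <;> omega

theorem tauB_tauB (y : ℕ) (a : ℤ) : tauB y (tauB y a) = a := by
  grind [tauB]

theorem extZero_vecB {m : ℕ} {a : ℤ} (ha : -m ≤ a ∧ a ≤ m) (p : ℕ) :
    extZero (vecB m a) p = unitB a p := by
  unfold extZero vecB unitB
  split_ifs <;> omega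

theorem simpleCoroot_typeB {m : ℕ} (i : Fin m) (v : Fin m → ℤ) :
    (typeB m).simpleCoroot i v = 2 * v i
      - (if (i : ℕ) = 0 then 2 else 1) * extZero v (i + 1)
      - (if (i : ℕ) = 0 then 0 else extZero v (i - 1)) := by
  have h : ∀ j : Fin m, (typeB m).A j i * v j = 2 * (if (j : ℕ) = i then v j else 0)
      - (if (i : ℕ) = 0 then 2 else 1) * (if (j : ℕ) = i + 1 then v j else 0)
      - (if (i : ℕ) = 0 then 0 else if (j : ℕ) = i - 1 then v j else 0) := by
    intro j
    have hi := i.2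
    have hj := j.2
    have hA : (typeB m).A j i = if (j : ℕ) = i then 2 else
        if (j : ℕ) = i + 1 then (if (i : ℕ) = 0 then -2 else -1)
        else if (i : ℕ) = j + 1 then -1 else 0 := by
      simp only [typeB, Matrix.submatrix_apply, CartanMatrix.B, Matrix.of_apply, Fin.ext_iff,
        Fin.val_rev]
      split_ifs <;> omega
    rw [hA]
    split_ifs <;> omega
  rw [simpleCoroot_apply, Finset.sum_congr rfl fun j _ => h j, Finset.sum_sub_distrib,
    Finset.sum_sub_distrib, ← Finset.mul_sum, ← Finset.mul_sum, sum_ite_val_eq, sum_ite_val_eq,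
    extZero_val]
  split_ifs
  · simp
  · rw [sum_ite_val_eq]

theorem unitB_tauB_self {y : ℕ} (a : ℤ) :
    unitB (tauB y a) y = unitB a y - (2 * unitB a y
      - (if y = 0 then 2 else 1) * unitB a (y + 1) - (if y = 0 then 0 else unitB a (y - 1))) := by
  rcases Nat.eq_zero_or_pos y with rfl | hy
  · grind [unitB, tauB]
  · have h1 : ((y - 1 : ℕ) : ℤ) = y - 1 := by omega
    have hy0 : y ≠ 0 := by omega
    grind [unitB, tauB]

theorem unitB_tauB_of_ne {y p : ℕ} (h : p ≠ y) (a : ℤ) : unitB (tauB y a) p = unitB a p := by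
  grind [unitB, tauB]

theorem refl_vecB {m : ℕ} (i : Fin m) {a : ℤ} (ha : -m ≤ a ∧ a ≤ m) :
    (typeB m).refl i (vecB m a) = vecB m (tauB i a) := by
  ext p
  by_cases h : p = i
  · subst h
    rw [refl_apply, simpleCoroot_typeB, extZero_vecB ha, extZero_vecB ha]
    simp only [Pi.sub_apply, Pi.smul_apply, simpleRoot, Pi.single_eq_same, vecB, smul_eq_mul,
      mul_one]
    rw [unitB_tauB_self]
  · rw [refl_apply_of_ne _ h]
    exact (unitB_tauB_of_ne (fun h' => h (Fin.ext h')) a).symm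

theorem tauB_mem {m : ℕ} (i : Fin m) {a : ℤ} (ha : -m ≤ a ∧ a ≤ m) :
    -m ≤ tauB i a ∧ tauB i a ≤ m := by
  have := i.2
  unfold tauB
  split_ifs <;> omega

/-- Since `vecB m 0 = 0`, the short simple root e_1 is covered by the same formula. Allowing the
index 0 likewise puts the short roots among the sums e_a + e_b. -/
theorem simpleRoot_typeB {m : ℕ} (i : Fin m) :
    simpleRoot ℤ i = vecB m (i + 1) - vecB m i := by
  ext p
  simp only [simpleRoot, Pi.single_apply, Fin.ext_iff, vecB, unitB, Pi.sub_apply]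
  split_ifs <;> omega

theorem vecB_add_nonneg {m : ℕ} {a b : ℤ} (h : 0 ≤ a + b) : 0 ≤ vecB m a + vecB m b := by
  intro i
  simp only [Pi.zero_apply, Pi.add_apply, vecB, unitB]
  split_ifs <;> omega

theorem vecB_add_ne_zero {m : ℕ} {a b : ℤ} (ha : -m ≤ a ∧ a ≤ m) (hb : -m ≤ b ∧ b ≤ m)
    (hab : a ≠ -b) : vecB m a + vecB m b ≠ 0 := by
  intro h
  have h1 : ∀ p < m, unitB a p + unitB b p = 0 := fun p hp => congrFun h ⟨p, hp⟩
  have key : ∀ a b : ℤ, -(m : ℤ) ≤ a ∧ a ≤ m → -(m : ℤ) ≤ b ∧ b ≤ m → 0 < a + b →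
      (∀ p < m, unitB a p + unitB b p = 0) → False := by
    intro a b ha hb hab h1
    rcases le_total a b with h | h
    · have := h1 (b.toNat - 1) (by omega)
      unfold unitB at this
      split_ifs at this <;> omega
    · have := h1 (a.toNat - 1) (by omega)
      unfold unitB at this
      split_ifs at this <;> omega
  rcases lt_trichotomy 0 (a + b) with h2 | h2 | h2
  · exact key a b ha hb h2 h1
  · omega
  · refine key (-a) (-b) (by omega) (by omega) (by omega) fun p hp => ?_
    rw [unitB_neg, unitB_neg]
    have := h1 p hp
    omega

theorem vecB_add_nonneg_iff {m : ℕ} {a b : ℤ} (ha : -m ≤ a ∧ a ≤ m) (hb : -m ≤ b ∧ b ≤ m) :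
    0 ≤ vecB m a + vecB m b ↔ 0 ≤ a + b := by
  refine ⟨fun h => ?_, vecB_add_nonneg⟩
  by_contra h'
  have h2 : 0 ≤ vecB m (-a) + vecB m (-b) := vecB_add_nonneg (by omega)
  rw [vecB_neg, vecB_neg, ← neg_add] at h2
  exact vecB_add_ne_zero ha hb (by omega) (le_antisymm (neg_nonneg.mp h2) h)

/-- The index pairs of the roots `e a + e b` in type `B`. -/
def IsIdxB (m : ℕ) (a b : ℤ) : Prop :=
  (-m ≤ a ∧ a ≤ m) ∧ (-m ≤ b ∧ b ≤ m) ∧ a ≠ b ∧ a ≠ -b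

/-- After normalising to |b| < a, some simple reflection lowers a + b while keeping this shape,
unless b = 1 - a, when the vector is a simple root. -/
theorem vecB_add_mem_roots {m : ℕ} {a b : ℤ} (h : IsIdxB m a b) :
    vecB m a + vecB m b ∈ (typeB m).roots := by
  have step : ∀ {a b : ℤ} (y : ℕ) (_ : y < m), IsIdxB m a b →
      vecB m (tauB y a) + vecB m (tauB y b) ∈ (typeB m).roots →
      vecB m a + vecB m b ∈ (typeB m).roots := by
    intro a b y hy hI h
    have := apply_mem_roots ((typeB m).refl_mem_W ⟨y, hy⟩) h
    rw [← refl_vecB ⟨y, hy⟩ hI.1, ← refl_vecB ⟨y, hy⟩ hI.2.1, ← map_add, refl_refl] at this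
    exact this
  have key : ∀ k : ℕ, ∀ a b : ℤ, IsIdxB m a b → |b| < a → a + b = k →
      vecB m a + vecB m b ∈ (typeB m).roots := by
    intro k
    induction k using Nat.strong_induction_on with
    | _ k ih =>
      intro a b hI hab hk
      obtain ⟨h1, h2⟩ := abs_lt.mp hab
      have hI' := hI
      obtain ⟨ha, hb, hne, hne'⟩ := hI'
      have go : ∀ (y : ℕ) (_ : y < m) (a' b' : ℤ), tauB y a = a' → tauB y b = b' → |b'| < a' →
          a' + b' < a + b → vecB m a + vecB m b ∈ (typeB m).roots := by
        intro y hy a' b' ea eb hab' hlt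
        have hm := tauB_mem ⟨y, hy⟩ ha
        have hm' := tauB_mem ⟨y, hy⟩ hb
        simp only [ea, eb] at hm hm'
        have := abs_lt.mp hab'
        refine step y hy hI ?_
        rw [ea, eb]
        exact ih (a' + b').toNat (by omega) a' b' ⟨hm, hm', by omega, by omega⟩ hab' (by omega)
      by_cases hbase : b = 1 - a
      · have hs := simpleRoot_mem_roots (C := typeB m) ⟨(a - 1).toNat, by omega⟩
        rw [simpleRoot_typeB, sub_eq_add_neg, ← vecB_neg] at hs
        convert hs using 3 <;> simp <;> omega
      · rcases lt_trichotomy b 0 with hb0 | hb0 | hb0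
        · refine go (-b).toNat (by omega) a (b - 1) ?_ ?_ (abs_lt.mpr (by omega)) (by omega) <;>
          · unfold tauB
            split_ifs <;> omega
        · refine go (a - 1).toNat (by omega) (a - 1) b ?_ ?_ (abs_lt.mpr (by omega)) (by omega) <;>
          · unfold tauB
            split_ifs <;> omega
        · by_cases hb1 : b = 1
          · refine go 0 (by omega) a (-1) ?_ ?_ (abs_lt.mpr (by omega)) (by omega) <;>
            · unfold tauB
              split_ifs <;> omega
          · refine go (b - 1).toNat (by omega) a (b - 1) ?_ ?_ (abs_lt.mpr (by omega))
              (by omega) <;>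
            · unfold tauB
              split_ifs <;> omega
  have key2 : ∀ a b : ℤ, IsIdxB m a b → 0 < a + b → vecB m a + vecB m b ∈ (typeB m).roots := by
    intro a b hI hab
    have hI' := hI
    obtain ⟨ha, hb, hne, hne'⟩ := hI'
    rcases lt_or_gt_of_ne hne with h | h
    · rw [add_comm]
      exact key (b + a).toNat b a ⟨hb, ha, hne.symm, by omega⟩ (abs_lt.mpr (by omega)) (by omega)
    · exact key (a + b).toNat a b hI (abs_lt.mpr (by omega)) (by omega)
  obtain ⟨ha, hb, hne, hne'⟩ := h
  rcases lt_trichotomy 0 (a + b) with h2 | h2 | h2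
  · exact key2 a b ⟨ha, hb, hne, hne'⟩ h2
  · omega
  · have := neg_mem_roots (key2 (-a) (-b) ⟨by omega, by omega, by omega, by omega⟩ (by omega))
    rwa [vecB_neg, vecB_neg, neg_add, neg_neg, neg_neg] at this

theorem roots_typeB (m : ℕ) :
    (typeB m).roots = {β | ∃ a b, IsIdxB m a b ∧ β = vecB m a + vecB m b} := by
  refine Set.Subset.antisymm (roots_subset (fun i => ?_) ?_) ?_
  · have := i.2
    refine ⟨i + 1, -i, ⟨by omega, by omega, by omega, by omega⟩, ?_⟩
    rw [simpleRoot_typeB, sub_eq_add_neg, vecB_neg]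
  · rintro i _ ⟨a, b, ⟨ha, hb, hne, hne'⟩, rfl⟩
    refine ⟨tauB i a, tauB i b, ⟨tauB_mem i ha, tauB_mem i hb, fun h => hne ?_, fun h => hne' ?_⟩,
      by rw [map_add, refl_vecB i ha, refl_vecB i hb]⟩
    · rw [← tauB_tauB i a, h, tauB_tauB]
    · rw [← tauB_tauB i a, h, tauB_neg, tauB_tauB]
  · rintro _ ⟨a, b, h, rfl⟩
    exact vecB_add_mem_roots h

theorem typeB_isFiniteType (m : ℕ) : (typeB m).IsFiniteType where
  finite := by
    refine ((Set.toFinite (Set.Icc (-m : ℤ) m ×ˢ Set.Icc (-m : ℤ) m)).image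
      fun x => vecB m x.1 + vecB m x.2).subset ?_
    rw [roots_typeB]
    rintro _ ⟨a, b, h, rfl⟩
    exact ⟨(a, b), ⟨h.1, h.2.1⟩, rfl⟩
  sign := by
    rw [roots_typeB]
    rintro _ ⟨a, b, h, rfl⟩
    rcases le_total 0 (a + b) with hab | hab
    · exact Or.inl (vecB_add_nonneg hab)
    · right
      have h2 : 0 ≤ vecB m (-a) + vecB m (-b) := vecB_add_nonneg (by omega)
      rw [vecB_neg, vecB_neg, ← neg_add] at h2
      exact neg_nonneg.mp h2
  reduced := by
    intro i c hc h
    have h0 := ne_zero_of_mem_roots h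
    rw [roots_typeB] at h
    obtain ⟨a, b, ⟨ha, hb, hne, hne'⟩, h⟩ := h
    have h1 : ∀ p (hp : p < m), c * (if p = i then 1 else 0) = unitB a p + unitB b p := by
      intro p hp
      have := congrFun h ⟨p, hp⟩
      simpa [simpleRoot, Pi.single_apply, Fin.ext_iff, vecB] using this
    have hi := h1 i i.2
    rw [if_pos rfl, mul_one] at hi
    have hc0 : c ≠ 0 := by
      rintro rfl
      simp at h0
    have h2 : ∀ p : ℕ, p < m → p ≠ i → unitB a p + unitB b p = 0 := by
      intro p hp hpi
      rw [← h1 p hp, if_neg hpi, mul_zero]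
    -- Coordinates of e_a + e_b are at most 2, so c = 2 and both indices exceed `i`. They differ, so
    -- the coordinate just below the larger index is nonzero and sits at a position other than `i`.
    by_contra hc1
    have hab : (i : ℤ) < a ∧ (i : ℤ) < b := by
      unfold unitB at hi
      split_ifs at hi <;> omega
    rcases lt_or_gt_of_ne hne with h3 | h3
    · have := h2 (b.toNat - 1) (by omega) (by omega)
      unfold unitB at this
      split_ifs at this <;> omega
    · have := h2 (a.toNat - 1) (by omega) (by omega)
      unfold unitB at this
      split_ifs at this <;> omega

/-! ### Type D: the same model with doubled vectors -/

/-- The coordinates of `2 e a` in type `D`, where `e (-a) = -e a`. -/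
def unitD (a : ℤ) (p : ℕ) : ℤ :=
  if a = 1 then (if p = 0 then 1 else if p = 1 then -1 else 0)
  else if a = -1 then (if p = 0 then -1 else if p = 1 then 1 else 0)
  else if (p : ℤ) < a then (if p < 2 then 1 else 2)
  else if a < -(p : ℤ) then (if p < 2 then -1 else -2) else 0

/-- The vector `2 e a` in type `D`, where `e (-a) = -e a`. -/
def vecD (m : ℕ) (a : ℤ) : Fin m → ℤ := fun i => unitD a i

/-- The vector `e a + e b` in type `D`. -/
def rootD (m : ℕ) (a b : ℤ) : Fin m → ℤ := fun i => (unitD a i + unitD b i) / 2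

/-- The simple reflections in type `D` as permutations of the indices of the vectors `e a`. -/
def tauD (y : ℕ) (a : ℤ) : ℤ :=
  if y = 0 then (if a = 1 then -2 else if a = 2 then -1 else if a = -1 then 2
    else if a = -2 then 1 else a)
  else if a = y then y + 1 else if a = y + 1 then y else if a = -y then -(y + 1)
  else if a = -(y + 1) then -y else a

theorem unitD_neg (a : ℤ) (p : ℕ) : unitD (-a) p = -unitD a p := by
  grind [unitD]

theorem vecD_neg (m : ℕ) (a : ℤ) : vecD m (-a) = -vecD m a :=
  funext fun _ => unitD_neg _ _

theorem tauD_neg (y : ℕ) (a : ℤ) : tauD y (-a) = -tauD y a := by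
  grind [tauD]

theorem tauD_tauD (y : ℕ) (a : ℤ) : tauD y (tauD y a) = a := by
  grind [tauD]

theorem tauD_injective (y : ℕ) : Function.Injective (tauD y) :=
  Function.Involutive.injective (tauD_tauD y)

theorem extZero_vecD {m : ℕ} (hm : 2 ≤ m) {a : ℤ} (ha : -m ≤ a ∧ a ≤ m) (p : ℕ) :
    extZero (vecD m a) p = unitD a p := by
  grind [extZero, vecD, unitD]

theorem simpleCoroot_typeD {m : ℕ} (hm : 2 ≤ m) (i : Fin m) (v : Fin m → ℤ) :
    (typeD m).simpleCoroot i v = 2 * v i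
      - (if (i : ℕ) = 0 then extZero v 2 else extZero v (i + 1))
      - (if (i : ℕ) ≤ 1 then 0 else extZero v (i - 1))
      - (if (i : ℕ) = 2 then extZero v 0 else 0) := by
  have h : ∀ j : Fin m, (typeD m).A j i * v j = 2 * (if (j : ℕ) = i then v j else 0)
      - (if (i : ℕ) = 0 then (if (j : ℕ) = 2 then v j else 0)
          else (if (j : ℕ) = i + 1 then v j else 0))
      - (if (i : ℕ) ≤ 1 then 0 else if (j : ℕ) = i - 1 then v j else 0)
      - (if (i : ℕ) = 2 then (if (j : ℕ) = 0 then v j else 0) else 0) := by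
    intro j
    have hi := i.2
    have hj := j.2
    have hA : (typeD m).A j i = if (j : ℕ) = i then 2 else
        if (j : ℕ) = i + 1 ∧ (i : ℕ) ≠ 0 then -1 else if (i : ℕ) = j + 1 ∧ (j : ℕ) ≠ 0 then -1
        else if (i : ℕ) = 0 ∧ (j : ℕ) = 2 then -1 else if (i : ℕ) = 2 ∧ (j : ℕ) = 0 then -1
        else 0 := by
      simp only [typeD, Matrix.submatrix_apply, CartanMatrix.D, Matrix.of_apply, Fin.ext_iff,
        Fin.val_rev]
      split_ifs <;> omega
    rw [hA]
    split_ifs <;> omega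
  rw [simpleCoroot_apply, Finset.sum_congr rfl fun j _ => h j, Finset.sum_sub_distrib,
    Finset.sum_sub_distrib, Finset.sum_sub_distrib, ← Finset.mul_sum, sum_ite_val_eq, extZero_val]
  split_ifs <;> simp only [sum_ite_val_eq, Finset.sum_const_zero]

theorem unitD_tauD_self {y : ℕ} {a : ℤ} (ha : a ≠ 0) :
    unitD (tauD y a) y = unitD a y - (2 * unitD a y
      - (if y = 0 then unitD a 2 else unitD a (y + 1))
      - (if y ≤ 1 then 0 else unitD a (y - 1)) - (if y = 2 then unitD a 0 else 0)) := by
  by_cases hy : y ≤ 2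
  · interval_cases y <;> grind (splits := 30) [unitD, tauD]
  · have h1 : ((y - 1 : ℕ) : ℤ) = y - 1 := by omega
    have hy0 : y ≠ 0 := by omega
    have hy1 : ¬ y ≤ 1 := by omega
    have hy2 : y ≠ 2 := by omega
    grind (splits := 30) [unitD, tauD]

theorem unitD_tauD_of_ne {y p : ℕ} (h : p ≠ y) {a : ℤ} (ha : a ≠ 0) :
    unitD (tauD y a) p = unitD a p := by
  grind (splits := 30) [unitD, tauD]

theorem refl_vecD {m : ℕ} (hm : 2 ≤ m) (i : Fin m) {a : ℤ} (ha : -m ≤ a ∧ a ≤ m) (h0 : a ≠ 0) :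
    (typeD m).refl i (vecD m a) = vecD m (tauD i a) := by
  ext p
  by_cases h : p = i
  · subst h
    rw [refl_apply, simpleCoroot_typeD hm, extZero_vecD hm ha, extZero_vecD hm ha,
      extZero_vecD hm ha, extZero_vecD hm ha]
    simp only [Pi.sub_apply, Pi.smul_apply, simpleRoot, Pi.single_eq_same, vecD, smul_eq_mul,
      mul_one]
    rw [unitD_tauD_self h0]
  · rw [refl_apply_of_ne _ h]
    exact (unitD_tauD_of_ne (fun h' => h (Fin.ext h')) h0).symm

theorem tauD_mem {m : ℕ} (hm : 2 ≤ m) (i : Fin m) {a : ℤ} (ha : -m ≤ a ∧ a ≤ m) :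
    -m ≤ tauD i a ∧ tauD i a ≤ m := by
  have := i.2
  grind [tauD]

theorem tauD_ne_zero {y : ℕ} {a : ℤ} (h0 : a ≠ 0) : tauD y a ≠ 0 := by
  grind [tauD]

/-- The vectors e_a have half-integral coordinates at the two fork nodes, which is why they are
doubled. For every nonzero index the doubled coordinates are odd at these two nodes and even
elsewhere, so the halving in `rootD` is exact. -/
theorem two_mul_rootD {a b : ℤ} (ha : a ≠ 0) (hb : b ≠ 0) (p : ℕ) :
    2 * ((unitD a p + unitD b p) / 2) = unitD a p + unitD b p := by
  have h : ∀ a : ℤ, a ≠ 0 → ∃ c, unitD a p = 2 * c + if p < 2 then 1 else 0 := by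
    intro a ha
    have h3 : (unitD a p) % 2 = if p < 2 then 1 else 0 := by
      grind [unitD]
    refine ⟨unitD a p / 2, ?_⟩
    rw [← h3]
    omega
  obtain ⟨c, hc⟩ := h a ha
  obtain ⟨d, hd⟩ := h b hb
  rw [hc, hd]
  split_ifs <;> omega

theorem two_smul_rootD {m : ℕ} {a b : ℤ} (ha : a ≠ 0) (hb : b ≠ 0) :
    (2 : ℤ) • rootD m a b = vecD m a + vecD m b :=
  funext fun p => two_mul_rootD ha hb p

theorem eq_rootD_iff {m : ℕ} {a b : ℤ} (ha : a ≠ 0) (hb : b ≠ 0) {β : Fin m → ℤ} :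
    β = rootD m a b ↔ (2 : ℤ) • β = vecD m a + vecD m b := by
  rw [← two_smul_rootD ha hb, smul_right_inj (by norm_num : (2 : ℤ) ≠ 0)]

/-- The index pairs of the roots `e a + e b` in type `D`. -/
def IsIdxD (m : ℕ) (a b : ℤ) : Prop :=
  (-m ≤ a ∧ a ≤ m) ∧ (-m ≤ b ∧ b ≤ m) ∧ a ≠ 0 ∧ b ≠ 0 ∧ a ≠ b ∧ a ≠ -b

theorem rootD_comm (m : ℕ) (a b : ℤ) : rootD m a b = rootD m b a := by
  ext i
  simp [rootD, add_comm]

theorem neg_rootD {m : ℕ} {a b : ℤ} (ha : a ≠ 0) (hb : b ≠ 0) :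
    -rootD m a b = rootD m (-a) (-b) := by
  rw [eq_rootD_iff (neg_ne_zero.mpr ha) (neg_ne_zero.mpr hb), smul_neg, two_smul_rootD ha hb,
    vecD_neg, vecD_neg, neg_add]

theorem apply_rootD {m : ℕ} {w : (Fin m → ℤ) ≃ₗ[ℤ] (Fin m → ℤ)} {a b a' b' : ℤ}
    (ha : a ≠ 0) (hb : b ≠ 0) (ha' : a' ≠ 0) (hb' : b' ≠ 0)
    (h : w (vecD m a) = vecD m a') (h' : w (vecD m b) = vecD m b') :
    w (rootD m a b) = rootD m a' b' := by
  rw [eq_rootD_iff ha' hb', ← map_smul, two_smul_rootD ha hb, map_add, h, h']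

theorem simpleRoot_typeD_zero {m : ℕ} (hm : 2 ≤ m) :
    simpleRoot ℤ ⟨0, by omega⟩ = rootD m 1 2 := by
  rw [eq_rootD_iff (by norm_num) (by norm_num)]
  ext p
  simp only [simpleRoot, Pi.single_apply, Fin.ext_iff, vecD, Pi.add_apply, Pi.smul_apply,
    smul_eq_mul]
  grind [unitD]

theorem simpleRoot_typeD_succ {m : ℕ} (i : Fin m) (hi : (i : ℕ) ≠ 0) :
    simpleRoot ℤ i = rootD m (i + 1) (-i) := by
  rw [eq_rootD_iff (by omega) (by omega)]
  ext p
  simp only [simpleRoot, Pi.single_apply, Fin.ext_iff, vecD, Pi.add_apply, Pi.smul_apply,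
    smul_eq_mul]
  grind [unitD]

theorem rootD_nonneg {m : ℕ} {a b : ℤ} (hI : IsIdxD m a b) (h : 0 ≤ a + b) : 0 ≤ rootD m a b := by
  intro i
  obtain ⟨-, -, h1, h2, h3, h4⟩ := hI
  have : 0 ≤ unitD a i + unitD b i := by grind [unitD]
  simp only [Pi.zero_apply, rootD]
  omega

theorem IsIdxD.neg {m : ℕ} {a b : ℤ} (h : IsIdxD m a b) : IsIdxD m (-a) (-b) := by
  obtain ⟨h1, h2, h3, h4, h5, h6⟩ := h
  exact ⟨by omega, by omega, by omega, by omega, by omega, by omega⟩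

theorem IsIdxD.symm {m : ℕ} {a b : ℤ} (h : IsIdxD m a b) : IsIdxD m b a := by
  obtain ⟨h1, h2, h3, h4, h5, h6⟩ := h
  exact ⟨by omega, by omega, by omega, by omega, by omega, by omega⟩

theorem IsIdxD.tauD {m : ℕ} (hm : 2 ≤ m) (i : Fin m) {a b : ℤ} (h : IsIdxD m a b) :
    IsIdxD m (tauD i a) (tauD i b) := by
  obtain ⟨h1, h2, h3, h4, h5, h6⟩ := h
  refine ⟨tauD_mem hm i h1, tauD_mem hm i h2, tauD_ne_zero h3, tauD_ne_zero h4,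
    fun h => h5 (tauD_injective i h), fun h => h6 (tauD_injective i ?_)⟩
  rw [h, tauD_neg]

theorem refl_rootD {m : ℕ} (hm : 2 ≤ m) (i : Fin m) {a b : ℤ} (h : IsIdxD m a b) :
    (typeD m).refl i (rootD m a b) = rootD m (tauD i a) (tauD i b) :=
  apply_rootD h.2.2.1 h.2.2.2.1 (tauD_ne_zero h.2.2.1) (tauD_ne_zero h.2.2.2.1)
    (refl_vecD hm i h.1 h.2.2.1) (refl_vecD hm i h.2.1 h.2.2.2.1)

/-- The descent on a + b is that of type B. There is a second base case, the fork root e_1 + e_2,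
and the step past zero sends the index 1 directly to -2. -/
theorem rootD_mem_roots {m : ℕ} (hm : 2 ≤ m) {a b : ℤ} (h : IsIdxD m a b) :
    rootD m a b ∈ (typeD m).roots := by
  have step : ∀ {a b : ℤ} (y : ℕ) (_ : y < m), IsIdxD m a b →
      rootD m (tauD y a) (tauD y b) ∈ (typeD m).roots →
      rootD m a b ∈ (typeD m).roots := by
    intro a b y hy hI h
    have := apply_mem_roots ((typeD m).refl_mem_W ⟨y, hy⟩) h
    rwa [← refl_rootD hm ⟨y, hy⟩ hI, refl_refl] at this
  have key : ∀ k : ℕ, ∀ a b : ℤ, IsIdxD m a b → |b| < a → a + b = k →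
      rootD m a b ∈ (typeD m).roots := by
    intro k
    induction k using Nat.strong_induction_on with
    | _ k ih =>
      intro a b hI hab hk
      obtain ⟨h1, h2⟩ := abs_lt.mp hab
      have hI' := hI
      obtain ⟨ha, hb, ha0, hb0, hne, hne'⟩ := hI'
      have go : ∀ (y : ℕ) (_ : y < m) (a' b' : ℤ), tauD y a = a' → tauD y b = b' → |b'| < a' →
          a' + b' < a + b → rootD m a b ∈ (typeD m).roots := by
        intro y hy a' b' ea eb hab' hlt
        have hI'' := hI.tauD hm ⟨y, hy⟩
        simp only [ea, eb] at hI''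
        have := abs_lt.mp hab'
        refine step y hy hI ?_
        rw [ea, eb]
        exact ih (a' + b').toNat (by omega) a' b' hI'' hab' (by omega)
      by_cases hbase : b = 1 - a
      · have hs := simpleRoot_mem_roots (C := typeD m) ⟨(a - 1).toNat, by omega⟩
        rw [simpleRoot_typeD_succ _ (by simp only; omega)] at hs
        convert hs using 2 <;> simp only <;> omega
      · by_cases hbase2 : a = 2
        · have hb1 : b = 1 := by omega
          have hs := simpleRoot_mem_roots (C := typeD m) ⟨0, by omega⟩
          rw [simpleRoot_typeD_zero hm] at hs
          rw [hbase2, hb1, rootD_comm]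
          exact hs
        · rcases lt_or_gt_of_ne hb0 with hb0 | hb0
          · refine go (-b).toNat (by omega) a (b - 1) ?_ ?_ (abs_lt.mpr (by omega)) (by omega) <;>
              grind [tauD]
          · by_cases hb1 : b = 1
            · refine go 0 (by omega) a (-2) ?_ ?_ (abs_lt.mpr (by omega)) (by omega) <;>
                grind [tauD]
            · refine go (b - 1).toNat (by omega) a (b - 1) ?_ ?_ (abs_lt.mpr (by omega))
                (by omega) <;> grind [tauD]
  have key2 : ∀ a b : ℤ, IsIdxD m a b → 0 < a + b → rootD m a b ∈ (typeD m).roots := by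
    intro a b hI hab
    have hne := hI.2.2.2.2
    rcases lt_or_gt_of_ne hne.1 with h | h
    · rw [rootD_comm]
      exact key (b + a).toNat b a hI.symm (abs_lt.mpr (by omega)) (by omega)
    · exact key (a + b).toNat a b hI (abs_lt.mpr (by omega)) (by omega)
  have hne := h.2.2
  rcases lt_trichotomy 0 (a + b) with h2 | h2 | h2
  · exact key2 a b h h2
  · omega
  · have := neg_mem_roots (key2 (-a) (-b) h.neg (by omega))
    rwa [neg_rootD (by omega) (by omega), neg_neg, neg_neg] at this

theorem roots_typeD {m : ℕ} (hm : 2 ≤ m) :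
    (typeD m).roots = {β | ∃ a b, IsIdxD m a b ∧ β = rootD m a b} := by
  refine Set.Subset.antisymm (roots_subset (fun i => ?_) ?_) ?_
  · have := i.2
    by_cases hi : (i : ℕ) = 0
    · refine ⟨1, 2, ⟨by omega, by omega, by omega, by omega, by omega, by omega⟩, ?_⟩
      rw [← simpleRoot_typeD_zero hm, show i = ⟨0, by omega⟩ from Fin.ext hi]
    · exact ⟨i + 1, -i, ⟨by omega, by omega, by omega, by omega, by omega, by omega⟩,
        simpleRoot_typeD_succ i hi⟩
  · rintro i _ ⟨a, b, h, rfl⟩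
    exact ⟨_, _, h.tauD hm i, refl_rootD hm i h⟩
  · rintro _ ⟨a, b, h, rfl⟩
    exact rootD_mem_roots hm h

theorem rootD_nonneg_iff {m : ℕ} (hm : 2 ≤ m) {a b : ℤ} (h : IsIdxD m a b) :
    0 ≤ rootD m a b ↔ 0 ≤ a + b := by
  refine ⟨fun h0 => ?_, rootD_nonneg h⟩
  by_contra h'
  have := rootD_nonneg h.neg (by omega)
  rw [← neg_rootD h.2.2.1 h.2.2.2.1] at this
  exact not_nonneg_neg (rootD_mem_roots hm h) h0 this

theorem typeD_isFiniteType {m : ℕ} (hm : 2 ≤ m) : (typeD m).IsFiniteType where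
  finite := by
    refine ((Set.toFinite (Set.Icc (-m : ℤ) m ×ˢ Set.Icc (-m : ℤ) m)).image
      fun x => rootD m x.1 x.2).subset ?_
    rw [roots_typeD hm]
    rintro _ ⟨a, b, h, rfl⟩
    exact ⟨(a, b), ⟨h.1, h.2.1⟩, rfl⟩
  sign := by
    rw [roots_typeD hm]
    rintro _ ⟨a, b, h, rfl⟩
    rcases le_total 0 (a + b) with hab | hab
    · exact Or.inl (rootD_nonneg h hab)
    · right
      rw [← neg_nonneg, neg_rootD h.2.2.1 h.2.2.2.1]
      exact rootD_nonneg h.neg (by omega)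
  reduced := by
    intro i c hc h
    have hr := ne_zero_of_mem_roots h
    rw [roots_typeD hm] at h
    obtain ⟨a, b, ⟨ha, hb, ha0, hb0, hne, hne'⟩, h⟩ := h
    rw [eq_rootD_iff ha0 hb0] at h
    have h1 : ∀ p (hp : p < m), 2 * (c * (if p = i then 1 else 0)) = unitD a p + unitD b p := by
      intro p hp
      have := congrFun h ⟨p, hp⟩
      simpa [simpleRoot, Pi.single_apply, Fin.ext_iff, vecD] using this
    have hi := h1 i i.2
    rw [if_pos rfl, mul_one] at hi
    have hc0 : c ≠ 0 := by
      rintro rfl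
      simp at hr
    have h2 : ∀ p : ℕ, p < m → p ≠ i → unitD a p + unitD b p = 0 := by
      intro p hp hpi
      rw [← h1 p hp, if_neg hpi, mul_zero, mul_zero]
    by_contra hc1
    have hab : (i : ℤ) < a ∧ (i : ℤ) < b ∧ 2 ≤ (i : ℕ) := by
      clear h1 h2 h hr
      grind (splits := 30) [unitD]
    rcases lt_or_gt_of_ne hne with h3 | h3
    · have := h2 (b.toNat - 1) (by omega) (by omega)
      grind [unitD]
    · have := h2 (a.toNat - 1) (by omega) (by omega)
      grind [unitD]

/-! ### Signed permutations in type B and equalities between numbers of reduced words -/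

theorem vecB_injective {m : ℕ} {a b : ℤ} (ha : -m ≤ a ∧ a ≤ m) (hb : -m ≤ b ∧ b ≤ m)
    (h : vecB m a = vecB m b) : a = b := by
  by_contra hne
  refine vecB_add_ne_zero (b := -b) ha (by omega) (by omega) ?_
  rw [h, vecB_neg, add_neg_cancel]

/-- `w` acts on the vectors `e a` in type `B` as the signed permutation `σ`. -/
def ActsB (m : ℕ) (w : (Fin m → ℤ) ≃ₗ[ℤ] (Fin m → ℤ)) (σ : ℤ → ℤ) : Prop :=
  ∀ a : ℤ, -m ≤ a ∧ a ≤ m → (-m ≤ σ a ∧ σ a ≤ m) ∧ w (vecB m a) = vecB m (σ a)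

namespace ActsB

variable {m : ℕ} {w : (Fin m → ℤ) ≃ₗ[ℤ] (Fin m → ℤ)} {σ : ℤ → ℤ}

theorem one (m : ℕ) : ActsB m 1 id := fun _ h => ⟨h, rfl⟩

theorem refl_mul (h : ActsB m w σ) (i : Fin m) :
    ActsB m ((typeB m).refl i * w) fun a => tauB i (σ a) := fun a ha => by
  obtain ⟨h1, h2⟩ := h a ha
  exact ⟨tauB_mem i h1, by rw [LinearEquiv.mul_apply, h2, refl_vecB i h1]⟩

theorem exists_of_mem (hw : w ∈ (typeB m).W) : ∃ σ, ActsB m w σ := by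
  obtain ⟨l, rfl⟩ := exists_word hw
  induction l with
  | nil => exact ⟨id, one m⟩
  | cons i l ih =>
    obtain ⟨σ, hσ⟩ := ih (wordProd_mem_W _ l)
    exact ⟨_, by simpa using hσ.refl_mul i⟩

theorem injOn (h : ActsB m w σ) {a b : ℤ} (ha : -m ≤ a ∧ a ≤ m) (hb : -m ≤ b ∧ b ≤ m)
    (hab : σ a = σ b) : a = b := by
  refine vecB_injective ha hb (w.injective ?_)
  rw [(h a ha).2, (h b hb).2, hab]

theorem map_neg (h : ActsB m w σ) {a : ℤ} (ha : -m ≤ a ∧ a ≤ m) : σ (-a) = -σ a := by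
  have hna : -(m : ℤ) ≤ -a ∧ -a ≤ m := by omega
  have h1 := h a ha
  have h2 := h (-a) hna
  refine vecB_injective h2.1 (by omega) ?_
  rw [← h2.2, vecB_neg, vecB_neg, _root_.map_neg, h1.2]

theorem map_zero (h : ActsB m w σ) : σ 0 = 0 := by
  have := h.map_neg (a := 0) (by omega)
  rw [neg_zero] at this
  omega

theorem inv_apply (h : ActsB m w σ) {a : ℤ} (ha : -m ≤ a ∧ a ≤ m) :
    w⁻¹ (vecB m (σ a)) = vecB m a := by
  rw [← (h a ha).2, inv_apply_apply]

theorem surjOn (h : ActsB m w σ) (hw : w ∈ (typeB m).W) {c : ℤ} (hc : -m ≤ c ∧ c ≤ m) :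
    ∃ a : ℤ, (-m ≤ a ∧ a ≤ m) ∧ σ a = c := by
  obtain ⟨σ', h'⟩ := exists_of_mem ((typeB m).W.inv_mem hw)
  obtain ⟨h1, h2⟩ := h' c hc
  refine ⟨σ' c, h1, vecB_injective (h _ h1).1 hc ?_⟩
  rw [← (h _ h1).2, ← h2, apply_inv_apply]

theorem eq_neg_of_eq_neg (h : ActsB m w σ) {a b : ℤ} (ha : -m ≤ a ∧ a ≤ m)
    (hb : -m ≤ b ∧ b ≤ m) (hab : σ a = -σ b) : a = -b :=
  h.injOn ha (by omega) (by rw [hab, h.map_neg hb])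

/-- The root w⁻¹ α_i is e_p - e_{p'}, which is negative exactly when p < p'. For the node with index
0 one has p' = 0. -/
theorem mem_desc_iff (h : ActsB m w σ) (hw : w ∈ (typeB m).W) (i : Fin m) {p p' : ℤ}
    (hp : -m ≤ p ∧ p ≤ m) (hp' : -m ≤ p' ∧ p' ≤ m) (e : σ p = i + 1) (e' : σ p' = i) :
    i ∈ (typeB m).desc w ↔ p < p' := by
  rw [(typeB_isFiniteType m).mem_desc_iff hw, simpleRoot_typeB, ← e, ← e', map_sub,
    h.inv_apply hp, h.inv_apply hp', sub_eq_add_neg, ← vecB_neg,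
    vecB_add_nonneg_iff hp (by omega)]
  omega

end ActsB

/-- The difference of the coordinates at c - 1 and c is the coefficient of e_c, so a root determines
its unordered index pair. -/
theorem vecB_add_eq_iff {m : ℕ} {a b a' b' : ℤ} (h : IsIdxB m a b) (h' : IsIdxB m a' b')
    (e : vecB m a + vecB m b = vecB m a' + vecB m b') :
    (a = a' ∧ b = b') ∨ (a = b' ∧ b = a') := by
  obtain ⟨h1, h2, h3, h4⟩ := h
  obtain ⟨h1', h2', h3', h4'⟩ := h'
  have key : ∀ p : ℕ, unitB a p + unitB b p = unitB a' p + unitB b' p := by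
    intro p
    by_cases hp : p < m
    · exact congrFun e ⟨p, hp⟩
    · unfold unitB
      split_ifs <;> omega
  have key' : ∀ c : ℤ, 0 < c → ∀ a : ℤ, unitB a (c.toNat - 1) - unitB a c.toNat =
      (if a = c then 1 else 0) - (if a = -c then 1 else 0) := by
    intro c hc a
    unfold unitB
    split_ifs <;> omega
  have key2 : ∀ c : ℤ, c ≠ 0 → ((if a = c then 1 else 0) - (if a = -c then 1 else 0) : ℤ) +
      ((if b = c then 1 else 0) - (if b = -c then 1 else 0)) =
      ((if a' = c then 1 else 0) - (if a' = -c then 1 else 0)) +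
      ((if b' = c then 1 else 0) - (if b' = -c then 1 else 0)) := by
    have pos : ∀ c : ℤ, 0 < c → ((if a = c then 1 else 0) - (if a = -c then 1 else 0) : ℤ) +
        ((if b = c then 1 else 0) - (if b = -c then 1 else 0)) =
        ((if a' = c then 1 else 0) - (if a' = -c then 1 else 0)) +
        ((if b' = c then 1 else 0) - (if b' = -c then 1 else 0)) := by
      intro c hc
      rw [← key' c hc, ← key' c hc, ← key' c hc, ← key' c hc]
      have h1 := key (c.toNat - 1)
      have h2 := key c.toNat
      omega
    intro c hc
    rcases lt_or_gt_of_ne hc with hc | hc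
    · have := pos (-c) (by omega)
      rw [neg_neg] at this
      omega
    · exact pos c hc
  have ha : a ≠ 0 → a = a' ∨ a = b' := fun h0 => by
    have := key2 a h0
    rw [if_pos rfl, if_neg (by omega : a ≠ -a), if_neg h3.symm, if_neg (by omega : b ≠ -a)] at this
    split_ifs at this <;> omega
  have hb : b ≠ 0 → b = a' ∨ b = b' := fun h0 => by
    have := key2 b h0
    rw [if_neg h3, if_neg h4, if_pos rfl, if_neg (by omega : b ≠ -b)] at this
    split_ifs at this <;> omega
  have ha' : a' ≠ 0 → a' = a ∨ a' = b := fun h0 => by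
    have := key2 a' h0
    rw [if_pos (rfl : a' = a'), if_neg (by omega : a' ≠ -a'), if_neg h3'.symm,
      if_neg (by omega : b' ≠ -a')] at this
    split_ifs at this <;> omega
  have hb' : b' ≠ 0 → b' = a ∨ b' = b := fun h0 => by
    have := key2 b' h0
    rw [if_neg h3', if_neg h4', if_pos (rfl : b' = b'), if_neg (by omega : b' ≠ -b')] at this
    split_ifs at this <;> omega
  omega

/-- The reflection is conjugate to a simple one by an element that acts as a signed permutation.
Nonzero indices rule out the node with index 0, so the formula is that of a long root. -/
theorem rho_vecB {m : ℕ} {a b : ℤ} (h : IsIdxB m a b) (ha0 : a ≠ 0) (hb0 : b ≠ 0) :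
    (typeB m).rho (vecB m a + vecB m b) (vecB m b) = -vecB m a ∧
      ∀ c : ℤ, -m ≤ c ∧ c ≤ m → c ≠ a → c ≠ -a → c ≠ b → c ≠ -b →
        (typeB m).rho (vecB m a + vecB m b) (vecB m c) = vecB m c := by
  obtain ⟨u, hu, i, hui⟩ := vecB_add_mem_roots h
  obtain ⟨σ, hσ⟩ := ActsB.exists_of_mem hu
  have hi := i.2
  have b1 : -(m : ℤ) ≤ (i : ℤ) + 1 ∧ (i : ℤ) + 1 ≤ m := by omega
  have b2 : -(m : ℤ) ≤ -(i : ℤ) ∧ -(i : ℤ) ≤ m := by omega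
  have hr : (typeB m).rho (vecB m a + vecB m b) = u * (typeB m).refl i * u⁻¹ := by
    rw [hui, (typeB_isFiniteType m).rho_conj hu (simpleRoot_mem_roots i),
      (typeB_isFiniteType m).rho_simpleRoot]
  have happ : ∀ d : ℤ, -m ≤ d ∧ d ≤ m →
      (typeB m).rho (vecB m a + vecB m b) (vecB m (σ d)) = vecB m (σ (tauB i d)) := by
    intro d hd
    rw [hr, LinearEquiv.mul_apply, LinearEquiv.mul_apply, hσ.inv_apply hd, refl_vecB i hd,
      (hσ _ (tauB_mem i hd)).2]
  rw [simpleRoot_typeB, sub_eq_add_neg, ← vecB_neg, map_add, (hσ _ b1).2, (hσ _ b2).2] at hui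
  have hidx : IsIdxB m (σ (i + 1)) (σ (-i)) := by
    refine ⟨(hσ _ b1).1, (hσ _ b2).1, fun h => ?_, fun h => ?_⟩
    · have := hσ.injOn b1 b2 h
      omega
    · have := hσ.eq_neg_of_eq_neg b1 b2 h
      omega
  have hcase := vecB_add_eq_iff h hidx hui
  have hi0 : (i : ℤ) ≠ 0 := by
    intro h0
    rw [h0, neg_zero, hσ.map_zero] at hcase
    omega
  have n1 := hσ.map_neg b1
  have n2 := hσ.map_neg b2
  rw [neg_neg] at n2
  constructor
  · rcases hcase with ⟨h1, h2⟩ | ⟨h1, h2⟩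
    · have e := happ _ b2
      rw [← h2] at e
      rw [e, h1, ← vecB_neg, ← n1]
      congr 2
      unfold tauB
      split_ifs <;> omega
    · have e := happ _ b1
      rw [← h2] at e
      rw [e, h1, ← vecB_neg, ← n2]
      congr 2
      unfold tauB
      split_ifs <;> omega
  · intro c hc c1 c2 c3 c4
    obtain ⟨d, hd, rfl⟩ := hσ.surjOn hu hc
    rw [happ d hd]
    congr 2
    have hd1 : d ≠ i + 1 := by
      rintro rfl
      omega
    have hd2 : d ≠ -i := by
      rintro rfl
      omega
    have hd3 : d ≠ -(i + 1) := by
      rintro rfl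
      omega
    have hd4 : d ≠ i := by
      rintro rfl
      omega
    unfold tauB
    split_ifs <;> omega

/-- The root splits as (e_a + e_c) + (e_b - e_c), and w keeps both summands positive; so an
intermediate index `c` prevents a cover. -/
theorem len_mul_rho_vecB_ne {m : ℕ} {w : (Fin m → ℤ) ≃ₗ[ℤ] (Fin m → ℤ)} {σ : ℤ → ℤ}
    (hσ : ActsB m w σ) (hw : w ∈ (typeB m).W) {a b c : ℤ} (hac : IsIdxB m a c)
    (hbc : IsIdxB m b c) (hab : IsIdxB m a b) (ha0 : a ≠ 0) (hb0 : b ≠ 0) (hc0 : c ≠ 0)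
    (h1 : 0 ≤ a + c) (h2 : 0 ≤ b - c) (h3 : 0 ≤ σ a + σ c) (h4 : 0 ≤ σ b - σ c) :
    (typeB m).len (w * (typeB m).rho (vecB m a + vecB m b)) ≠ (typeB m).len w + 1 := by
  obtain ⟨ha, hc, h5, h6⟩ := hac
  obtain ⟨hb, -, h7, h8⟩ := hbc
  obtain ⟨-, -, h9, h10⟩ := hab
  have hc' : -(m : ℤ) ≤ -c ∧ -c ≤ m := by omega
  have i1 : IsIdxB m a c := ⟨ha, hc, h5, h6⟩
  have i2 : IsIdxB m b (-c) := ⟨hb, hc', by omega, by omega⟩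
  have e : vecB m a + vecB m b = (vecB m a + vecB m c) + (vecB m b + vecB m (-c)) := by
    rw [vecB_neg]
    abel
  rw [e]
  refine (typeB_isFiniteType m).len_mul_rho_ne_of_add hw (vecB_add_mem_roots i1)
    (vecB_add_mem_roots i2) (vecB_add_nonneg h1) (vecB_add_nonneg (by omega)) ?_ ?_ ?_ ?_
  · obtain ⟨r1, r2⟩ := rho_vecB i1 ha0 hc0
    rw [vecB_neg, map_add, map_neg, r1, r2 b hb (by omega) (by omega) (by omega) (by omega)]
    abel
  · rw [map_add, (hσ a ha).2, (hσ c hc).2]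
    exact vecB_add_nonneg h3
  · rw [map_add, (hσ b hb).2, (hσ _ hc').2]
    refine vecB_add_nonneg ?_
    rw [hσ.map_neg hc]
    omega
  · obtain ⟨r1, r2⟩ := rho_vecB i2 hb0 (by omega)
    have r3 : (typeB m).rho (vecB m b + vecB m (-c)) (vecB m c) = vecB m b := by
      have := congrArg Neg.neg r1
      rwa [← map_neg, ← vecB_neg, neg_neg, neg_neg] at this
    rw [map_add, r3, r2 a ha (by omega) (by omega) (by omega) (by omega), vecB_neg]
    abel

/-- The functional that extracts the coefficient of `e (r + 1)` in type `B`. -/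
def coordB {m : ℕ} (r : Fin m) (hr : (r : ℕ) + 1 < m) : Module.Dual ℤ (Fin m → ℤ) :=
  LinearMap.proj r - LinearMap.proj ⟨r + 1, hr⟩

theorem coordB_vecB {m : ℕ} (r : Fin m) (hr : (r : ℕ) + 1 < m) (a : ℤ) :
    coordB r hr (vecB m a) =
      (if a = r + 1 then 1 else 0) - (if a = -(r + 1) then 1 else 0) := by
  simp only [coordB, LinearMap.sub_apply, LinearMap.proj_apply, vecB, unitB]
  split_ifs <;> omega

theorem sum_simpleRoot_typeB (m : ℕ) : ∑ i : Fin m, simpleRoot ℤ i = vecB m m := by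
  ext p
  have := p.2
  simp only [simpleRoot, Finset.sum_apply, Finset.sum_pi_single, Finset.mem_univ, if_true, vecB,
    unitB]
  split_ifs <;> omega

/-- In type `B`, the sum of the weights of the covers vanishes for elements that fix the last
coordinate. -/
theorem coverSum_coordB_eq_zero {m : ℕ} (r : Fin m) (hr : (r : ℕ) + 1 < m)
    {w : (Fin m → ℤ) ≃ₗ[ℤ] (Fin m → ℤ)} (hw : w ∈ (typeB m).W) (h : w (vecB m m) = vecB m m) :
    (typeB_isFiniteType m).coverSum (coordB r hr) w = 0 := by
  -- Fixing e_m passes to s_i w for every descent i: the last node is never a descent, since the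
  -- value m sits at the largest argument. The functional vanishes on w⁻¹ e_m = e_m because it reads
  -- a coordinate of smaller index.
  refine (typeB_isFiniteType m).coverSum_eq_zero _ (fun w => w (vecB m m) = vecB m m)
    ?_ ?_ hw h
  · intro w hw h i hi
    have hi' := i.2
    rw [LinearEquiv.mul_apply, h, refl_vecB i (by omega)]
    by_cases him : (i : ℕ) + 1 = m
    · exfalso
      obtain ⟨σ, hσ⟩ := ActsB.exists_of_mem hw
      obtain ⟨p, hp, e⟩ := hσ.surjOn hw (c := i) (by omega)
      have hm : σ m = m := vecB_injective (hσ m (by omega)).1 (by omega) (by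
        rw [← (hσ m (by omega)).2, h])
      rw [hσ.mem_desc_iff hw i (p := m) (p' := p) (by omega) hp (by omega) e] at hi
      omega
    · congr 1
      unfold tauB
      grind
  · intro w hw h
    rw [sum_simpleRoot_typeB, show w⁻¹ (vecB m m) = vecB m m by
      conv_lhs => rw [← h]
      exact inv_apply_apply _ _, coordB_vecB]
    split_ifs <;> omega

/-- Weight the covers of w by the coefficient of e_r; the weighted sum is 0. The root e_s - e_r has
weight -1, and its cover is left multiplication by the reflection with index `x`. The root e_r + e_q
has weight 1, and its cover uses the index `x + 1`. Hypotheses `h1`, `h2` and `h3` ensure that any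
other positive root involving e_r which w keeps positive splits through e_q or e_s, hence gives no
cover. -/
theorem numRed_typeB_eq {m : ℕ} {w : (Fin m → ℤ) ≃ₗ[ℤ] (Fin m → ℤ)} (hw : w ∈ (typeB m).W)
    {σ : ℤ → ℤ} (hσ : ActsB m w σ) {x : ℕ} {r s q : ℤ} (hx : 1 ≤ x) (hxm : x + 2 < m)
    (hr : 1 ≤ r) (hrs : r < s) (hsq : s < q) (hq : q ≤ m) (er : σ r = -(x + 1)) (es : σ s = -x)
    (eq : σ q = x + 2) (em : σ m = m) (h1 : ∀ i, 1 ≤ i → i < r → -(x + 1 : ℤ) < σ i)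
    (h2 : ∀ i : ℤ, 1 ≤ i → i ≤ m → (x : ℤ) + 2 < σ i → q < i)
    (h3 : ∀ i, r < i → i < s → σ i < -(x + 1)) :
    (typeB m).numRed ((typeB m).refl ⟨x, by omega⟩ * w) =
      (typeB m).numRed ((typeB m).refl ⟨x + 1, by omega⟩ * w) := by
  have H := typeB_isFiniteType m
  set R : Fin m := ⟨(r - 1).toNat, by omega⟩ with hR
  have hR1 : (R : ℕ) + 1 < m := by
    simp only [hR]
    omega
  have hRr : ((R : ℕ) : ℤ) + 1 = r := by
    simp only [hR]
    omega
  have h0 := coverSum_coordB_eq_zero R hR1 hw (by rw [(hσ m (by omega)).2, em])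
  have bs : -(m : ℤ) ≤ s ∧ s ≤ m := by omega
  have br : -(m : ℤ) ≤ r ∧ r ≤ m := by omega
  have bnr : -(m : ℤ) ≤ -r ∧ -r ≤ m := by omega
  have bq : -(m : ℤ) ≤ q ∧ q ≤ m := by omega
  have i1 : IsIdxB m (-r) s := ⟨bnr, bs, by omega, by omega⟩
  have i2 : IsIdxB m r q := ⟨br, bq, by omega, by omega⟩
  have hc : ∀ a, coordB R hR1 (vecB m a) = (if a = r then 1 else 0) - (if a = -r then 1 else 0) := by
    intro a
    rw [coordB_vecB, hRr]
  have c1 : coordB R hR1 (vecB m (-r) + vecB m s) = -1 := by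
    rw [map_add, hc, hc]
    split_ifs <;> omega
  have c2 : coordB R hR1 (vecB m r + vecB m q) = 1 := by
    rw [map_add, hc, hc]
    split_ifs <;> omega
  have enr := hσ.map_neg br
  have cov : ∀ (y : ℕ) (hy : y < m) (a b : ℤ), IsIdxB m a b → 0 ≤ a + b → σ a = y + 1 →
      σ b = -y → (typeB m).refl ⟨y, hy⟩ * w = w * (typeB m).rho (vecB m a + vecB m b) ∧
        (typeB m).len (w * (typeB m).rho (vecB m a + vecB m b)) = (typeB m).len w + 1 := by
    intro y hy a b hI hab ea eb
    have e1 : (typeB m).refl ⟨y, hy⟩ * w = w * (typeB m).rho (vecB m a + vecB m b) := by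
      rw [← H.mul_rho_inv_simpleRoot hw, simpleRoot_typeB, sub_eq_add_neg, ← vecB_neg, ← ea, ← eb,
        map_add, hσ.inv_apply hI.1, hσ.inv_apply hI.2.1]
    have h4 := H.lt_len_mul_rho hw (vecB_add_mem_roots hI) (vecB_add_nonneg hab) (by
      rw [map_add, (hσ _ hI.1).2, (hσ _ hI.2.1).2]
      exact vecB_add_nonneg (by omega))
    have h5 := len_refl_mul_le hw ⟨y, hy⟩
    rw [e1] at h5
    exact ⟨e1, by omega⟩
  obtain ⟨e1, l1⟩ := cov x (by omega) (-r) s i1 (by omega) (by omega) (by omega)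
  obtain ⟨e2, l2⟩ := cov (x + 1) (by omega) q r ⟨bq, br, by omega, by omega⟩ (by omega)
    (by push_cast; omega) (by push_cast; omega)
  rw [add_comm (vecB m q)] at e2 l2
  rw [IsFiniteType.coverSum, Finset.sum_eq_add (vecB m (-r) + vecB m s) (vecB m r + vecB m q)
    (fun h => by rw [h, c2] at c1; omega), if_pos l1, if_pos l2, c1, c2] at h0
  · rw [e1, e2]
    omega
  · rintro β hβ ⟨hne1, hne2⟩
    obtain ⟨hβ, hβ0⟩ := H.mem_posFinset.mp hβ
    split_ifs with hcov
    swap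
    · rfl
    have hpos : 0 ≤ w β := by
      rw [← H.lt_len_mul_rho_iff hw hβ hβ0]
      omega
    have main : ∀ a b, IsIdxB m a b → (a = r ∨ a = -r) → β ≠ vecB m a + vecB m b := by
      rintro a b ⟨ha, hb, hab, hab'⟩ har rfl
      rw [map_add, (hσ a ha).2, (hσ b hb).2,
        vecB_add_nonneg_iff (hσ a ha).1 (hσ b hb).1] at hpos
      rw [vecB_add_nonneg_iff ha hb] at hβ0
      have hσab : σ b ≠ -σ a := fun h => hab' (by
        have := hσ.eq_neg_of_eq_neg hb ha h
        omega)
      rcases har with rfl | rfl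
      · have hb0 : 0 < b := by
          by_contra hb0
          rcases eq_or_ne b 0 with rfl | hb1
          · rw [hσ.map_zero] at hpos
            omega
          · have := h1 (-b) (by omega) (by omega)
            rw [hσ.map_neg hb] at this
            omega
        have hbq : b ≠ q := fun h => hne2 (by rw [h])
        have hσb : σ b ≠ x + 2 := fun h => hbq (hσ.injOn hb bq (by rw [h, eq]))
        have hqb := h2 b (by omega) (by omega) (by omega)
        -- Here b > q and σ b > σ q, so e_r + e_b passes through e_q; in the second case e_b - e_r
        -- passes through e_s in the same way.
        exact len_mul_rho_vecB_ne hσ hw (c := q) i2 ⟨hb, bq, by omega, by omega⟩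
          ⟨ha, hb, hab, hab'⟩ (by omega) (by omega) (by omega) (by omega) (by omega) (by omega)
          (by omega) hcov
      · have hbs : b ≠ s := fun h => hne1 (by rw [h])
        have hsb : s < b := by
          by_contra hsb
          have := h3 b (by omega) (by omega)
          omega
        exact len_mul_rho_vecB_ne hσ hw (c := s) i1 ⟨hb, bs, by omega, by omega⟩
          ⟨ha, hb, hab, hab'⟩ (by omega) (by omega) (by omega) (by omega) (by omega) (by omega)
          (by omega) hcov
    have hβ' := hβ
    rw [roots_typeB] at hβ'
    obtain ⟨a, b, hI, rfl⟩ := hβ'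
    have ha : ¬ (a = r ∨ a = -r) := fun h => main a b hI h rfl
    have hb : ¬ (b = r ∨ b = -r) := fun h => main b a
      ⟨hI.2.1, hI.1, hI.2.2.1.symm, by have := hI.2.2.2; omega⟩ h (add_comm _ _)
    rw [map_add, hc, hc]
    rw [if_neg (by omega), if_neg (by omega), if_neg (by omega), if_neg (by omega)]
    simp
  · exact fun h => absurd (H.mem_posFinset.mpr
      ⟨vecB_add_mem_roots i1, vecB_add_nonneg (by omega)⟩) h
  · exact fun h => absurd (H.mem_posFinset.mpr
      ⟨vecB_add_mem_roots i2, vecB_add_nonneg (by omega)⟩) h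

theorem tauB_self {y : ℕ} (hy : 1 ≤ y) : tauB y y = y + 1 := by
  unfold tauB
  split_ifs <;> omega

theorem tauB_succ {y : ℕ} (hy : 1 ≤ y) : tauB y (y + 1) = y := by
  unfold tauB
  split_ifs <;> omega

theorem tauB_of_ne {y : ℕ} (hy : 1 ≤ y) {a : ℤ} (h1 : a ≠ y) (h2 : a ≠ y + 1) (h3 : a ≠ -y)
    (h4 : a ≠ -(y + 1)) : tauB y a = a := by
  unfold tauB
  split_ifs <;> omega

theorem tauB_tauB_succ_of_ne {y : ℕ} (hy : 1 ≤ y) {a : ℤ} (h1 : a ≠ y) (h2 : a ≠ y + 1)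
    (h3 : a ≠ y + 2) (h4 : a ≠ -y) (h5 : a ≠ -(y + 1)) (h6 : a ≠ -(y + 2)) :
    tauB (y + 1) (tauB y a) = a := by
  rw [tauB_of_ne hy h1 h2 h4 h5, tauB_of_ne (by omega) (by push_cast; omega) (by push_cast; omega)
    (by push_cast; omega) (by push_cast; omega)]

theorem tauB_tauB_succ_self {y : ℕ} (hy : 1 ≤ y) : tauB (y + 1) (tauB y y) = y + 2 := by
  have := tauB_self (y := y + 1) (by omega)
  push_cast at this
  rw [tauB_self hy, this]
  ring

theorem tauB_tauB_succ_succ {y : ℕ} (hy : 1 ≤ y) : tauB (y + 1) (tauB y (y + 1)) = y := by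
  rw [tauB_succ hy, tauB_of_ne (by omega) (by push_cast; omega) (by push_cast; omega)
    (by push_cast; omega) (by push_cast; omega)]

theorem tauB_tauB_succ_add_two {y : ℕ} (hy : 1 ≤ y) :
    tauB (y + 1) (tauB y (y + 2)) = y + 1 := by
  have := tauB_succ (y := y + 1) (by omega)
  push_cast at this
  rw [tauB_of_ne hy (by omega) (by omega) (by omega) (by omega),
    show (y : ℤ) + 2 = y + 1 + 1 by ring, this]

/-! ### Moves on the sequence of negative values -/

/-- `w` is the signed permutation in type `B` with values `-(c + a 1), …, -(c + a k)` followed by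
positive values in increasing order, the last of which is fixed. -/
def IsStageB (m k c : ℕ) (a : ℤ → ℤ) (w : (Fin m → ℤ) ≃ₗ[ℤ] (Fin m → ℤ)) : Prop :=
  w ∈ (typeB m).W ∧ ∃ σ, ActsB m w σ ∧ (∀ i : ℤ, 1 ≤ i → i ≤ k → 0 < a i ∧ σ i = -(c + a i)) ∧
    (∀ i j : ℤ, k < i → i < j → j ≤ m → σ i < σ j) ∧ (∀ i : ℤ, k < i → i ≤ m → 0 < σ i) ∧ σ m = m

theorem IsStageB.congr {m k c : ℕ} {a a' : ℤ → ℤ} {w : (Fin m → ℤ) ≃ₗ[ℤ] (Fin m → ℤ)}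
    (h : IsStageB m k c a w) (ha : ∀ i : ℤ, 1 ≤ i → i ≤ k → a i = a' i) :
    IsStageB m k c a' w := by
  obtain ⟨hw, σ, h1, h2, h3⟩ := h
  exact ⟨hw, σ, h1, fun i hi hi' => by rw [← ha i hi hi']; exact h2 i hi hi', h3⟩

/-- Put X = c + x and let v = s_X w, which interchanges the two entries `x` and `x + 1`; the
subscript is the index in `Fin m`. The covers of v singled out by `numRed_typeB_eq` are s_X v = w
and s_{X+1} v, and the second has the sequence `a'`. -/
theorem IsStageB.step {m k c : ℕ} (hkm : k < m) {a a' : ℤ → ℤ}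
    {w : (Fin m → ℤ) ≃ₗ[ℤ] (Fin m → ℤ)}
    (h : IsStageB m k c a w) {x r s : ℤ} (hx : 1 ≤ x) (hxm : c + x + 2 < m) (hr : 1 ≤ r)
    (hrs : r < s) (hsk : s ≤ k) (er : a r = x) (es : a s = x + 1)
    (h1 : ∀ i : ℤ, 1 ≤ i → i < r → a i < x) (h2 : ∀ i : ℤ, r < i → i < s → x + 1 < a i)
    (h3 : ∀ i : ℤ, 1 ≤ i → i ≤ k → a i ≠ x + 2) (hr' : a' r = x + 2) (hs' : a' s = x)
    (ha' : ∀ i : ℤ, 1 ≤ i → i ≤ k → i ≠ r → i ≠ s → a' i = a i) :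
    ∃ w', IsStageB m k c a' w' ∧ (typeB m).numRed w = (typeB m).numRed w' := by
  obtain ⟨hw, σ, hσ, n1, n2, n3, n4⟩ := h
  obtain ⟨X, hX⟩ : ∃ X : ℕ, (X : ℤ) = c + x := ⟨(c + x).toNat, by omega⟩
  have sr := (n1 r hr (by omega)).2
  have ss := (n1 s (by omega) hsk).2
  have hv := hσ.refl_mul ⟨X, by omega⟩
  have hv' := hv.refl_mul ⟨X + 1, by omega⟩
  have hvW := refl_mul_mem_W ⟨X, by omega⟩ hw
  -- Because `x + 2` is absent from the sequence, the value X + 2 is taken positively, beyond the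
  -- argument `k`.
  obtain ⟨q, hq, eq⟩ := hσ.surjOn hw (c := X + 2) (by omega)
  have hqk : k < q := by
    by_contra hqk
    rcases lt_trichotomy q 0 with h | h | h
    · have e := hσ.map_neg hq
      by_cases hk : -q ≤ k
      · have := (n1 (-q) (by omega) hk).2
        exact h3 (-q) (by omega) hk (by omega)
      · have := n3 (-q) (by omega) (by omega)
        omega
    · rw [h, hσ.map_zero] at eq
      omega
    · have := n1 q (by omega) (by omega)
      exact h3 q (by omega) (by omega) (by omega)
  have hinj : ∀ i : ℤ, k < i → i ≤ m → σ i ≠ X ∧ σ i ≠ X + 1 := by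
    intro i hi him
    constructor <;> intro h
    · have := hσ.eq_neg_of_eq_neg (a := i) (b := r) (by omega) (by omega) (by omega)
      omega
    · have := hσ.eq_neg_of_eq_neg (a := i) (b := s) (by omega) (by omega) (by omega)
      omega
  have hinj2 : ∀ i : ℤ, 1 ≤ i → i ≤ k → i ≠ r → i ≠ s → a i ≠ x ∧ a i ≠ x + 1 := by
    intro i hi hik hir his
    have e := (n1 i hi hik).2
    constructor <;> intro h
    · exact hir (hσ.injOn (by omega) (by omega) (by omega))
    · exact his (hσ.injOn (by omega) (by omega) (by omega))
  have hX1 : 1 ≤ X := by omega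
  have ht : ∀ i : ℤ, k < i → i ≤ m →
      tauB (X + 1) (tauB X (σ i)) = if σ i = X + 2 then (X : ℤ) + 1 else σ i := by
    intro i hi him
    have e1 := hinj i hi him
    have p1 := n3 i hi him
    split_ifs with h
    · rw [h, tauB_tauB_succ_add_two hX1]
    · exact tauB_tauB_succ_of_ne hX1 (by omega) (by omega) (by omega) (by omega) (by omega)
        (by omega)
  have bd : ∀ i : ℤ, -m ≤ i ∧ i ≤ m → -m ≤ σ i ∧ σ i ≤ m := fun i hi => (hσ i hi).1
  refine ⟨(typeB m).refl ⟨X + 1, by omega⟩ * ((typeB m).refl ⟨X, by omega⟩ * w),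
    ⟨refl_mul_mem_W _ hvW, _, hv', ?_, ?_, ?_, ?_⟩, ?_⟩
  · intro i hi hik
    obtain ⟨e0, e⟩ := n1 i hi hik
    by_cases hir : i = r
    · subst hir
      refine ⟨by omega, ?_⟩
      have e' : σ i = -X := by omega
      simp only [e', tauB_neg, tauB_tauB_succ_self hX1]
      omega
    · by_cases his : i = s
      · subst his
        refine ⟨by omega, ?_⟩
        have e' : σ i = -(X + 1) := by omega
        simp only [e', tauB_neg, tauB_tauB_succ_succ hX1]
        omega
      · have e2 := hinj2 i hi hik hir his
        have e3 := h3 i hi hik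
        rw [ha' i hi hik hir his]
        refine ⟨e0, ?_⟩
        rw [← e]
        exact tauB_tauB_succ_of_ne hX1 (by omega) (by omega) (by omega) (by omega) (by omega)
          (by omega)
  · intro i j hi hij hj
    have p1 := n3 i hi (by omega)
    have p2 := n2 i j hi hij hj
    have e1 := ht i hi (by omega)
    have e2 := ht j (by omega) hj
    have e3 := hinj i hi (by omega)
    have e4 := hinj j (by omega) hj
    simp only [e1, e2]
    split_ifs <;> omega
  · intro i hi him
    have p1 := n3 i hi him
    simp only [ht i hi him]
    split_ifs <;> omega
  · have e1 := ht m (by omega) le_rfl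
    rw [n4] at e1
    simp only [n4, e1]
    split_ifs <;> omega
  · have key := numRed_typeB_eq hvW hv (x := X) (r := r) (s := s) (q := q) (by omega) (by omega)
      hr hrs (by omega) hq.2 ?_ ?_ ?_ ?_ ?_ ?_ ?_
    · rwa [refl_mul_cancel] at key
    · simp only [show σ r = -X by omega, tauB_neg, tauB_self hX1]
    · simp only [show σ s = -(X + 1) by omega, tauB_neg, tauB_succ hX1]
    · simp only [eq]
      exact tauB_of_ne hX1 (by omega) (by omega) (by omega) (by omega)
    · simp only [n4]
      exact tauB_of_ne hX1 (by omega) (by omega) (by omega) (by omega)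
    · intro i hi hir
      have e := n1 i hi (by omega)
      have := h1 i hi hir
      simp only
      rw [tauB_of_ne hX1 (by omega) (by omega) (by omega) (by omega)]
      omega
    · intro i hi him h
      have hik : k < i := by
        by_contra hik
        obtain ⟨e0, e⟩ := n1 i hi (by omega)
        revert h
        simp only [tauB]
        split_ifs <;> omega
      have hσi : (X : ℤ) + 2 < σ i := by
        simp only at h
        have := hinj i hik him
        have := n3 i hik him
        rwa [tauB_of_ne hX1 (by omega) (by omega) (by omega) (by omega)] at h
      by_contra hqi
      rcases eq_or_lt_of_le (not_lt.mp hqi) with h' | h'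
      · rw [h', eq] at hσi
        omega
      · have := n2 i q hik h' hq.2
        omega
    · intro i hi his
      have e := n1 i (by omega) (by omega)
      have := h2 i hi his
      simp only
      rw [tauB_of_ne hX1 (by omega) (by omega) (by omega) (by omega)]
      omega

/-- The stages that connect the increasing sequence `1, …, k` with the sequence
`2 k - 1, 2 k - 3, …, 1`. -/
def stageSeq (k r j i : ℤ) : ℤ :=
  if i < r then i else if i = r then r + 2 * j
  else if i ≤ k - j then r + 1 + 2 * (k - i) else r + 2 * (k - i)

theorem IsStageB.exists_stageSeq {m k c : ℕ} (hm : c + 2 * k ≤ m)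
    {w : (Fin m → ℤ) ≃ₗ[ℤ] (Fin m → ℤ)} (h : IsStageB m k c (fun i => i) w) (hk : 1 ≤ k) :
    ∃ w', IsStageB m k c (fun i => 2 * (k - i) + 1) w' ∧
      (typeB m).numRed w = (typeB m).numRed w' := by
  -- One step raises the entry at `r` from r + 2j to r + 2j + 2 and lowers the entry at k - j from r
  -- + 2j + 1 to r + 2j.
  have inner : ∀ (r : ℤ), 1 ≤ r → r ≤ k → ∀ j : ℕ, j ≤ k - r → ∀ w,
      IsStageB m k c (stageSeq k r 0) w → ∃ w', IsStageB m k c (stageSeq k r j) w' ∧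
        (typeB m).numRed w = (typeB m).numRed w' := by
    intro r hr hrk j
    induction j with
    | zero => exact fun _ w hw => ⟨w, hw, rfl⟩
    | succ j ih =>
      intro hj w hw
      obtain ⟨w', hw', e⟩ := ih (by omega) w hw
      obtain ⟨w'', hw'', e'⟩ := hw'.step (a' := stageSeq k r (j + 1 : ℕ)) (by omega)
        (x := r + 2 * j) (r := r)
        (s := k - j) (by omega) (by omega) hr (by omega) (by omega)
        (by unfold stageSeq; split_ifs <;> omega)
        (by unfold stageSeq; split_ifs <;> omega)
        (by intro i h1 h2; unfold stageSeq; split_ifs; omega)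
        (by intro i h1 h2; unfold stageSeq; split_ifs <;> omega)
        (by intro i h1 h2; unfold stageSeq; split_ifs <;> omega)
        (by unfold stageSeq; split_ifs <;> omega)
        (by unfold stageSeq; split_ifs <;> omega)
        (by intro i h1 h2 h3 h4; unfold stageSeq; split_ifs <;> omega)
      exact ⟨w'', hw'', e.trans e'⟩
  -- Once j = k - r, all entries from `r` on equal r + 2(k - i), which is the sequence for r - 1
  -- with j = 0. So `r` runs down from k, where the sequence is 1, …, k, to 1.
  have outer : ∀ t : ℕ, t < k → ∃ w', IsStageB m k c (stageSeq k (k - t) 0) w' ∧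
      (typeB m).numRed w = (typeB m).numRed w' := by
    intro t
    induction t with
    | zero =>
      exact fun _ => ⟨w, h.congr fun i h1 h2 => by unfold stageSeq; split_ifs <;> omega, rfl⟩
    | succ t ih =>
      intro ht
      obtain ⟨w', hw', e⟩ := ih (by omega)
      obtain ⟨w'', hw'', e'⟩ := inner (k - t) (by omega) (by omega) t (by omega) w' hw'
      exact ⟨w'', hw''.congr fun i h1 h2 => by unfold stageSeq; split_ifs <;> omega, e.trans e'⟩
  obtain ⟨w', hw', e⟩ := outer (k - 1) (by omega)
  obtain ⟨w'', hw'', e'⟩ := inner (k - (k - 1 : ℕ)) (by omega) (by omega) (k - 1) (by omega) w' hw'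
  exact ⟨w'', hw''.congr fun i h1 h2 => by unfold stageSeq; split_ifs <;> omega, e.trans e'⟩

/-! ### Node-number words, change of rank and the element b_{k,n} -/

namespace CartanDatum

variable {n : ℕ} {R : Type} [CommRing R] (C : CartanDatum n R)

theorem s_succ {y : ℕ} (h : y < n) : C.s (y + 1) = C.refl ⟨y, h⟩ := by
  rw [s, dif_pos ⟨by omega, by omega⟩]
  rfl

theorem s_mem_W (i : ℕ) : C.s i ∈ C.W := by
  unfold s
  split_ifs
  · exact C.refl_mem_W _
  · exact C.W.one_mem

@[simp] theorem elt_nil : C.elt [] = 1 := rfl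

theorem elt_cons (i : ℕ) (l : List ℕ) : C.elt (i :: l) = C.s i * C.elt l := by
  simp [elt]

theorem elt_append (l l' : List ℕ) : C.elt (l ++ l') = C.elt l * C.elt l' := by
  simp [elt]

theorem elt_mem_W (l : List ℕ) : C.elt l ∈ C.W := by
  induction l with
  | nil => exact C.W.one_mem
  | cons i l ih => exact C.elt_cons i l ▸ C.W.mul_mem (C.s_mem_W i) ih

end CartanDatum

/-- The number of reduced words of an element of a parabolic subgroup of type `B` does not depend on
the rank of the ambient group. -/
theorem numRed_typeB_lift {m n : ℕ} (hmn : m ≤ n) {w : (Fin m → ℤ) ≃ₗ[ℤ] (Fin m → ℤ)}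
    (hw : w ∈ (typeB m).W) :
    ∃ w' σ, w' ∈ (typeB n).W ∧ ActsB m w σ ∧ ActsB n w' σ ∧ (∀ a : ℤ, m < a → σ a = a) ∧
      (typeB m).numRed w = (typeB n).numRed w' := by
  let Rel : ((Fin m → ℤ) ≃ₗ[ℤ] (Fin m → ℤ)) → ((Fin n → ℤ) ≃ₗ[ℤ] (Fin n → ℤ)) → Prop :=
    fun w w' => w ∈ (typeB m).W ∧ w' ∈ (typeB n).W ∧
      ∃ σ, ActsB m w σ ∧ ActsB n w' σ ∧ ∀ a : ℤ, m < a → σ a = a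
  have hstep : ∀ w w', Rel w w' → ∀ i : Fin m,
      Rel ((typeB m).refl i * w) ((typeB n).refl (Fin.castLE hmn i) * w') := by
    rintro w w' ⟨hw, hw', σ, h1, h2, h3⟩ i
    refine ⟨refl_mul_mem_W _ hw, refl_mul_mem_W _ hw', _, h1.refl_mul i,
      h2.refl_mul (Fin.castLE hmn i), fun a ha => ?_⟩
    have := i.2
    rw [h3 a ha]
    unfold tauB
    split_ifs <;> omega
  have hex : ∃ w', Rel w w' := by
    obtain ⟨l, rfl⟩ := exists_word hw
    clear hw
    induction l with
    | nil => exact ⟨1, Subgroup.one_mem _, Subgroup.one_mem _, id, ActsB.one m, ActsB.one n,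
        fun _ _ => rfl⟩
    | cons i l ih =>
      obtain ⟨w', h⟩ := ih
      rw [wordProd_cons]
      exact ⟨_, hstep _ _ h i⟩
  obtain ⟨w', h⟩ := hex
  have hnum : (typeB m).numRed w = (typeB n).numRed w' := by
    refine numRed_eq_of_rel Rel (fun w w' h => ⟨h.1, h.2.1⟩) ?_ h
    rintro w w' hR
    obtain ⟨hw, hw', σ, h1, h2, h3⟩ := id hR
    refine ⟨Fin.castLE hmn, ⟨?_, fun i _ j _ h => Fin.castLE_injective hmn h, ?_⟩,
      fun i _ => hstep _ _ hR i⟩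
    · intro i hi
      have hi' := i.2
      obtain ⟨p, hp, ep⟩ := h1.surjOn hw (c := i + 1) (by omega)
      obtain ⟨q, hq, eq⟩ := h1.surjOn hw (c := i) (by omega)
      rw [Finset.mem_coe, h1.mem_desc_iff hw i hp hq ep eq] at hi
      rw [Finset.mem_coe, h2.mem_desc_iff hw' (Fin.castLE hmn i) (p := p) (p' := q) (by omega)
        (by omega) ep eq]
      exact hi
    · intro j hj
      have hj' := j.2
      by_cases hjm : (j : ℕ) < m
      · refine ⟨⟨j, hjm⟩, ?_, rfl⟩
        obtain ⟨p, hp, ep⟩ := h1.surjOn hw (c := j + 1) (by omega)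
        obtain ⟨q, hq, eq⟩ := h1.surjOn hw (c := j) (by omega)
        rw [Finset.mem_coe, h2.mem_desc_iff hw' j (p := p) (p' := q) (by omega) (by omega) ep
          eq] at hj
        rw [Finset.mem_coe, h1.mem_desc_iff hw ⟨j, hjm⟩ hp hq ep eq]
        exact hj
      -- Values above `m` are fixed, so a node outside the smaller diagram is never a descent.
      · exfalso
        obtain ⟨q, hq, eq⟩ := h2.surjOn hw' (c := j) (by omega)
        rw [Finset.mem_coe, h2.mem_desc_iff hw' j (p := j + 1) (p' := q) (by omega) hq
          (h3 _ (by omega)) eq] at hj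
        have := h3 q (by omega)
        omega
  obtain ⟨-, hw', σ, h1, h2, h3⟩ := h
  exact ⟨w', σ, hw', h1, h2, h3, hnum⟩

theorem elt_range'_typeB_apply {m : ℕ} (j : ℕ) (hj : j ≤ m) {i : ℤ} (hi : 1 ≤ i) (him : i ≤ m) :
    (typeB m).elt (List.range' 1 j) (vecB m i) =
      vecB m (if i < j then i + 1 else if i = j then -1 else i) := by
  induction j generalizing i with
  | zero =>
    rw [List.range'_zero, elt_nil, if_neg (by omega), if_neg (by omega)]
    rfl
  | succ j ih =>
    rw [List.range'_concat, elt_append, elt_cons, elt_nil, mul_one, LinearEquiv.mul_apply,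
      show 1 + 1 * j = j + 1 by ring, s_succ _ (by omega), refl_vecB _ (by omega)]
    have ht : tauB j i = -1 ∧ j = 0 ∧ i = 1 ∨ 1 ≤ tauB j i ∧ tauB j i ≤ m ∧
        (if tauB j i < j then tauB j i + 1 else if tauB j i = j then -1 else tauB j i) =
          if i < (j + 1 : ℕ) then i + 1 else if i = (j + 1 : ℕ) then -1 else i := by
      rcases Nat.eq_zero_or_pos j with rfl | hj0
      · by_cases h1 : i = 1
        · exact Or.inl ⟨by rw [h1]; rfl, rfl, h1⟩
        · right
          have e : tauB 0 i = i := by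
            unfold tauB
            split_ifs <;> omega
          rw [e]
          exact ⟨hi, him, by split_ifs <;> omega⟩
      · right
        by_cases h1 : i = j
        · rw [h1, tauB_self hj0]
          exact ⟨by omega, by omega, by split_ifs <;> omega⟩
        · by_cases h2 : i = j + 1
          · rw [h2, tauB_succ hj0]
            exact ⟨by omega, by omega, by split_ifs <;> omega⟩
          · rw [tauB_of_ne hj0 h1 h2 (by omega) (by omega)]
            exact ⟨by omega, by omega, by split_ifs <;> omega⟩
    rcases ht with ⟨h1, rfl, rfl⟩ | ⟨h1, h2, h3⟩
    · simp only [h1]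
      simp [elt]
    · rw [ih (by omega) h1 h2, h3]

theorem elt_range'_typeB_pow_apply {m : ℕ} (t : ℕ) (ht : t ≤ m) {i : ℤ} (hi : 1 ≤ i)
    (him : i ≤ m) :
    ((typeB m).elt (List.range' 1 m) ^ t) (vecB m i) =
      vecB m (if i + t ≤ m then i + t else -(i + t - m)) := by
  induction t with
  | zero => simp [him]
  | succ t ih =>
    rw [pow_succ', LinearEquiv.mul_apply, ih (by omega)]
    split_ifs with h1 h2 h2
    · rw [elt_range'_typeB_apply m le_rfl (by omega) h1, if_pos (by omega)]
      push_cast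
      ring_nf
    · rw [elt_range'_typeB_apply m le_rfl (by omega) h1, if_neg (by omega), if_pos (by omega)]
      congr 1
      push_cast at *
      omega
    · omega
    · rw [vecB_neg, map_neg, elt_range'_typeB_apply m le_rfl (by omega) (by omega),
        if_pos (by omega), ← vecB_neg]
      congr 1
      push_cast
      ring

theorem bElt_mem_W (k n : ℕ) : bElt k n ∈ (typeB (n - k)).W :=
  Subgroup.pow_mem _ (elt_mem_W _ _) _

theorem bElt_apply {k n : ℕ} (hn : 2 * k ≤ n) {i : ℤ} (hi : 1 ≤ i) (him : i ≤ (n - k : ℕ)) :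
    bElt k n (vecB (n - k) i) = vecB (n - k)
      (if i + k ≤ (n - k : ℕ) then i + k else -(i + k - (n - k : ℕ))) :=
  elt_range'_typeB_pow_apply k (by omega) hi him

/-- The inverse of b_{k,n} has the values -(c+1), …, -(c+k), 1, 2, … with c = n - 2k. Since k ≥ 1,
the lift to rank n fixes the value n, as the cover identity requires. -/
theorem exists_isStageB_bElt {k n : ℕ} (hk : 1 ≤ k) (hn : 2 * k ≤ n) :
    ∃ w, IsStageB n k (n - 2 * k) (fun i => i) w ∧
      (typeB (n - k)).numRed (bElt k n) = (typeB n).numRed w := by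
  have hb := Subgroup.inv_mem _ (bElt_mem_W k n)
  obtain ⟨w, σ, hw, h1, h2, h3, h4⟩ := numRed_typeB_lift (n := n) (by omega) hb
  have inv : ∀ i j : ℤ, 1 ≤ i → i ≤ (n - k : ℕ) →
      -((n - k : ℕ) : ℤ) ≤ j ∧ j ≤ (n - k : ℕ) →
      (if i + k ≤ (n - k : ℕ) then i + k else -(i + k - (n - k : ℕ))) = j → σ j = i := by
    intro i j hi him hj e
    have := bElt_apply hn hi him
    rw [e] at this
    obtain ⟨b1, b2⟩ := h1 j hj
    rw [← this, inv_apply_apply] at b2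
    exact (vecB_injective (by omega) b1 b2).symm
  refine ⟨w, ⟨hw, σ, h2, ?_, ?_, ?_, h3 n (by omega)⟩, by rw [← h4, numRed_inv]⟩
  · intro i hi hik
    have h5 := inv (i + (n - k : ℕ) - k) (-i) (by omega) (by omega) (by omega)
      (by split_ifs <;> omega)
    have h6 := h1.map_neg (a := i) (by omega)
    show 0 < i ∧ σ i = -(((n - 2 * k : ℕ) : ℤ) + i)
    omega
  · have hpos : ∀ i : ℤ, k < i → i ≤ (n - k : ℕ) → σ i = i - k := fun i hi hi' =>
      inv (i - k) i (by omega) (by omega) (by omega) (by split_ifs <;> omega)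
    intro i j hi hij hj
    by_cases hi' : i ≤ (n - k : ℕ)
    · rw [hpos i hi hi']
      by_cases hj' : j ≤ (n - k : ℕ)
      · rw [hpos j (by omega) hj']
        omega
      · rw [h3 j (by omega)]
        omega
    · rw [h3 i (by omega), h3 j (by omega)]
      exact hij
  · intro i hi him
    by_cases hi' : i ≤ (n - k : ℕ)
    · rw [inv (i - k) i (by omega) (by omega) (by omega) (by split_ifs <;> omega)]
      omega
    · rw [h3 i (by omega)]
      omega

/-! ### Type D signed permutations and comparison of Grassmannian elements -/

theorem vecD_zero (m : ℕ) : vecD m 0 = 0 := by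
  ext i
  simp only [vecD, Pi.zero_apply]
  grind [unitD]

theorem tauD_zero (y : ℕ) : tauD y 0 = 0 := by
  grind [tauD]

theorem refl_vecD' {m : ℕ} (hm : 2 ≤ m) (i : Fin m) {a : ℤ} (ha : -m ≤ a ∧ a ≤ m) :
    (typeD m).refl i (vecD m a) = vecD m (tauD i a) := by
  by_cases h0 : a = 0
  · rw [h0, tauD_zero, vecD_zero, map_zero]
  · exact refl_vecD hm i ha h0

theorem vecD_injective {m : ℕ} (hm : 2 ≤ m) {a b : ℤ} (ha : -m ≤ a ∧ a ≤ m)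
    (hb : -m ≤ b ∧ b ≤ m) (h : vecD m a = vecD m b) : a = b := by
  have h1 : ∀ p : ℕ, p < m → unitD a p = unitD b p := fun p hp => congrFun h ⟨p, hp⟩
  have e0 := h1 0 (by omega)
  have e1 := h1 1 (by omega)
  by_contra hne
  have key : ∀ a b : ℤ, (-m ≤ a ∧ a ≤ m) → (-m ≤ b ∧ b ≤ m) → |b| ≤ |a| → a ≠ b →
      unitD a 0 = unitD b 0 → unitD a 1 = unitD b 1 →
      unitD a (|a|.toNat - 1) ≠ unitD b (|a|.toNat - 1) := by
    intro a b ha hb hab hne e0 e1 e2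
    rcases abs_cases a with ⟨h1, h2⟩ | ⟨h1, h2⟩ <;> rcases abs_cases b with ⟨h3, h4⟩ | ⟨h3, h4⟩ <;>
      simp only [h1, h3] at hab e2 <;> unfold unitD at e0 e1 e2 <;> clear h h1 <;>
      grind (splits := 60)
  rcases le_total |b| |a| with hab | hab
  · by_cases ha0 : a = 0
    · subst ha0
      simp at hab
      exact hne hab.symm
    · have := abs_le.mpr ha
      have := abs_pos.mpr ha0
      exact key a b ha hb hab hne e0 e1 (h1 _ (by omega))
  · by_cases hb0 : b = 0
    · subst hb0
      simp at hab
      exact hne hab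
    · have := abs_le.mpr hb
      have := abs_pos.mpr hb0
      exact key b a hb ha hab (Ne.symm hne) e0.symm e1.symm (h1 _ (by omega)).symm

/-- `w` acts on the vectors `2 e a` in type `D` as the signed permutation `σ`. -/
def ActsD (m : ℕ) (w : (Fin m → ℤ) ≃ₗ[ℤ] (Fin m → ℤ)) (σ : ℤ → ℤ) : Prop :=
  ∀ a : ℤ, -m ≤ a ∧ a ≤ m → (-m ≤ σ a ∧ σ a ≤ m) ∧ w (vecD m a) = vecD m (σ a)

/-- `σ` restricts to a signed permutation of `-m, …, m`. -/
structure IsSignedPerm (m : ℕ) (σ : ℤ → ℤ) : Prop where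
  mem : ∀ a : ℤ, -m ≤ a ∧ a ≤ m → -m ≤ σ a ∧ σ a ≤ m
  neg : ∀ a : ℤ, -m ≤ a ∧ a ≤ m → σ (-a) = -σ a
  inj : ∀ a b : ℤ, -m ≤ a ∧ a ≤ m → -m ≤ b ∧ b ≤ m → σ a = σ b → a = b
  surj : ∀ c : ℤ, -m ≤ c ∧ c ≤ m → ∃ a : ℤ, (-m ≤ a ∧ a ≤ m) ∧ σ a = c

theorem ActsB.isSignedPerm {m : ℕ} {w : (Fin m → ℤ) ≃ₗ[ℤ] (Fin m → ℤ)} {σ : ℤ → ℤ}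
    (h : ActsB m w σ) (hw : w ∈ (typeB m).W) : IsSignedPerm m σ where
  mem a ha := (h a ha).1
  neg _ ha := h.map_neg ha
  inj _ _ ha hb := h.injOn ha hb
  surj _ hc := h.surjOn hw hc

namespace ActsD

variable {m : ℕ} {w : (Fin m → ℤ) ≃ₗ[ℤ] (Fin m → ℤ)} {σ : ℤ → ℤ}

theorem one (m : ℕ) : ActsD m 1 id := fun _ h => ⟨h, rfl⟩

theorem refl_mul (hm : 2 ≤ m) (h : ActsD m w σ) (i : Fin m) :
    ActsD m ((typeD m).refl i * w) fun a => tauD i (σ a) := fun a ha => by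
  obtain ⟨h1, h2⟩ := h a ha
  exact ⟨tauD_mem hm i h1, by rw [LinearEquiv.mul_apply, h2, refl_vecD' hm i h1]⟩

theorem exists_of_mem (hm : 2 ≤ m) (hw : w ∈ (typeD m).W) : ∃ σ, ActsD m w σ := by
  obtain ⟨l, rfl⟩ := exists_word hw
  induction l with
  | nil => exact ⟨id, one m⟩
  | cons i l ih =>
    obtain ⟨σ, hσ⟩ := ih (wordProd_mem_W _ l)
    exact ⟨_, by simpa using hσ.refl_mul hm i⟩

theorem isSignedPerm (hm : 2 ≤ m) (h : ActsD m w σ) (hw : w ∈ (typeD m).W) :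
    IsSignedPerm m σ where
  mem a ha := (h a ha).1
  neg a ha := by
    have h1 := h a ha
    have h2 := h (-a) (by omega)
    refine vecD_injective hm h2.1 (by omega) ?_
    rw [← h2.2, vecD_neg, vecD_neg, map_neg, h1.2]
  inj a b ha hb hab := by
    refine vecD_injective hm ha hb (w.injective ?_)
    rw [(h a ha).2, (h b hb).2, hab]
  surj c hc := by
    obtain ⟨σ', h'⟩ := exists_of_mem hm ((typeD m).W.inv_mem hw)
    obtain ⟨h1, h2⟩ := h' c hc
    refine ⟨σ' c, h1, vecD_injective hm (h _ h1).1 hc ?_⟩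
    rw [← (h _ h1).2, ← h2, apply_inv_apply]

theorem apply_rootD (h : ActsD m w σ) (hs : IsSignedPerm m σ) {a b : ℤ} (hI : IsIdxD m a b) :
    IsIdxD m (σ a) (σ b) ∧ w (rootD m a b) = rootD m (σ a) (σ b) := by
  obtain ⟨h1, h2, h3, h4, h5, h6⟩ := hI
  have hz : σ 0 = 0 := by
    have := hs.neg 0 (by omega)
    rw [neg_zero] at this
    omega
  have h3' : σ a ≠ 0 := fun e => h3 (hs.inj _ _ h1 (by omega) (e.trans hz.symm))
  have h4' : σ b ≠ 0 := fun e => h4 (hs.inj _ _ h2 (by omega) (e.trans hz.symm))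
  exact ⟨⟨hs.mem a h1, hs.mem b h2, h3', h4', fun e => h5 (hs.inj _ _ h1 h2 e),
    fun e => h6 (hs.inj _ _ h1 (by omega) (by rw [e, hs.neg b h2]))⟩,
    RootPosetEmbedding.apply_rootD h3 h4 h3' h4' (h a h1).2 (h b h2).2⟩

theorem inv_rootD (h : ActsD m w σ) (hs : IsSignedPerm m σ) {a b : ℤ} (hI : IsIdxD m a b) :
    w⁻¹ (rootD m (σ a) (σ b)) = rootD m a b := by
  rw [← (h.apply_rootD hs hI).2, inv_apply_apply]

theorem zero_mem_desc_iff (hm : 2 ≤ m) (h : ActsD m w σ) (hw : w ∈ (typeD m).W) {p p' : ℤ}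
    (hp : -m ≤ p ∧ p ≤ m) (hp' : -m ≤ p' ∧ p' ≤ m) (e : σ p = 1) (e' : σ p' = 2) :
    ⟨0, by omega⟩ ∈ (typeD m).desc w ↔ p + p' < 0 := by
  have hs := h.isSignedPerm hm hw
  have hz := hs.neg 0 (by omega)
  have hI : IsIdxD m p p' := by
    refine ⟨hp, hp', ?_, ?_, ?_, ?_⟩
    · rintro rfl
      rw [neg_zero] at hz
      omega
    · rintro rfl
      rw [neg_zero] at hz
      omega
    · rintro rfl
      omega
    · rintro rfl
      rw [hs.neg p' hp'] at e
      omega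
  rw [(typeD_isFiniteType hm).mem_desc_iff hw, simpleRoot_typeD_zero hm, ← e, ← e',
    h.inv_rootD hs hI, rootD_nonneg_iff hm hI]
  omega

theorem mem_desc_iff (hm : 2 ≤ m) (h : ActsD m w σ) (hw : w ∈ (typeD m).W) (i : Fin m)
    (hi : (i : ℕ) ≠ 0) {p p' : ℤ} (hp : -m ≤ p ∧ p ≤ m) (hp' : -m ≤ p' ∧ p' ≤ m)
    (e : σ p = i + 1) (e' : σ p' = i) : i ∈ (typeD m).desc w ↔ p < p' := by
  have hs := h.isSignedPerm hm hw
  have hz := hs.neg 0 (by omega)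
  have en := hs.neg p' hp'
  have hI : IsIdxD m p (-p') := by
    refine ⟨hp, by omega, ?_, ?_, ?_, ?_⟩
    · rintro rfl
      rw [neg_zero] at hz
      omega
    · intro h0
      rw [neg_eq_zero.mp h0] at e'
      rw [neg_zero] at hz
      omega
    · rintro rfl
      omega
    · rintro h0
      rw [neg_neg] at h0
      subst h0
      omega
  rw [(typeD_isFiniteType hm).mem_desc_iff hw, simpleRoot_typeD_succ i hi, ← e, ← e', ← en,
    h.inv_rootD hs hI, rootD_nonneg_iff hm hI]
  omega

end ActsD

/-- `z` is a value of `σ` at a positive argument. -/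
def Hits (m : ℕ) (σ : ℤ → ℤ) (z : ℤ) : Prop := ∃ i : ℤ, 1 ≤ i ∧ i ≤ m ∧ σ i = z

namespace IsSignedPerm

variable {m : ℕ} {σ : ℤ → ℤ} (hs : IsSignedPerm m σ)
include hs

theorem map_zero : σ 0 = 0 := by
  have := hs.neg 0 (by omega)
  rw [neg_zero] at this
  omega

theorem hits_neg_iff {z : ℤ} (hz : -m ≤ z ∧ z ≤ m) (h0 : z ≠ 0) :
    Hits m σ (-z) ↔ ¬ Hits m σ z := by
  constructor
  · rintro ⟨i, hi, him, e⟩ ⟨j, hj, hjm, e'⟩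
    have := hs.inj i (-j) (by omega) (by omega) (by rw [e, hs.neg j (by omega), e'])
    omega
  · intro h
    obtain ⟨a, ha, e⟩ := hs.surj z hz
    have ha0 : a ≠ 0 := by
      rintro rfl
      exact h0 (e ▸ hs.map_zero)
    by_cases hpos : 0 < a
    · exact absurd ⟨a, by omega, by omega, e⟩ h
    · exact ⟨-a, by omega, by omega, by rw [hs.neg a ha, e]⟩

/-- For an increasing `σ` the order of two preimages depends only on the signs with which the two
values occur at positive arguments. Descents thus become conditions on a set of values, that is, on
a shifted shape. -/
theorem lt_iff_hits (hmono : ∀ i j : ℤ, 1 ≤ i → i < j → j ≤ m → σ i < σ j) {q q' z z' : ℤ}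
    (hq : -m ≤ q ∧ q ≤ m) (hq' : -m ≤ q' ∧ q' ≤ m) (e : σ q = z) (e' : σ q' = z')
    (h0 : 0 < z') (hzz : z' < z) : q < q' ↔ Hits m σ (-z) ∧ Hits m σ z' := by
  have bz := e ▸ hs.mem q hq
  have bz' := e' ▸ hs.mem q' hq'
  have hz := hs.map_zero
  have q0 : q ≠ 0 := by
    rintro rfl
    omega
  have q0' : q' ≠ 0 := by
    rintro rfl
    omega
  have hn := hs.neg q hq
  have hn' := hs.neg q' hq'
  have x1 := hs.hits_neg_iff bz (by omega)
  have x2 := hs.hits_neg_iff bz' (by omega)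
  rcases lt_or_gt_of_ne q0 with h1 | h1 <;> rcases lt_or_gt_of_ne q0' with h2 | h2
  · have y : Hits m σ (-z') := ⟨-q', by omega, by omega, by omega⟩
    have : ¬ q < q' := fun h => by
      have := hmono (-q') (-q) (by omega) (by omega) (by omega)
      omega
    tauto
  · have y : Hits m σ (-z) := ⟨-q, by omega, by omega, by omega⟩
    have y' : Hits m σ z' := ⟨q', by omega, by omega, by omega⟩
    have : q < q' := by omega
    tauto
  · have y : Hits m σ z := ⟨q, by omega, by omega, by omega⟩
    have : ¬ q < q' := by omega
    tauto
  · have y : Hits m σ z := ⟨q, by omega, by omega, by omega⟩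
    have : ¬ q < q' := fun h => by
      have := hmono q q' (by omega) (by omega) (by omega)
      omega
    tauto

theorem add_neg_iff_hits (hmono : ∀ i j : ℤ, 1 ≤ i → i < j → j ≤ m → σ i < σ j) {q q' z z' : ℤ}
    (hq : -m ≤ q ∧ q ≤ m) (hq' : -m ≤ q' ∧ q' ≤ m) (e : σ q = z) (e' : σ q' = z')
    (h0 : 0 < z) (h0' : 0 < z') : q + q' < 0 ↔ Hits m σ (-z) ∧ Hits m σ (-z') := by
  have bz := e ▸ hs.mem q hq
  have bz' := e' ▸ hs.mem q' hq'
  have hz := hs.map_zero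
  have q0 : q ≠ 0 := by
    rintro rfl
    omega
  have q0' : q' ≠ 0 := by
    rintro rfl
    omega
  have hn := hs.neg q hq
  have hn' := hs.neg q' hq'
  have x1 := hs.hits_neg_iff bz (by omega)
  have x2 := hs.hits_neg_iff bz' (by omega)
  rcases lt_or_gt_of_ne q0 with h1 | h1 <;> rcases lt_or_gt_of_ne q0' with h2 | h2
  · have y : Hits m σ (-z) := ⟨-q, by omega, by omega, by omega⟩
    have y' : Hits m σ (-z') := ⟨-q', by omega, by omega, by omega⟩
    have : q + q' < 0 := by omega
    tauto
  · have y' : Hits m σ z' := ⟨q', by omega, by omega, by omega⟩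
    have : ¬ q + q' < 0 := fun h => by
      have := hmono q' (-q) (by omega) (by omega) (by omega)
      omega
    tauto
  · have y : Hits m σ z := ⟨q, by omega, by omega, by omega⟩
    have : ¬ q + q' < 0 := fun h => by
      have := hmono q (-q') (by omega) (by omega) (by omega)
      omega
    tauto
  · have y : Hits m σ z := ⟨q, by omega, by omega, by omega⟩
    have : ¬ q + q' < 0 := by omega
    tauto

end IsSignedPerm

/-- `σ` is increasing at positive arguments. -/
def IncrPos (m : ℕ) (σ : ℤ → ℤ) : Prop := ∀ i j : ℤ, 1 ≤ i → i < j → j ≤ m → σ i < σ j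

theorem hits_comp_iff {m : ℕ} {σ τ : ℤ → ℤ} (hτ : ∀ a, τ (τ a) = a) (z : ℤ) :
    Hits m (fun a => τ (σ a)) z ↔ Hits m σ (τ z) := by
  constructor
  · rintro ⟨i, h1, h2, h3⟩
    exact ⟨i, h1, h2, by rw [← h3, hτ]⟩
  · rintro ⟨i, h1, h2, h3⟩
    exact ⟨i, h1, h2, by simp only [h3, hτ]⟩

theorem IncrPos.comp {m : ℕ} {σ τ : ℤ → ℤ} (h : IncrPos m σ)
    (hτ : ∀ a b, Hits m σ a → Hits m σ b → a < b → τ a < τ b) :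
    IncrPos m fun a => τ (σ a) := fun i j hi hij hj =>
  hτ _ _ ⟨i, hi, by omega, rfl⟩ ⟨j, by omega, hj, rfl⟩ (h i j hi hij hj)

/-- The excluded values are those missing when the node is a descent, so removing a descent keeps
the element Grassmannian. -/
theorem IncrPos.comp_tauB {m : ℕ} {σ : ℤ → ℤ} (h : IncrPos m σ) {y : ℕ}
    (h1 : ¬ Hits m σ (y + 1)) (h2 : ¬ Hits m σ (-y)) : IncrPos m fun a => tauB y (σ a) := by
  refine h.comp fun a b ha hb hab => ?_
  have ha1 : a ≠ y + 1 := by rintro rfl; exact h1 ha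
  have hb1 : b ≠ y + 1 := by rintro rfl; exact h1 hb
  have ha2 : a ≠ -y := by rintro rfl; exact h2 ha
  have hb2 : b ≠ -y := by rintro rfl; exact h2 hb
  unfold tauB
  split_ifs <;> omega

theorem IncrPos.comp_tauD {m : ℕ} {σ : ℤ → ℤ} (h : IncrPos m σ) {y : ℕ} (hy : y ≠ 0)
    (h1 : ¬ Hits m σ (y + 1)) (h2 : ¬ Hits m σ (-y)) : IncrPos m fun a => tauD y (σ a) := by
  refine h.comp fun a b ha hb hab => ?_
  have ha1 : a ≠ y + 1 := by rintro rfl; exact h1 ha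
  have hb1 : b ≠ y + 1 := by rintro rfl; exact h1 hb
  have ha2 : a ≠ -y := by rintro rfl; exact h2 ha
  have hb2 : b ≠ -y := by rintro rfl; exact h2 hb
  unfold tauD
  split_ifs <;> omega

theorem IncrPos.comp_tauD_zero {m : ℕ} {σ : ℤ → ℤ} (h : IncrPos m σ)
    (h1 : ¬ Hits m σ 1) (h2 : ¬ Hits m σ 2) (h3 : ¬ Hits m σ 0) :
    IncrPos m fun a => tauD 0 (σ a) := by
  refine h.comp fun a b ha hb hab => ?_
  have ha1 : a ≠ 1 := by rintro rfl; exact h1 ha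
  have hb1 : b ≠ 1 := by rintro rfl; exact h1 hb
  have ha2 : a ≠ 2 := by rintro rfl; exact h2 ha
  have hb2 : b ≠ 2 := by rintro rfl; exact h2 hb
  have ha3 : a ≠ 0 := by rintro rfl; exact h3 ha
  have hb3 : b ≠ 0 := by rintro rfl; exact h3 hb
  unfold tauD
  split_ifs <;> omega

theorem IsSignedPerm.not_hits_zero {m : ℕ} {σ : ℤ → ℤ} (hs : IsSignedPerm m σ) :
    ¬ Hits m σ 0 := by
  rintro ⟨i, h1, h2, h3⟩
  have := hs.inj i 0 (by omega) (by omega) (by rw [h3, hs.map_zero])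
  omega

theorem ActsB.mem_desc_iff_hits {m : ℕ} {w : (Fin m → ℤ) ≃ₗ[ℤ] (Fin m → ℤ)} {σ : ℤ → ℤ}
    (h : ActsB m w σ) (hw : w ∈ (typeB m).W) (hσ : IncrPos m σ) (i : Fin m) :
    i ∈ (typeB m).desc w ↔ Hits m σ (-(i + 1)) ∧ ((i : ℕ) ≠ 0 → Hits m σ i) := by
  have hs := h.isSignedPerm hw
  have hi := i.2
  obtain ⟨p, hp, ep⟩ := hs.surj (i + 1) (by omega)
  obtain ⟨q, hq, eq⟩ := hs.surj i (by omega)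
  rw [h.mem_desc_iff hw i hp hq ep eq]
  by_cases hi0 : (i : ℕ) = 0
  · have hq0 : q = 0 := hs.inj _ _ hq (by omega) (by rw [eq, hs.map_zero]; omega)
    have hz := hs.map_zero
    constructor
    · intro hlt
      exact ⟨⟨-p, by omega, by omega, by rw [hs.neg p hp, ep]⟩, fun h => absurd hi0 h⟩
    · rintro ⟨⟨j, h1, h2, h3⟩, -⟩
      have := hs.inj p (-j) hp (by omega) (by rw [ep, hs.neg j (by omega), h3, neg_neg])
      omega
  · rw [hs.lt_iff_hits hσ hp hq ep eq (by omega) (by omega)]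
    tauto

theorem ActsD.mem_desc_iff_hits {m : ℕ} (hm : 2 ≤ m) {w : (Fin m → ℤ) ≃ₗ[ℤ] (Fin m → ℤ)}
    {σ : ℤ → ℤ} (h : ActsD m w σ) (hw : w ∈ (typeD m).W) (hσ : IncrPos m σ) (i : Fin m)
    (hi0 : (i : ℕ) ≠ 0) :
    i ∈ (typeD m).desc w ↔ Hits m σ (-(i + 1)) ∧ Hits m σ i := by
  have hs := h.isSignedPerm hm hw
  have hi := i.2
  obtain ⟨p, hp, ep⟩ := hs.surj (i + 1) (by omega)
  obtain ⟨q, hq, eq⟩ := hs.surj i (by omega)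
  rw [h.mem_desc_iff hm hw i hi0 hp hq ep eq, hs.lt_iff_hits hσ hp hq ep eq (by omega) (by omega)]

theorem ActsD.zero_mem_desc_iff_hits {m : ℕ} (hm : 2 ≤ m)
    {w : (Fin m → ℤ) ≃ₗ[ℤ] (Fin m → ℤ)}
    {σ : ℤ → ℤ} (h : ActsD m w σ) (hw : w ∈ (typeD m).W) (hσ : IncrPos m σ) :
    ⟨0, by omega⟩ ∈ (typeD m).desc w ↔ Hits m σ (-1) ∧ Hits m σ (-2) := by
  have hs := h.isSignedPerm hm hw
  obtain ⟨p, hp, ep⟩ := hs.surj 1 (by omega)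
  obtain ⟨q, hq, eq⟩ := hs.surj 2 (by omega)
  rw [h.zero_mem_desc_iff hm hw hp hq ep eq,
    hs.add_neg_iff_hits hσ hp hq ep eq (by omega) (by omega)]

/-- The minimal coset representatives `w` in type `B` and `w'` in type `D` correspond to the same
shifted shape. -/
def GrassRel (m : ℕ) (w w' : (Fin m → ℤ) ≃ₗ[ℤ] (Fin m → ℤ)) : Prop :=
  w ∈ (typeB m).W ∧ w' ∈ (typeD m).W ∧ ∃ σ ω, ActsB m w σ ∧ ActsD m w' ω ∧ IncrPos m σ ∧
    IncrPos m ω ∧ Hits m σ m ∧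
    ∀ y : ℤ, 1 ≤ y → y < m → (Hits m σ (-y) ↔ Hits m ω (-(y + 1)))

/-- A negative value -y in type B corresponds to -(y+1) in type D, and descents of either element
are the removable boxes of one shifted shape. Type D of rank m has the shapes of type B of rank m -
1, whence the condition that m is taken positively. -/
theorem GrassRel.numRed_eq {m : ℕ} (hm : 2 ≤ m) {w w' : (Fin m → ℤ) ≃ₗ[ℤ] (Fin m → ℤ)}
    (h : GrassRel m w w') : (typeB m).numRed w = (typeD m).numRed w' := by
  refine numRed_eq_of_rel (GrassRel m) (fun w w' h => ⟨h.1, h.2.1⟩) ?_ h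
  clear h w w'
  rintro w w' ⟨hw, hw', σ, ω, hσ, hω, mσ, mω, htop, hrel⟩
  have sσ := hσ.isSignedPerm hw
  have sω := hω.isSignedPerm hm hw'
  have dB := hσ.mem_desc_iff_hits hw mσ
  have dD := hω.mem_desc_iff_hits hm hw' mω
  have d0 := hω.zero_mem_desc_iff_hits hm hw' mω
  have nσ := fun z : ℤ => sσ.hits_neg_iff (z := z)
  have nω := fun z : ℤ => sω.hits_neg_iff (z := z)
  have hrel' : ∀ y : ℤ, 1 ≤ y → y < m → (Hits m σ y ↔ Hits m ω (y + 1)) := by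
    intro y h1 h2
    have := nσ y (by omega) (by omega)
    have := nω (y + 1) (by omega) (by omega)
    have := hrel y h1 h2
    tauto
  have htop' : ¬ Hits m σ (-m) := by
    rw [nσ m (by omega) (by omega)]
    exact fun h => h htop
  have hlast : ∀ i : Fin m, i ∈ (typeB m).desc w → (i : ℕ) + 1 < m := by
    intro i hi
    have := i.2
    by_contra hcon
    have e : ((i : ℕ) : ℤ) + 1 = m := by omega
    exact htop' (e ▸ ((dB i).mp hi).1)
  -- The descent at the double edge corresponds to one of the two fork nodes, selected by the sign
  -- with which 1 occurs in `ω`. Removing it flips that sign, so consecutive diagonal boxes use the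
  -- fork nodes alternately.
  by_cases hm1 : Hits m ω (-1)
  · have hp1 : ¬ Hits m ω 1 := (nω 1 (by omega) (by omega)).mp hm1
    -- The final `else` value is irrelevant, since the last type B node is never a descent.
    refine ⟨fun i => if h : (i : ℕ) + 1 < m then
      (if (i : ℕ) = 0 then ⟨0, by omega⟩ else ⟨i + 1, h⟩) else i, ⟨?_, ?_, ?_⟩, ?_⟩
    · intro i hi
      have hi1 := hlast i hi
      have hi2 := (dB i).mp hi
      simp only [dif_pos hi1]
      split_ifs with h0
      · rw [Finset.mem_coe, d0]
        refine ⟨hm1, ?_⟩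
        have := (hrel 1 le_rfl (by omega)).mp (by simpa [h0] using hi2.1)
        norm_num at this
        exact this
      · rw [Finset.mem_coe, dD _ (by simp)]
        refine ⟨?_, ?_⟩
        · have := (hrel (i + 1) (by omega) (by omega)).mp hi2.1
          push_cast
          exact this
        · have := (hrel' i (by omega) (by omega)).mp (hi2.2 h0)
          push_cast
          exact this
    · intro i hi j hj hij
      have hi1 := hlast i hi
      have hj1 := hlast j hj
      simp only [dif_pos hi1, dif_pos hj1] at hij
      split_ifs at hij <;> simp only [Fin.mk.injEq] at hij <;> exact Fin.ext (by omega)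
    · intro j hj
      rw [Finset.mem_coe] at hj
      have hj2 := j.2
      by_cases h0 : (j : ℕ) = 0
      · refine ⟨⟨0, by omega⟩, ?_, ?_⟩
        · rw [show j = ⟨0, by omega⟩ from Fin.ext h0, d0] at hj
          rw [Finset.mem_coe, dB]
          refine ⟨?_, fun h => absurd rfl h⟩
          have := (hrel 1 le_rfl (by omega)).mpr (by norm_num; exact hj.2)
          simpa using this
        · dsimp only
          rw [dif_pos (by omega), if_pos rfl]
          exact Fin.ext h0.symm
      · have hj3 := (dD j h0).mp hj
        have h1 : (j : ℕ) ≠ 1 := by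
          intro h1
          refine hp1 ?_
          have := hj3.2
          rw [h1] at this
          exact_mod_cast this
        have e : ((j - 1 : ℕ) : ℤ) = j - 1 := by omega
        refine ⟨⟨j - 1, by omega⟩, ?_, ?_⟩
        · rw [Finset.mem_coe, dB]
          simp only [e]
          refine ⟨?_, fun _ => ?_⟩
          · rw [sub_add_cancel]
            exact (hrel j (by omega) (by omega)).mpr hj3.1
          · rw [hrel' _ (by omega) (by omega), sub_add_cancel]
            exact hj3.2
        · simp only
          rw [dif_pos (by omega), if_neg (by omega)]
          exact Fin.ext (by simp only; omega)
    · intro i hi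
      have hi1 := hlast i hi
      have hi2 := (dB i).mp hi
      have hB1 : ¬ Hits m σ (i + 1) := fun h => (nσ (i + 1) (by omega) (by omega)).mp hi2.1 h
      have hB2 : ¬ Hits m σ (-i) := by
        by_cases h0 : (i : ℕ) = 0
        · rw [h0]
          exact sσ.not_hits_zero
        · rw [nσ i (by omega) (by omega), not_not]
          exact hi2.2 h0
      have htopB : Hits m (fun a => tauB i (σ a)) m := by
        have e : tauB i m = m := by
          have hi3 : ((i : ℕ) : ℤ) + 1 < m := by omega
          unfold tauB
          grind
        rw [hits_comp_iff (tauB_tauB i), e]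
        exact htop
      simp only [dif_pos hi1]
      split_ifs with h0
      · refine ⟨refl_mul_mem_W _ hw, refl_mul_mem_W _ hw', _, _, hσ.refl_mul i,
          hω.refl_mul hm _, mσ.comp_tauB hB1 hB2, mω.comp_tauD_zero hp1 ?_ sω.not_hits_zero, htopB, ?_⟩
        · rw [h0] at hi2
          have := (hrel 1 le_rfl (by omega)).mp (by simpa using hi2.1)
          norm_num at this
          exact (nω 2 (by omega) (by omega)).mp this
        · intro y hy hym
          rw [hits_comp_iff (tauB_tauB i), hits_comp_iff (tauD_tauD 0), h0]
          by_cases hy1 : y = 1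
          · subst hy1
            have e1 : tauB 0 (-1) = 1 := rfl
            have e2 : tauD 0 (-(1 + 1)) = 1 := rfl
            rw [e1, e2]
            rw [h0] at hB1
            exact ⟨fun h => absurd h (by simpa using hB1), fun h => absurd h hp1⟩
          · have e1 : tauB 0 (-y) = -y := by unfold tauB; split_ifs <;> omega
            have e2 : tauD 0 (-(y + 1)) = -(y + 1) := by unfold tauD; split_ifs <;> omega
            rw [e1, e2]
            exact hrel y hy hym
      · have hd1 := (hrel (i + 1) (by omega) (by omega)).mp hi2.1
        have hd2 := (hrel' i (by omega) (by omega)).mp (hi2.2 h0)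
        refine ⟨refl_mul_mem_W _ hw, refl_mul_mem_W _ hw', _, _, hσ.refl_mul i,
          hω.refl_mul hm _, mσ.comp_tauB hB1 hB2, mω.comp_tauD (by simp) ?_ ?_, htopB, ?_⟩
        · push_cast
          exact (nω _ (by omega) (by omega)).mp hd1
        · push_cast
          rw [nω _ (by omega) (by omega), not_not]
          exact hd2
        · intro y hy hym
          rw [hits_comp_iff (tauB_tauB i), hits_comp_iff (tauD_tauD _)]
          by_cases hy1 : y = i
          · have e1 : tauB i (-y) = -(i + 1) := by unfold tauB; split_ifs <;> omega
            have e2 : tauD (i + 1) (-(y + 1)) = -(i + 1 + 1) := by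
              unfold tauD; push_cast; split_ifs <;> omega
            rw [e1, e2]
            exact hrel _ (by omega) (by omega)
          · by_cases hy2 : y = i + 1
            · have e1 : tauB i (-y) = -i := by unfold tauB; split_ifs <;> omega
              have e2 : tauD (i + 1) (-(y + 1)) = -(i + 1) := by
                unfold tauD; push_cast; split_ifs <;> omega
              rw [e1, e2]
              exact hrel _ (by omega) (by omega)
            · have e1 : tauB i (-y) = -y := by unfold tauB; split_ifs <;> omega
              have e2 : tauD (i + 1) (-(y + 1)) = -(y + 1) := by
                unfold tauD; push_cast; split_ifs <;> omega
              rw [e1, e2]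
              exact hrel _ hy hym
  · have hp1 : Hits m ω 1 := by
      have := nω 1 (by omega) (by omega)
      tauto
    refine ⟨fun i => if h : (i : ℕ) + 1 < m then ⟨i + 1, h⟩ else i, ⟨?_, ?_, ?_⟩, ?_⟩
    · intro i hi
      have hi1 := hlast i hi
      have hi2 := (dB i).mp hi
      simp only [dif_pos hi1]
      rw [Finset.mem_coe, dD _ (by simp)]
      have := (hrel (i + 1) (by omega) (by omega)).mp hi2.1
      refine ⟨by push_cast; exact this, ?_⟩
      by_cases h0 : (i : ℕ) = 0
      · simpa [h0] using hp1
      · have := (hrel' i (by omega) (by omega)).mp (hi2.2 h0)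
        push_cast
        exact this
    · intro i hi j hj hij
      have hi1 := hlast i hi
      have hj1 := hlast j hj
      simp only [dif_pos hi1, dif_pos hj1, Fin.mk.injEq] at hij
      exact Fin.ext (by omega)
    · intro j hj
      rw [Finset.mem_coe] at hj
      have hj2 := j.2
      have h0 : (j : ℕ) ≠ 0 := by
        intro h0
        rw [show j = ⟨0, by omega⟩ from Fin.ext h0, d0] at hj
        exact hm1 hj.1
      have hj3 := (dD j h0).mp hj
      have e : ((j - 1 : ℕ) : ℤ) = j - 1 := by omega
      refine ⟨⟨j - 1, by omega⟩, ?_, ?_⟩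
      · rw [Finset.mem_coe, dB]
        simp only [e]
        refine ⟨?_, fun _ => ?_⟩
        · rw [sub_add_cancel]
          exact (hrel j (by omega) (by omega)).mpr hj3.1
        · rw [hrel' _ (by omega) (by omega), sub_add_cancel]
          exact hj3.2
      · simp only
        rw [dif_pos (by omega)]
        exact Fin.ext (by simp only; omega)
    · intro i hi
      have hi1 := hlast i hi
      have hi2 := (dB i).mp hi
      have hB1 : ¬ Hits m σ (i + 1) := fun h => (nσ (i + 1) (by omega) (by omega)).mp hi2.1 h
      have hB2 : ¬ Hits m σ (-i) := by
        by_cases h0 : (i : ℕ) = 0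
        · rw [h0]
          exact sσ.not_hits_zero
        · rw [nσ i (by omega) (by omega), not_not]
          exact hi2.2 h0
      have htopB : Hits m (fun a => tauB i (σ a)) m := by
        have e : tauB i m = m := by
          have hi3 : ((i : ℕ) : ℤ) + 1 < m := by omega
          unfold tauB
          grind
        rw [hits_comp_iff (tauB_tauB i), e]
        exact htop
      have hd1 := (hrel (i + 1) (by omega) (by omega)).mp hi2.1
      simp only [dif_pos hi1]
      refine ⟨refl_mul_mem_W _ hw, refl_mul_mem_W _ hw', _, _, hσ.refl_mul i,
        hω.refl_mul hm _, mσ.comp_tauB hB1 hB2, mω.comp_tauD (by simp) ?_ ?_, htopB, ?_⟩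
      · push_cast
        exact (nω _ (by omega) (by omega)).mp hd1
      · push_cast
        rw [nω _ (by omega) (by omega), not_not]
        by_cases h0 : (i : ℕ) = 0
        · rw [h0]
          exact_mod_cast hp1
        · exact (hrel' i (by omega) (by omega)).mp (hi2.2 h0)
      · intro y hy hym
        rw [hits_comp_iff (tauB_tauB i), hits_comp_iff (tauD_tauD _)]
        by_cases h0 : (i : ℕ) = 0
        · rw [h0] at hB1
          by_cases hy1 : y = 1
          · subst hy1
            have e1 : tauB i (-1) = 1 := by rw [h0]; rfl
            have e2 : tauD (i + 1) (-(1 + 1)) = -1 := by rw [h0]; rfl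
            rw [e1, e2]
            exact ⟨fun h => absurd h (by simpa using hB1), fun h => absurd h hm1⟩
          · have e1 : tauB i (-y) = -y := by rw [h0]; unfold tauB; split_ifs <;> omega
            have e2 : tauD (i + 1) (-(y + 1)) = -(y + 1) := by
              rw [h0]; unfold tauD; split_ifs <;> omega
            rw [e1, e2]
            exact hrel y hy hym
        · by_cases hy1 : y = i
          · have e1 : tauB i (-y) = -(i + 1) := by unfold tauB; split_ifs <;> omega
            have e2 : tauD (i + 1) (-(y + 1)) = -(i + 1 + 1) := by
              unfold tauD; push_cast; split_ifs <;> omega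
            rw [e1, e2]
            exact hrel _ (by omega) (by omega)
          · by_cases hy2 : y = i + 1
            · have e1 : tauB i (-y) = -i := by unfold tauB; split_ifs <;> omega
              have e2 : tauD (i + 1) (-(y + 1)) = -(i + 1) := by
                unfold tauD; push_cast; split_ifs <;> omega
              rw [e1, e2]
              exact hrel _ (by omega) (by omega)
            · have e1 : tauB i (-y) = -y := by unfold tauB; split_ifs <;> omega
              have e2 : tauD (i + 1) (-(y + 1)) = -(y + 1) := by
                unfold tauD; push_cast; split_ifs <;> omega
              rw [e1, e2]
              exact hrel _ hy hym

/-! ### The type D word and its signed permutation -/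

theorem elt_range'_typeD_inv_apply {n : ℕ} (L : ℕ) (hL : L + 2 ≤ n) {a : ℤ} (h1 : 1 ≤ a)
    (h2 : a ≤ n) : ((typeD n).elt (List.range' 3 L))⁻¹ (vecD n a) =
      vecD n (if a = 1 then 1 else if a = 2 then L + 2 else if a ≤ L + 2 then a - 1 else a) := by
  induction L with
  | zero =>
    rw [List.range'_zero, elt_nil, inv_one]
    change vecD n a = _
    congr 1
    split_ifs <;> omega
  | succ L ih =>
    rw [List.range'_concat, elt_append, elt_cons, elt_nil, mul_one, mul_inv_rev,
      LinearEquiv.mul_apply, ih (by omega), show 3 + 1 * L = (L + 2) + 1 by ring,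
      s_succ _ (by omega), refl_inv, refl_vecD' (by omega) _ (by split_ifs <;> omega)]
    congr 1
    have e1 : tauD (L + 2) 1 = 1 := by unfold tauD; split_ifs <;> omega
    have e2 : tauD (L + 2) (L + 2) = L + 3 := by unfold tauD; push_cast; split_ifs <;> omega
    have e3 : a ≠ 1 → a ≠ 2 → a ≤ L + 2 → tauD (L + 2) (a - 1) = a - 1 := by
      intro h3 h4 h5
      unfold tauD
      push_cast
      split_ifs <;> omega
    have e4 : a ≠ 1 → a ≠ 2 → ¬ a ≤ L + 2 → tauD (L + 2) a =
        if a = L + 3 then (L : ℤ) + 2 else a := by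
      intro h3 h4 h5
      unfold tauD
      push_cast
      split_ifs <;> omega
    dsimp only
    push_cast
    split_ifs with h3 h4 h5 h6 h6
    · exact e1
    · rw [e2]
      ring
    · exact e3 h3 h4 h5
    · omega
    · rw [e4 h3 h4 h5]
      split_ifs <;> omega
    · rw [e4 h3 h4 h5]
      split_ifs <;> omega

/-- The signed permutation that belongs to the inverse of the element spelled by `wordB k n`. -/
def permD (n k : ℕ) (y : ℤ) : ℤ :=
  if y ≤ k then -(n - 2 * y + 2) else if y = k + 1 then (if Even k then 1 else -1)
  else if y ≤ n - k + 1 then y - k else 2 * y - n - 1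

/-- The signed permutation that takes `permD n k` to `permD n (k + 1)`. -/
def stepD (n k a : ℤ) : ℤ :=
  if a = 1 then (if Even k then -(n - 2 * k) else n - 2 * k)
  else if a = 2 then (if Even k then -1 else 1) else if a ≤ n - 2 * k then a - 1 else a

theorem elt_wordB_succ (k n : ℕ) : (typeD n).elt (wordB (k + 1) n) =
    (typeD n).elt (wordB k n) *
      ((typeD n).s (if Even k then 1 else 2) *
        (typeD n).elt (List.range' 3 (n - 2 * (k + 1)))) := by
  rw [wordB, List.range_succ, List.flatMap_append, elt_append, List.flatMap_singleton, elt_cons]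
  rfl

theorem elt_wordB_inv_apply {k n : ℕ} (hn : 2 * k ≤ n) {y : ℤ} (h1 : 1 ≤ y) (h2 : y ≤ n) :
    ((typeD n).elt (wordB k n))⁻¹ (vecD n y) = vecD n (permD n k y) := by
  induction k with
  | zero =>
    change vecD n y = _
    congr 1
    unfold permD
    simp only [Nat.cast_zero, Even.zero, if_true]
    split_ifs <;> omega
  | succ k ih =>
    rw [elt_wordB_succ, mul_inv_rev, LinearEquiv.mul_apply, ih (by omega), mul_inv_rev,
      LinearEquiv.mul_apply]
    have hE : ∀ a : ℤ, 1 ≤ a → a ≤ n → ((typeD n).elt (List.range' 3 (n - 2 * (k + 1))))⁻¹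
        (((typeD n).s (if Even k then 1 else 2))⁻¹ (vecD n a)) =
        vecD n (stepD n k a) := by
      intro a ha ha'
      unfold stepD
      simp only [Int.even_coe_nat]
      have hc : ((n - 2 * (k + 1) : ℕ) : ℤ) = n - 2 * k - 2 := by omega
      by_cases hk : Even k
      · simp only [hk, if_true]
        rw [s_succ (y := 0) _ (by omega), refl_inv, refl_vecD' (by omega) _ (by omega)]
        by_cases a1 : a = 1
        · rw [a1, if_pos rfl, show tauD ((⟨0, by omega⟩ : Fin n) : ℕ) 1 = -2 from rfl, vecD_neg,
            map_neg, elt_range'_typeD_inv_apply _ (by omega) (by omega) (by omega), hc, ← vecD_neg]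
          congr 1
          norm_num
        · by_cases a2 : a = 2
          · rw [a2, show tauD ((⟨0, by omega⟩ : Fin n) : ℕ) 2 = -1 from rfl, vecD_neg,
              map_neg, elt_range'_typeD_inv_apply _ (by omega) (by omega) (by omega), ← vecD_neg]
            congr 1
          · have e : tauD 0 a = a := by unfold tauD; split_ifs <;> omega
            rw [e, elt_range'_typeD_inv_apply _ (by omega) (by omega) (by omega), hc]
            congr 1
            split_ifs <;> omega
      · simp only [hk, if_false]
        rw [s_succ (y := 1) _ (by omega), refl_inv, refl_vecD' (by omega) _ (by omega)]
        by_cases a1 : a = 1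
        · rw [a1, show tauD ((⟨1, by omega⟩ : Fin n) : ℕ) 1 = 2 from rfl,
            elt_range'_typeD_inv_apply _ (by omega) (by omega) (by omega), hc]
          congr 1
          norm_num
        · by_cases a2 : a = 2
          · rw [a2, show tauD ((⟨1, by omega⟩ : Fin n) : ℕ) 2 = 1 from rfl,
              elt_range'_typeD_inv_apply _ (by omega) (by omega) (by omega)]
            congr 1
          · have e : tauD 1 a = a := by unfold tauD; split_ifs <;> omega
            rw [e, elt_range'_typeD_inv_apply _ (by omega) (by omega) (by omega), hc]
            congr 1
            split_ifs <;> omega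
    have hpos : ∀ a : ℤ, 1 ≤ a → a ≤ n → permD n k y = a → permD n (k + 1) y =
        (stepD n k a) := by
      intro a ha ha' e
      unfold permD at e
      unfold permD stepD
      simp only [Nat.even_add_one, Int.even_coe_nat]
      push_cast at *
      by_cases hk : Even k <;> simp only [hk, if_true, if_false, not_true, not_false_iff] at e ⊢ <;>
        split_ifs at e ⊢ <;> omega
    have hneg : ∀ a : ℤ, 1 ≤ a → a ≤ n → permD n k y = -a → permD n (k + 1) y =
        -(stepD n k a) := by
      intro a ha ha' e
      unfold permD at e
      unfold permD stepD
      simp only [Nat.even_add_one, Int.even_coe_nat]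
      push_cast at *
      by_cases hk : Even k <;> simp only [hk, if_true, if_false, not_true, not_false_iff] at e ⊢ <;>
        split_ifs at e ⊢ <;> omega
    have hb : permD n k y ≠ 0 ∧ -(n : ℤ) ≤ permD n k y ∧ permD n k y ≤ n := by
      unfold permD
      split_ifs <;> omega
    rcases lt_or_gt_of_ne hb.1 with h | h
    · obtain ⟨a, ha⟩ : ∃ a, permD n k y = -a := ⟨-permD n k y, by ring⟩
      rw [hneg a (by omega) (by omega) ha, ha, vecD_neg, map_neg, map_neg, hE a (by omega) (by omega),
        vecD_neg]
    · rw [hpos _ (by omega) (by omega) rfl, hE _ (by omega) (by omega)]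

theorem exists_actsD_wordB {k n : ℕ} (hk : 1 ≤ k) (hn : 2 * k ≤ n) :
    ∃ ω, ActsD n ((typeD n).elt (wordB k n))⁻¹ ω ∧
      (∀ y : ℤ, 1 ≤ y → y ≤ n → ω y = permD n k y) ∧ IncrPos n ω := by
  obtain ⟨ω, hω⟩ := ActsD.exists_of_mem (by omega)
    (Subgroup.inv_mem _ ((typeD n).elt_mem_W (wordB k n)))
  have h : ∀ y : ℤ, 1 ≤ y → y ≤ n → ω y = permD n k y := by
    intro y h1 h2
    obtain ⟨h3, h4⟩ := hω y (by omega)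
    rw [elt_wordB_inv_apply hn h1 h2] at h4
    refine (vecD_injective (by omega) ?_ h3 h4).symm
    unfold permD
    split_ifs <;> omega
  refine ⟨ω, hω, h, fun i j hi hij hj => ?_⟩
  rw [h i hi (by omega), h j (by omega) hj]
  unfold permD
  split_ifs <;> omega

/-- After the moves the negative values in type B are -(n-1), -(n-3), …, -(n-2k+1). In type D, apart
from a possible -1, they are -n, -(n-2), …, -(n-2k+2), each lower by one. Both elements belong to
the strict partition with parts n - 1, n - 3, …. -/
theorem numRed_bElt {k n : ℕ} (hk : 1 ≤ k) (hn : 2 * k ≤ n) :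
    (typeB (n - k)).numRed (bElt k n) = (typeD n).numRed ((typeD n).elt (wordB k n)) := by
  obtain ⟨w, hw, e1⟩ := exists_isStageB_bElt hk hn
  obtain ⟨w', ⟨hw', σ, hσ, n1, n2, n3, n4⟩, e2⟩ := hw.exists_stageSeq (by omega) hk
  obtain ⟨ω, hω, h1, h2⟩ := exists_actsD_wordB hk hn
  rw [e1, e2, ← (typeD n).numRed_inv]
  dsimp only at n1
  refine GrassRel.numRed_eq (by omega) ⟨hw', Subgroup.inv_mem _ (elt_mem_W _ _), σ, ω, hσ, hω, ?_, h2,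
    ⟨n, by omega, le_rfl, n4⟩, ?_⟩
  · intro i j hi hij hj
    by_cases hjk : j ≤ k
    · rw [(n1 i hi (by omega)).2, (n1 j (by omega) hjk).2]
      omega
    · by_cases hik : i ≤ k
      · have := n1 i hi hik
        have := n3 j (by omega) hj
        omega
      · exact n2 i j (by omega) hij hj
  · intro y hy hyn
    constructor
    · rintro ⟨i, hi, hin, e⟩
      by_cases hik : i ≤ k
      · refine ⟨i, hi, hin, ?_⟩
        have := (n1 i hi hik).2
        rw [h1 i hi hin, permD, if_pos hik]
        omega
      · have := n3 i (by omega) hin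
        omega
    · rintro ⟨i, hi, hin, e⟩
      rw [h1 i hi hin] at e
      have hik : i ≤ k := by
        by_contra hik
        unfold permD at e
        split_ifs at e <;> omega
      refine ⟨i, hi, hin, ?_⟩
      have := (n1 i hi hik).2
      rw [permD, if_pos hik] at e
      omega

/-! ### Order embeddings, and the trapezoid as an ideal -/

theorem dualEmbedsAsIdeal_of_index {ι V V' : Type} [PartialOrder V'] {P : Set V}
    {le : V → V → Prop} {Λ I : Set V'} (r : ι → V) (s : ι → V') (hP : P = Set.range r)
    (hI : I = Set.range s) (hΛ : I ⊆ Λ) (hs : Function.Injective s)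
    (hle : ∀ x y, le (r x) (r y) ↔ s y ≤ s x)
    (hlow : ∀ β ∈ Λ, ∀ x, β ≤ s x → β ∈ I) : DualEmbedsAsIdeal P le Λ I := by
  -- Injectivity of `r` follows from antisymmetry in the target, so `le` need not be known to be a
  -- partial order.
  have hr : Function.Injective r := fun x y h => by
    have h1 := hle x y
    have h2 := hle y x
    rw [h, hle] at h1 h2
    exact hs (le_antisymm (h2.mp le_rfl) (h1.mp le_rfl))
  subst hP hI
  have hf : ∀ β : Set.range r, ∃ x, r x = β := fun β => β.2
  choose f hf using hf
  have hf' : ∀ x, f ⟨r x, x, rfl⟩ = x := fun x => hr (hf _)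
  refine ⟨fun β => ⟨s (f β), hΛ ⟨_, rfl⟩⟩, fun β γ h => ?_, fun β γ => ?_, ?_, ?_⟩
  · have h' : f β = f γ := hs (congrArg Subtype.val h)
    exact Subtype.ext (by rw [← hf β, ← hf γ, h'])
  · rw [← hf β, ← hf γ]
    exact hle _ _
  · rintro _ ⟨γ, hγ⟩ h ⟨β, rfl⟩
    obtain ⟨x, rfl⟩ := hlow γ hγ _ h
    exact ⟨⟨r x, x, rfl⟩, Subtype.ext (congrArg s (hf' x))⟩
  · ext γ
    constructor
    · rintro ⟨β, rfl⟩
      exact ⟨_, rfl⟩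
    · rintro ⟨x, rfl⟩
      exact ⟨⟨r x, x, rfl⟩, congrArg s (hf' x)⟩

theorem CartanDatum.IsFiniteType.mem_inversions_iff {n : ℕ} {R : Type} [CommRing R] [LinearOrder R]
    [IsStrictOrderedRing R] {C : CartanDatum n R} (H : C.IsFiniteType)
    {w : (Fin n → R) ≃ₗ[R] (Fin n → R)} (hw : w ∈ C.W) {β : Fin n → R} :
    β ∈ C.inversions w ↔ β ∈ C.posRoots ∧ ¬ 0 ≤ w⁻¹ β := by
  constructor
  · rintro ⟨hβ, γ, hγ, rfl⟩
    refine ⟨hβ, ?_⟩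
    rw [map_neg, inv_apply_apply]
    exact not_nonneg_neg hγ.1 hγ.2
  · rintro ⟨hβ, h⟩
    have hr := inv_apply_mem_roots hw hβ.1
    refine ⟨hβ, -(w⁻¹ β), ⟨neg_mem_roots hr, (H.neg_nonneg_iff hr).mpr h⟩, ?_⟩
    rw [map_neg, apply_inv_apply, neg_neg]

theorem posRoots_typeB (m : ℕ) : (typeB m).posRoots =
    {β | ∃ j i : ℤ, -j < i ∧ i < j ∧ j ≤ m ∧ β = vecB m j + vecB m i} := by
  ext β
  simp only [posRoots, roots_typeB, Set.mem_ofPred_eq]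
  constructor
  · rintro ⟨⟨a, b, ⟨ha, hb, h1, h2⟩, rfl⟩, h⟩
    rw [vecB_add_nonneg_iff ha hb] at h
    rcases lt_or_gt_of_ne h1 with h3 | h3
    · exact ⟨b, a, by omega, h3, hb.2, add_comm _ _⟩
    · exact ⟨a, b, by omega, h3, ha.2, rfl⟩
  · rintro ⟨j, i, h1, h2, h3, rfl⟩
    exact ⟨⟨j, i, ⟨by omega, by omega, by omega, by omega⟩, rfl⟩, vecB_add_nonneg (by omega)⟩

theorem posRoots_typeD {m : ℕ} (hm : 2 ≤ m) : (typeD m).posRoots =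
    {β | ∃ q p : ℤ, -q < p ∧ p < q ∧ q ≤ m ∧ p ≠ 0 ∧ β = rootD m q p} := by
  ext β
  simp only [posRoots, roots_typeD hm, Set.mem_ofPred_eq]
  constructor
  · rintro ⟨⟨a, b, hI, rfl⟩, h⟩
    rw [rootD_nonneg_iff hm hI] at h
    obtain ⟨ha, hb, ha0, hb0, h1, h2⟩ := hI
    rcases lt_or_gt_of_ne h1 with h3 | h3
    · exact ⟨b, a, by omega, h3, hb.2, ha0, rootD_comm _ _ _⟩
    · exact ⟨a, b, by omega, h3, ha.2, hb0, rfl⟩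
  · rintro ⟨q, p, h1, h2, h3, h4, rfl⟩
    have hI : IsIdxD m q p := ⟨by omega, by omega, by omega, by omega, by omega, by omega⟩
    exact ⟨⟨q, p, hI, rfl⟩, (rootD_nonneg_iff hm hI).mpr (by omega)⟩

theorem unitB_mono {a a' : ℤ} (h : a ≤ a') (p : ℕ) : unitB a p ≤ unitB a' p := by
  unfold unitB
  split_ifs <;> omega

/-- Two test coordinates suffice: j - 1 for the larger index, and i - 1 or -i, according to the sign
of `i`, for the other. -/
theorem vecB_add_le_iff {m : ℕ} {j i j' i' : ℤ} (h1 : -j < i) (h2 : i < j) (h3 : j ≤ m)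
    (h2' : i' < j') :
    vecB m j + vecB m i ≤ vecB m j' + vecB m i' ↔ j ≤ j' ∧ i ≤ i' := by
  constructor
  · intro h
    have h' : ∀ p : ℕ, p < m → unitB j p + unitB i p ≤ unitB j' p + unitB i' p :=
      fun p hp => h ⟨p, hp⟩
    obtain ⟨p, hp⟩ : ∃ p : ℕ, (p : ℤ) = j - 1 := ⟨(j - 1).toNat, by omega⟩
    have e := h' p (by omega)
    have hj : j ≤ j' := by
      unfold unitB at e
      split_ifs at e <;> omega
    refine ⟨hj, ?_⟩
    by_cases hi : 0 < i
    · obtain ⟨q, hq⟩ : ∃ q : ℕ, (q : ℤ) = i - 1 := ⟨(i - 1).toNat, by omega⟩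
      have e := h' q (by omega)
      unfold unitB at e
      split_ifs at e <;> omega
    · obtain ⟨q, hq⟩ : ∃ q : ℕ, (q : ℤ) = -i := ⟨(-i).toNat, by omega⟩
      have e := h' q (by omega)
      unfold unitB at e
      split_ifs at e <;> omega
  · rintro ⟨h4, h5⟩ p
    exact add_le_add (unitB_mono h4 p) (unitB_mono h5 p)

theorem rootD_le_iff {m : ℕ} {q p q' p' : ℤ} (h1 : 0 < p) (h2 : p < q) (h3 : q ≤ m)
    (h1' : 0 < p') (h2' : p' < q') : rootD m q p ≤ rootD m q' p' ↔ q ≤ q' ∧ p ≤ p' := by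
  constructor
  · intro h
    have h' : ∀ t : ℕ, t < m → (unitD q t + unitD p t) / 2 ≤ (unitD q' t + unitD p' t) / 2 :=
      fun t ht => h ⟨t, ht⟩
    obtain ⟨s, hs⟩ : ∃ s : ℕ, (s : ℤ) = q - 1 := ⟨(q - 1).toNat, by omega⟩
    obtain ⟨t, ht⟩ : ∃ t : ℕ, (t : ℤ) = p - 1 := ⟨(p - 1).toNat, by omega⟩
    have e1 := h' s (by omega)
    have e2 := h' t (by omega)
    clear h h'
    constructor
    · clear e2
      grind (splits := 40) [unitD]
    · clear e1
      grind (splits := 40) [unitD]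
  · rintro ⟨h4, h5⟩ t
    have : unitD q t + unitD p t ≤ unitD q' t + unitD p' t := by
      grind (splits := 40) [unitD]
    simp only [rootD]
    omega

/-- The index pairs of the trapezoid. -/
def IsTrapezoidIdx (m k : ℕ) (x : ℤ × ℤ) : Prop :=
  (m - k < x.1 ∧ x.1 ≤ m) ∧ -x.1 < x.2 ∧ x.2 < x.1 ∧ (x.2 ≤ 0 ∨ m - k < x.2)

/-- The element b_{k,n} adds k to an index and changes the sign when it wraps around n - k. So e_j +
e_i becomes negative exactly when j wraps and, if i > 0, i wraps as well. -/
theorem trapezoid_eq {k n : ℕ} (hn : 2 * k ≤ n) : trapezoid k n =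
    Set.range fun x : {x : ℤ × ℤ // IsTrapezoidIdx (n - k) k x} =>
      vecB (n - k) x.1.1 + vecB (n - k) x.1.2 := by
  obtain ⟨σ, hσ⟩ := ActsB.exists_of_mem (bElt_mem_W k n)
  have hs := hσ.isSignedPerm (bElt_mem_W k n)
  have h1 : ∀ i : ℤ, 1 ≤ i → i ≤ (n - k : ℕ) →
      σ i = if i + k ≤ (n - k : ℕ) then i + k else -(i + k - (n - k : ℕ)) := fun i hi hi' => by
    obtain ⟨h3, h4⟩ := hσ i (by omega)
    rw [bElt_apply hn hi hi'] at h4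
    exact (vecB_injective (by split_ifs <;> omega) h3 h4).symm
  have key : ∀ j i : ℤ, -j < i → i < j → j ≤ (n - k : ℕ) →
      (-(bElt k n (vecB (n - k) j + vecB (n - k) i)) ∈ (typeB (n - k)).posRoots ↔
        IsTrapezoidIdx (n - k) k (j, i)) := by
    intro j i hj hi hjm
    have hr : vecB (n - k) j + vecB (n - k) i ∈ (typeB (n - k)).roots :=
      vecB_add_mem_roots ⟨by omega, by omega, by omega, by omega⟩
    have hsj := hσ j (by omega)
    have hsi := hσ i (by omega)
    rw [posRoots, Set.mem_ofPred_eq,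
      and_iff_right (neg_mem_roots (apply_mem_roots (bElt_mem_W k n) hr)), map_add, hsj.2, hsi.2,
      neg_add, ← vecB_neg, ← vecB_neg, vecB_add_nonneg_iff (by omega) (by omega)]
    unfold IsTrapezoidIdx
    have e1 := h1 j (by omega) hjm
    rcases lt_trichotomy i 0 with h0 | rfl | h0
    · have e2 := h1 (-i) (by omega) (by omega)
      rw [hs.neg i (by omega)] at e2
      split_ifs at e1 e2 <;> omega
    · have := hs.neg 0 (by omega)
      rw [neg_zero] at this
      split_ifs at e1 <;> omega
    · have e2 := h1 i (by omega) (by omega)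
      split_ifs at e1 e2 <;> omega
  ext β
  constructor
  · rintro ⟨h2, h3⟩
    rw [posRoots_typeB] at h2
    obtain ⟨j, i, h4, h5, h6, rfl⟩ := h2
    exact ⟨⟨(j, i), (key j i h4 h5 h6).mp h3⟩, rfl⟩
  · rintro ⟨⟨⟨j, i⟩, hx⟩, rfl⟩
    have hx' := hx
    obtain ⟨⟨h2, h3⟩, h4, h5, h6⟩ := hx'
    refine ⟨?_, (key j i h4 h5 h3).mpr hx⟩
    rw [posRoots_typeB]
    exact ⟨j, i, h4, h5, h3, rfl⟩

theorem inversions_wordB {k n : ℕ} (hk : 1 ≤ k) (hn : 2 * k ≤ n) :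
    (typeD n).inversions ((typeD n).elt (wordB k n)) =
      {β | ∃ q p : ℤ, 0 < p ∧ p < q ∧ p ≤ k ∧ p + q ≤ n + 1 ∧ β = rootD n q p} := by
  have hn2 : 2 ≤ n := by omega
  obtain ⟨ω, hω, h1, h2⟩ := exists_actsD_wordB hk hn
  have hW := (typeD n).elt_mem_W (wordB k n)
  have hs := hω.isSignedPerm hn2 (Subgroup.inv_mem _ hW)
  have key : ∀ q p : ℤ, -q < p → p < q → q ≤ n → p ≠ 0 →
      (¬ 0 ≤ ((typeD n).elt (wordB k n))⁻¹ (rootD n q p) ↔ 0 < p ∧ p ≤ k ∧ p + q ≤ n + 1) := by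
    intro q p hq hp hqn hp0
    obtain ⟨hI, e⟩ := hω.apply_rootD hs (a := q) (b := p)
      ⟨by omega, by omega, by omega, by omega, by omega, by omega⟩
    rw [e, rootD_nonneg_iff hn2 hI]
    have e1 := h1 q (by omega) hqn
    unfold permD at e1
    rcases lt_or_gt_of_ne hp0 with h0 | h0
    · have e2 := h2 (-p) q (by omega) (by omega) hqn
      rw [hs.neg p (by omega)] at e2
      omega
    · have e2 := h1 p (by omega) (by omega)
      unfold permD at e2
      split_ifs at e1 e2 <;> omega
  ext β
  rw [(typeD_isFiniteType hn2).mem_inversions_iff hW, posRoots_typeD hn2]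
  constructor
  · rintro ⟨⟨q, p, h3, h4, h5, h6, rfl⟩, h7⟩
    obtain ⟨h8, h9, h10⟩ := (key q p h3 h4 h5 h6).mp h7
    exact ⟨q, p, h8, h4, h9, h10, rfl⟩
  · rintro ⟨q, p, h3, h4, h5, h6, rfl⟩
    exact ⟨⟨q, p, by omega, h4, by omega, by omega, rfl⟩,
      (key q p (by omega) h4 (by omega) (by omega)).mpr ⟨h3, h5, h6⟩⟩

theorem trapezoid_dualEmbeds {k n : ℕ} (hk : 1 ≤ k) (hn : 2 * k ≤ n) (h0 : 0 < n) :
    DualEmbedsAsIdeal (trapezoid k n) (fun β γ => β ≤ γ) ((typeD n).rootFilter ⟨0, h0⟩)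
      ((typeD n).inversions ((typeD n).elt (wordB k n))) := by
  have hn2 : 2 ≤ n := by omega
  have hpos : ∀ β ∈ (typeD n).rootFilter ⟨0, h0⟩, ∃ q p : ℤ, 0 < p ∧ p < q ∧ q ≤ n ∧
      β = rootD n q p := by
    rintro β ⟨hβ, hne⟩
    rw [posRoots_typeD hn2] at hβ
    obtain ⟨q, p, h1, h2, h3, h4, rfl⟩ := hβ
    refine ⟨q, p, ?_, h2, h3, rfl⟩
    by_contra h
    apply hne
    have : unitD q 0 + unitD p 0 = 0 := by grind [unitD]
    simp only [rootD, this]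
    rfl
  refine dualEmbedsAsIdeal_of_index
    (fun x : {x : ℤ × ℤ // IsTrapezoidIdx (n - k) k x} =>
      vecB (n - k) x.1.1 + vecB (n - k) x.1.2)
    -- Both indices are reversed. The wrapped positive values of the second index go to 1, …, k, and
    -- the values 0, -1, … to k + 1, k + 2, …, which closes the gap between the two blocks.
    (fun x => rootD n (if 0 < x.1.2 then n - k + 1 - x.1.2 else k + 1 - x.1.2) (n - k - x.1.1 + 1))
    (trapezoid_eq hn) ?_ ?_ ?_ ?_ ?_
  · rw [inversions_wordB hk hn]
    ext β
    constructor
    · rintro ⟨q, p, h1, h2, h3, h4, rfl⟩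
      refine ⟨⟨(n - k + 1 - p, if q ≤ k then n - k + 1 - q else k + 1 - q), ?_⟩, ?_⟩
      · unfold IsTrapezoidIdx
        dsimp only
        split_ifs <;> omega
      · dsimp only
        congr 1
        · split_ifs <;> omega
        · omega
    · rintro ⟨⟨⟨j, i⟩, h⟩, rfl⟩
      unfold IsTrapezoidIdx at h
      dsimp only at h ⊢
      exact ⟨_, _, by omega, by split_ifs <;> omega, by omega, by split_ifs <;> omega, rfl⟩
  · rw [inversions_wordB hk hn]
    rintro β ⟨q, p, h1, h2, h3, h4, rfl⟩
    refine ⟨?_, ?_⟩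
    · rw [posRoots_typeD hn2]
      exact ⟨q, p, by omega, h2, by omega, by omega, rfl⟩
    · have : unitD q 0 + unitD p 0 = 2 := by grind [unitD]
      simp only [rootD, this]
      norm_num
  · rintro ⟨⟨j, i⟩, h⟩ ⟨⟨j', i'⟩, h'⟩ e
    unfold IsTrapezoidIdx at h h'
    dsimp only at h h' e
    have e1 := (rootD_le_iff (by omega) (by split_ifs <;> omega) (by split_ifs <;> omega)
      (by omega) (by split_ifs <;> omega)).mp e.le
    have e2 := (rootD_le_iff (by omega) (by split_ifs <;> omega) (by split_ifs <;> omega)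
      (by omega) (by split_ifs <;> omega)).mp e.ge
    refine Subtype.ext (Prod.ext_iff.mpr ?_)
    change j = j' ∧ i = i'
    split_ifs at e1 e2 <;> omega
  · rintro ⟨⟨j, i⟩, h⟩ ⟨⟨j', i'⟩, h'⟩
    unfold IsTrapezoidIdx at h h'
    dsimp only at h h' ⊢
    rw [rootD_le_iff (by omega) (by split_ifs <;> omega) (by split_ifs <;> omega)
      (by omega) (by split_ifs <;> omega), vecB_add_le_iff (by omega) (by omega) (by omega)
      (by omega)]
    split_ifs <;> omega
  · rintro β hβ ⟨⟨j, i⟩, h⟩ hle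
    obtain ⟨q, p, h1, h2, h3, rfl⟩ := hpos β hβ
    unfold IsTrapezoidIdx at h
    dsimp only at h hle
    rw [rootD_le_iff h1 h2 h3 (by omega) (by split_ifs <;> omega)] at hle
    rw [inversions_wordB hk hn]
    exact ⟨q, p, h1, h2, by omega, by split_ifs at hle <;> omega, rfl⟩

theorem trapezoid_main {k n : ℕ} (hk : 1 ≤ k) (hn : 2 * k ≤ n) (h0 : 0 < n) :
    DualEmbedsAsIdeal (trapezoid k n) (fun β γ => β ≤ γ) ((typeD n).rootFilter ⟨0, h0⟩)
      ((typeD n).inversions ((typeD n).elt (wordB k n))) ∧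
    Nonempty ((typeB (n - k)).Red (bElt k n) ≃ (typeD n).Red ((typeD n).elt (wordB k n))) :=
  ⟨trapezoid_dualEmbeds hk hn h0, nonempty_Red_equiv (numRed_bElt hk hn)⟩

/-! ### Finite checks for root systems, and the numbers game -/

namespace CartanDatum

variable {n : ℕ} {R : Type} [CommRing R] {C : CartanDatum n R}

theorem refl_apply_coord (i : Fin n) (v : Fin n → R) (j : Fin n) :
    C.refl i v j = if j = i then v i - ∑ k, C.A k i * v k else v j := by
  split_ifs with h
  · subst h
    simp [refl_apply, simpleCoroot_apply, simpleRoot]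
  · exact C.refl_apply_of_ne h v

variable [LinearOrder R] [IsStrictOrderedRing R]

/-- Closure of `S` up to negating simple roots makes S ∪ -S stable under simple reflections, hence
it contains all roots. The list for E_7 or H_3 then needs only decidable checks. -/
theorem isFiniteType_of_pos {S : Set (Fin n → R)} (hfin : S.Finite) (hpos : ∀ v ∈ S, 0 ≤ v)
    (h1 : ∀ i, simpleRoot R i ∈ S) (h2 : ∀ v ∈ S, ∀ i, v = simpleRoot R i ∨ C.refl i v ∈ S)
    (hred : ∀ i, ∀ c : R, 0 ≤ c → c • simpleRoot R i ∈ S → c = 1) :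
    C.IsFiniteType ∧ C.posRoots ⊆ S := by
  have key : C.roots ⊆ S ∪ -S := by
    refine roots_subset (fun i => Or.inl (h1 i)) fun i β hβ => ?_
    rcases hβ with hβ | hβ
    · rcases h2 β hβ i with rfl | h
      · exact Or.inr (by simpa using h1 i)
      · exact Or.inl h
    · rcases h2 _ hβ i with h | h
      · rw [← neg_neg β, h]
        exact Or.inl (by simpa using h1 i)
      · exact Or.inr (by simpa using h)
  have hS : C.posRoots ⊆ S := by
    rintro β ⟨hβ, h0⟩
    rcases key hβ with h | h
    · exact h
    · exact absurd (hpos _ h) (not_nonneg_neg hβ h0)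
  refine ⟨⟨(hfin.union hfin.neg).subset key, fun β hβ => ?_, fun i c hc h => ?_⟩, hS⟩
  · rcases key hβ with h | h
    · exact Or.inl (hpos _ h)
    · exact Or.inr (neg_nonneg.mp (hpos _ h))
  · exact hred i c hc (hS ⟨h, smul_nonneg hc (simpleRoot_nonneg i)⟩)

/-- Strip the first letter: either `β` is its label, or s_i β is still positive and is an inversion
of the remaining product. -/
theorem IsFiniteType.exists_letterRoot_of_mem_inversions (H : C.IsFiniteType) (l : List (Fin n))
    {β : Fin n → R} (hβ : β ∈ C.inversions (C.wordProd l)) : ∃ p, β = C.letterRoot l p := by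
  rw [H.mem_inversions_iff (C.wordProd_mem_W l)] at hβ
  obtain ⟨hβ, h⟩ := hβ
  induction l generalizing β with
  | nil => exact absurd hβ.2 h
  | cons i l ih =>
    by_cases hi : β = simpleRoot R i
    · exact ⟨⟨0, by simp⟩, hi⟩
    · have hβ' : C.refl i β ∈ C.posRoots :=
        ⟨apply_mem_roots (C.refl_mem_W i) hβ.1, H.refl_nonneg hβ.1 hβ.2 hi⟩
      rw [wordProd_cons, mul_inv_rev, LinearEquiv.mul_apply, refl_inv] at h
      obtain ⟨p, hp⟩ := ih hβ' h
      refine ⟨⟨p + 1, by simp⟩, ?_⟩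
      rw [← C.refl_refl i β, hp]
      simp [letterRoot, LinearEquiv.mul_apply]

/-- The number of ways to play the numbers game: starting from the position `y`, a node at which
the position is negative is chosen and fired, for at most the given number of rounds. -/
def gameCount {K : Type} (neg : K → Bool) (fire : Fin n → Fin n → K → K → K) :
    ℕ → (Fin n → K) → ℕ
  | 0, _ => 1
  | f + 1, y => if ∀ i, neg (y i) = false then 1 else
      ∑ i, if neg (y i) then gameCount neg fire f fun j => fire i j (y j) (y i) else 0

theorem IsFiniteType.mem_desc_iff_sum_neg (H : C.IsFiniteType)
    {w : (Fin n → R) ≃ₗ[R] (Fin n → R)} (hw : w ∈ C.W) (i : Fin n) :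
    i ∈ C.desc w ↔ ∑ k, w⁻¹ (simpleRoot R i) k < 0 := by
  rw [H.mem_desc_iff hw]
  have hr := inv_apply_mem_roots hw (simpleRoot_mem_roots (C := C) i)
  constructor
  · intro h
    exact Fintype.sum_neg (lt_of_le_of_ne ((H.sign _ hr).resolve_left h) (ne_zero_of_mem_roots hr))
  · intro h h'
    exact absurd h (not_lt.mpr (Finset.sum_nonneg fun k _ => h' k))

/-- The position is j ↦ height of w⁻¹ α_j. A root has coordinates of one sign, so negative entries
are the descents, and firing `i` passes to s_i w. The type `K` carries exact arithmetic with a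
decidable sign, so the count can be evaluated. -/
theorem IsFiniteType.numRed_eq_gameCount (H : C.IsFiniteType) {K : Type} (val : K → R)
    (neg : K → Bool) (hneg : ∀ a, neg a ↔ val a < 0) (fire : Fin n → Fin n → K → K → K)
    (hfire : ∀ i j a b, val (fire i j a b) = val a - C.A j i * val b) (f : ℕ) (y : Fin n → K)
    {w : (Fin n → R) ≃ₗ[R] (Fin n → R)} (hw : w ∈ C.W) (hf : C.len w ≤ f)
    (hy : ∀ j, val (y j) = ∑ k, w⁻¹ (simpleRoot R j) k) :
    C.numRed w = gameCount neg fire f y := by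
  induction f generalizing y w with
  | zero =>
    rw [eq_one_of_len_eq_zero hw (Nat.le_zero.mp hf), numRed_one]
    rfl
  | succ f ih =>
    have hd : ∀ i, i ∈ C.desc w ↔ neg (y i) := fun i => by
      rw [H.mem_desc_iff_sum_neg hw, hneg, hy]
    rw [gameCount]
    split_ifs with h
    · have : w = 1 := by
        by_contra h1
        obtain ⟨i, hi⟩ := desc_nonempty hw h1
        rw [hd, h i] at hi
        exact absurd hi (by simp)
      rw [this, numRed_one]
    · have h1 : w ≠ 1 := by
        rintro rfl
        refine h fun i => ?_
        by_contra hi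
        rw [Bool.not_eq_false, ← hd, mem_desc, len_one] at hi
        omega
      rw [numRed_eq_sum hw h1, ← Finset.sum_filter]
      refine Finset.sum_congr (by ext i; simp [hd]) fun i hi => ?_
      refine ih _ (refl_mul_mem_W i hw) ?_ fun j => ?_
      · rw [Finset.mem_filter, ← hd, mem_desc_iff_len hw] at hi
        omega
      · rw [hfire, hy, hy, mul_inv_rev, LinearEquiv.mul_apply, refl_inv, refl_apply,
          simpleCoroot_simpleRoot_eq, map_sub, map_smul]
        simp [Finset.mul_sum]

end CartanDatum

/-! ### Type E_7 -/

/-- The positive roots of type `E 7`; the digits of a number are the coefficients of a root, the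
coefficient of the last simple root being the leading digit. -/
def rootCodesE7 : List ℕ :=
  [1, 10, 100, 101, 1000, 1100, 1101, 10000, 10010, 11000, 11010, 11100, 11101, 11110, 11111,
  100000, 110000, 110010, 111000, 111010, 111100, 111101, 111110, 111111, 121010, 121110, 121111,
  122110, 122111, 122211, 1000000, 1100000, 1110000, 1110010, 1111000, 1111010, 1111100, 1111101,
  1111110, 1111111, 1121010, 1121110, 1121111, 1122110, 1122111, 1122211, 1221010, 1221110,
  1221111, 1222110, 1222111, 1222211, 1232110, 1232111, 1232120, 1232121, 1232211, 1232221,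
  1233211, 1233221, 1243221, 1343221, 2343221]

/-- The vector of the last seven digits of a number. -/
def ofDigits (c : ℕ) : Fin 7 → ℤ := fun i => (c / 10 ^ (i : ℕ) % 10 : ℕ)

theorem typeE7_isFiniteType : typeE7.IsFiniteType := by
  refine (isFiniteType_of_pos (S := ofDigits '' {c | c ∈ rootCodesE7}) ?_ ?_ ?_ ?_ ?_).1
  · exact (List.finite_toSet _).image _
  · rintro _ ⟨c, -, rfl⟩ i
    exact Int.natCast_nonneg _
  · intro i
    refine ⟨10 ^ (i : ℕ), ?_, ?_⟩
    · revert i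
      decide +kernel
    · revert i
      unfold simpleRoot
      decide +kernel
  · have key : ∀ c ∈ rootCodesE7, ∀ i : Fin 7, ofDigits c = Pi.single i 1 ∨
        ∃ c' ∈ rootCodesE7, ∀ j, ofDigits c' j =
          if j = i then ofDigits c i - ∑ k, typeE7.A k i * ofDigits c k else ofDigits c j := by
      decide +kernel
    rintro _ ⟨c, hc, rfl⟩ i
    rcases key c hc i with h | ⟨c', hc', h⟩
    · exact Or.inl h
    · refine Or.inr ⟨c', hc', ?_⟩
      ext j
      rw [h, refl_apply_coord]
  · have key : ∀ c' ∈ rootCodesE7, ∀ i : Fin 7, (∀ j ≠ i, ofDigits c' j = 0) →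
        ofDigits c' i = 1 := by
      decide +kernel
    rintro i c - ⟨c', hc', h⟩
    have h1 := key c' hc' i fun j hj => by rw [h]; simp [simpleRoot, hj]
    rw [h] at h1
    simpa [simpleRoot] using h1

/-- The word `wordH` in the indices of the simple roots. -/
def indicesH : List (Fin 7) := [0, 2, 3, 4, 5, 6, 1, 4, 5, 3, 4, 1, 2, 3, 0]

theorem elt_wordH : typeE7.elt wordH = typeE7.wordProd indicesH := rfl

theorem eq_sum_smul_simpleRoot {n : ℕ} {R : Type} [CommRing R] (v : Fin n → R) :
    v = ∑ j, v j • simpleRoot R j := by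
  ext i
  simp [simpleRoot, Pi.single_apply]

/-- Both roots contain α_i exactly once, so γ - β is a nonnegative combination of the other simple
roots, which w⁻¹ keeps positive. Hence w⁻¹ β ≤ w⁻¹ γ, and w⁻¹ β cannot be positive. -/
theorem CartanDatum.IsFiniteType.mem_inversions_of_le {n : ℕ} {C : CartanDatum n ℤ}
    (H : C.IsFiniteType) {w : (Fin n → ℤ) ≃ₗ[ℤ] (Fin n → ℤ)} (hw : w ∈ C.W) {i : Fin n}
    (hdesc : ∀ j ≠ i, 0 ≤ w⁻¹ (simpleRoot ℤ j)) {β γ : Fin n → ℤ} (hγ : γ ∈ C.inversions w)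
    (h1 : γ i ≤ 1) (hβ : β ∈ C.rootFilter i) (hle : β ≤ γ) : β ∈ C.inversions w := by
  rw [H.mem_inversions_iff hw] at hγ ⊢
  refine ⟨hβ.1, fun h => hγ.2 ?_⟩
  have hi : (γ - β) i = 0 := by
    have h2 : β i ≤ γ i := hle i
    have h3 := hβ.1.2 i
    have h4 := hβ.2
    simp only [Pi.zero_apply, Pi.sub_apply] at h3 ⊢
    omega
  have hd : 0 ≤ w⁻¹ (γ - β) := by
    rw [eq_sum_smul_simpleRoot (γ - β), map_sum]
    refine Finset.sum_nonneg fun j _ => ?_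
    rw [map_smul]
    by_cases hj : j = i
    · rw [hj, hi, zero_smul]
    · exact smul_nonneg (sub_nonneg.mpr (hle j)) (hdesc j hj)
  rw [map_sub] at hd
  exact h.trans (sub_nonneg.mp hd)

/-- The image of a vector under a simple reflection, in coordinates. -/
def CartanDatum.reflCoord {n : ℕ} {R : Type} [CommRing R] (C : CartanDatum n R) (i : Fin n)
    (v : Fin n → R) : Fin n → R :=
  fun j => if j = i then v i - ∑ k, C.A k i * v k else v j

theorem CartanDatum.wordProd_apply {n : ℕ} {R : Type} [CommRing R] (C : CartanDatum n R)
    (l : List (Fin n)) (v : Fin n → R) : C.wordProd l v = l.foldr C.reflCoord v := by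
  induction l with
  | nil => rfl
  | cons i l ih =>
    rw [wordProd_cons, LinearEquiv.mul_apply, ih]
    exact funext (C.refl_apply_coord i _)

/-- The inversions of the element spelled by `wordH`, as codes. -/
def idealCodesE7 : Fin 15 → ℕ :=
  ![1122111, 1121111, 1111111, 1111101, 1221111, 122211, 122111, 121111, 111111, 111101, 11111,
  11101, 1101, 101, 1]

theorem inv_elt_wordH_apply (v : Fin 7 → ℤ) :
    (typeE7.elt wordH)⁻¹ v = indicesH.reverse.foldr typeE7.reflCoord v := by
  rw [elt_wordH, ← wordProd_reverse, wordProd_apply]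

/-- Inversions always occur among the letter labels. Conversely, each listed vector is a label and
acquires a negative coordinate under w⁻¹. -/
theorem inversions_wordH :
    typeE7.inversions (typeE7.elt wordH) = Set.range fun x => ofDigits (idealCodesE7 x) := by
  have h1 : ∀ p : Fin 15, ∃ x, (indicesH.take p).foldr typeE7.reflCoord
      (Pi.single (indicesH.get p) 1) = ofDigits (idealCodesE7 x) := by
    decide +kernel
  have h2 : ∀ x, ∃ p : Fin 15, (indicesH.take p).foldr typeE7.reflCoord
      (Pi.single (indicesH.get p) 1) = ofDigits (idealCodesE7 x) := by
    decide +kernel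
  have h3 : ∀ x, ∃ k, indicesH.reverse.foldr typeE7.reflCoord (ofDigits (idealCodesE7 x)) k < 0 := by
    decide +kernel
  ext β
  constructor
  · intro hβ
    rw [elt_wordH] at hβ
    obtain ⟨p, rfl⟩ := typeE7_isFiniteType.exists_letterRoot_of_mem_inversions indicesH hβ
    obtain ⟨x, hx⟩ := h1 p
    exact ⟨x, by rw [letterRoot, wordProd_apply, simpleRoot, hx]⟩
  · rintro ⟨x, rfl⟩
    dsimp only
    rw [typeE7_isFiniteType.mem_inversions_iff (elt_mem_W _ _)]
    refine ⟨⟨?_, fun i => Int.natCast_nonneg _⟩, ?_⟩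
    · obtain ⟨p, hp⟩ := h2 x
      rw [← hp, ← wordProd_apply]
      exact ⟨_, typeE7.wordProd_mem_W _, _, rfl⟩
    · rw [inv_elt_wordH_apply]
      obtain ⟨k, hk⟩ := h3 x
      exact fun h => absurd (h k) (not_le.mpr hk)

theorem mem_inversions_wordH_of_le {β : Fin 7 → ℤ} (hβ : β ∈ typeE7.rootFilter 0) (x : Fin 15)
    (hle : β ≤ ofDigits (idealCodesE7 x)) : β ∈ typeE7.inversions (typeE7.elt wordH) := by
  refine typeE7_isFiniteType.mem_inversions_of_le (elt_mem_W _ _) (fun j hj => ?_)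
    (inversions_wordH ▸ Set.mem_range_self x) ?_ hβ hle
  · rw [inv_elt_wordH_apply, simpleRoot]
    revert j
    have : ∀ j ≠ 0, ∀ k, 0 ≤ indicesH.reverse.foldr typeE7.reflCoord (Pi.single j 1) k := by
      decide +kernel
    exact this
  · revert x
    have : ∀ x, ofDigits (idealCodesE7 x) 0 ≤ 1 := by decide +kernel
    exact fun x _ => this x

theorem inversions_wordH_subset : typeE7.inversions (typeE7.elt wordH) ⊆ typeE7.rootFilter 0 := by
  intro β hβ
  refine ⟨hβ.1, ?_⟩
  rw [inversions_wordH] at hβ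
  obtain ⟨x, rfl⟩ := hβ
  have : ∀ x, ofDigits (idealCodesE7 x) 0 ≠ 0 := by decide +kernel
  exact this x

theorem numRed_wordH : typeE7.numRed (typeE7.elt wordH) = 286 := by
  -- These are the heights of the roots w⁻¹ α_j; the single negative entry says that every reduced
  -- word starts with the first node.
  have h1 : ∀ j, ![-14, 1, 2, 2, 1, 2, 2] j =
      ∑ k, indicesH.reverse.foldr typeE7.reflCoord (Pi.single j 1) k := by
    decide +kernel
  have h2 : typeE7.len (typeE7.elt wordH) ≤ 15 := typeE7.len_wordProd_le indicesH
  rw [typeE7_isFiniteType.numRed_eq_gameCount id (fun a => decide (a < 0)) (by simp)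
    (fun i j a b => a - typeE7.A j i * b) (by simp) 15 ![-14, 1, 2, 2, 1, 2, 2] (elt_mem_W _ _)
    h2 fun j => by rw [inv_elt_wordH_apply]; exact h1 j]
  decide +kernel

/-! ### Type H_3 over ℤ[φ] -/

open Real

theorem CartanDatum.refl_mul_comm_of_eq_zero {n : ℕ} {R : Type} [CommRing R]
    {C : CartanDatum n R} {i j : Fin n} (h1 : C.A i j = 0) (h2 : C.A j i = 0) :
    C.refl i * C.refl j = C.refl j * C.refl i := by
  refine LinearEquiv.ext fun v => ?_
  simp only [LinearEquiv.mul_apply, refl_apply, map_sub, map_smul, simpleCoroot_simpleRoot_eq, h1,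
    h2, zero_smul, sub_zero]
  abel

/-- The real number `a + b φ`. -/
noncomputable def goldenVal (x : ℤ × ℤ) : ℝ := x.1 + x.2 * goldenRatio

/-- The product of `a + b φ` and `c + d φ`. -/
def goldenMul (x y : ℤ × ℤ) : ℤ × ℤ := (x.1 * y.1 + x.2 * y.2, x.1 * y.2 + x.2 * y.1 + x.2 * y.2)

/-- Whether `a + b φ` is negative. -/
def goldenNeg (x : ℤ × ℤ) : Bool :=
  decide ((2 * x.1 + x.2 ≤ 0 ∧ x.2 < 0) ∨ (2 * x.1 + x.2 < 0 ∧ x.2 = 0) ∨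
    (2 * x.1 + x.2 < 0 ∧ 0 < x.2 ∧ 5 * x.2 ^ 2 < (2 * x.1 + x.2) ^ 2) ∨
    (0 < 2 * x.1 + x.2 ∧ x.2 < 0 ∧ (2 * x.1 + x.2) ^ 2 < 5 * x.2 ^ 2))

theorem goldenVal_mul (x y : ℤ × ℤ) : goldenVal (goldenMul x y) = goldenVal x * goldenVal y := by
  simp only [goldenVal, goldenMul]
  push_cast
  linear_combination -(x.2 * y.2 : ℝ) * goldenRatio_sq

theorem goldenVal_sub (x y : ℤ × ℤ) : goldenVal (x - y) = goldenVal x - goldenVal y := by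
  simp only [goldenVal, Prod.fst_sub, Prod.snd_sub]
  push_cast
  ring

theorem goldenVal_sum {ι : Type} (s : Finset ι) (f : ι → ℤ × ℤ) :
    goldenVal (∑ i ∈ s, f i) = ∑ i ∈ s, goldenVal (f i) := by
  simp only [goldenVal, Prod.fst_sum, Prod.snd_sum]
  push_cast
  rw [Finset.sum_add_distrib, Finset.sum_mul]

theorem goldenVal_injective : Function.Injective goldenVal := by
  have key : ∀ z : ℤ × ℤ, goldenVal z = 0 → z = 0 := by
    rintro ⟨a, b⟩ h
    simp only [goldenVal] at h
    have hb : b = 0 := by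
      by_contra hb
      have hb' : (b : ℝ) ≠ 0 := Int.cast_ne_zero.mpr hb
      refine goldenRatio_irrational ⟨-a / b, ?_⟩
      push_cast
      rw [div_eq_iff hb']
      linarith
    subst hb
    simpa using h
  intro x y h
  exact sub_eq_zero.mp (key _ (by rw [goldenVal_sub, h, sub_self]))

theorem goldenVal_zero : goldenVal (0, 0) = 0 := by simp [goldenVal]

theorem goldenVal_one : goldenVal (1, 0) = 1 := by simp [goldenVal]

theorem goldenVal_nonneg {x : ℤ × ℤ} (h1 : 0 ≤ x.1) (h2 : 0 ≤ x.2) : 0 ≤ goldenVal x :=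
  add_nonneg (Int.cast_nonneg h1) (mul_nonneg (Int.cast_nonneg h2) goldenRatio_pos.le)

theorem goldenNeg_iff (x : ℤ × ℤ) : goldenNeg x ↔ goldenVal x < 0 := by
  obtain ⟨a, b⟩ := x
  have h5 : √5 ^ 2 = (5 : ℝ) := Real.sq_sqrt (by norm_num)
  have h0 : 0 < √(5 : ℝ) := by positivity
  -- With p = 2a + b the sign is that of p + b√5, decided by the signs of p and b or, when these are
  -- opposite, by comparing p² with 5b².
  have e : goldenVal (a, b) = ((2 * a + b : ℤ) + (b : ℝ) * √5) / 2 := by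
    simp only [goldenVal, goldenRatio]
    push_cast
    ring
  rw [e, goldenNeg, decide_eq_true_iff]
  dsimp only
  generalize 2 * a + b = p
  have hlt : ∀ u v : ℤ, u < v ↔ (u : ℝ) < v := fun u v => Int.cast_lt.symm
  have hle : ∀ u v : ℤ, u ≤ v ↔ (u : ℝ) ≤ v := fun u v => Int.cast_le.symm
  have heq : ∀ u v : ℤ, u = v ↔ (u : ℝ) = v := fun u v => Int.cast_inj.symm
  simp only [hlt, hle, heq]
  push_cast
  generalize (p : ℝ) = p
  generalize (b : ℝ) = b
  constructor
  · rintro (⟨h1, h2⟩ | ⟨h1, h2⟩ | ⟨h1, h2, h3⟩ | ⟨h1, h2, h3⟩)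
    · nlinarith
    · nlinarith
    · have : b * √5 < -p := lt_of_pow_lt_pow_left₀ 2 (by linarith) (by nlinarith)
      linarith
    · have : p < -b * √5 := lt_of_pow_lt_pow_left₀ 2 (by nlinarith) (by nlinarith)
      linarith
  · intro h
    have h : p + b * √5 < 0 := by linarith
    rcases lt_trichotomy b 0 with hb | hb | hb
    · by_cases hp : p ≤ 0
      · exact Or.inl ⟨hp, hb⟩
      · refine Or.inr (Or.inr (Or.inr ⟨not_le.mp hp, hb, ?_⟩))
        have := pow_lt_pow_left₀ (show p < -b * √5 by linarith) (not_le.mp hp).le two_ne_zero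
        nlinarith
    · subst hb
      exact Or.inr (Or.inl ⟨by linarith, rfl⟩)
    · have hb5 : 0 < b * √5 := by positivity
      refine Or.inr (Or.inr (Or.inl ⟨by linarith, hb, ?_⟩))
      have := pow_lt_pow_left₀ (show b * √5 < -p by linarith) hb5.le two_ne_zero
      nlinarith

/-- The Cartan matrix of type `H 3`. -/
def cartanH (i j : Fin 3) : ℤ × ℤ :=
  if i = j then (2, 0) else if (i : ℕ) + j = 1 then (0, -1) else if (i : ℕ) + j = 3 then (-1, 0)
  else (0, 0)

theorem typeH3_A (i j : Fin 3) : typeH3.A i j = goldenVal (cartanH i j) := by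
  have h (i j : Fin 3) : typeH3.A i j =
      -2 * Real.cos (Real.pi / ((CoxeterMatrix.H₃ i.rev j.rev : ℕ) : ℝ)) := rfl
  have e1 : CoxeterMatrix.H₃ 0 1 = 3 := rfl
  have e2 : CoxeterMatrix.H₃ 1 0 = 3 := rfl
  have e3 : CoxeterMatrix.H₃ 0 2 = 2 := rfl
  have e4 : CoxeterMatrix.H₃ 2 0 = 2 := rfl
  have e5 : CoxeterMatrix.H₃ 1 2 = 5 := rfl
  have e6 : CoxeterMatrix.H₃ 2 1 = 5 := rfl
  by_cases hij : i = j
  · subst hij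
    rw [typeH3.diag, cartanH, if_pos rfl]
    simp [goldenVal]
  · rw [h]
    fin_cases i <;> fin_cases j <;> first | exact absurd rfl hij | skip
    all_goals simp [e1, e2, e3, e4, e5, e6, cartanH, goldenVal, cos_pi_div_five, goldenRatio]
    all_goals ring

/-- The vector with coordinates `a + b φ` in the basis of simple roots. -/
noncomputable def goldenVec (v : Fin 3 → ℤ × ℤ) : Fin 3 → ℝ := fun i => goldenVal (v i)

theorem goldenVec_injective : Function.Injective goldenVec := fun _ _ h =>
  funext fun i => goldenVal_injective (congrFun h i)

/-- The image of a vector under a simple reflection of type `H 3`. -/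
def reflH (i : Fin 3) (v : Fin 3 → ℤ × ℤ) : Fin 3 → ℤ × ℤ :=
  fun j => if j = i then v i - ∑ k, goldenMul (cartanH k i) (v k) else v j

theorem refl_goldenVec (i : Fin 3) (v : Fin 3 → ℤ × ℤ) :
    typeH3.refl i (goldenVec v) = goldenVec (reflH i v) := by
  ext j
  simp only [refl_apply_coord, goldenVec, reflH]
  split_ifs with h
  · rw [goldenVal_sub, goldenVal_sum]
    simp only [goldenVal_mul, typeH3_A]
  · rfl

theorem wordProd_goldenVec (l : List (Fin 3)) (v : Fin 3 → ℤ × ℤ) :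
    typeH3.wordProd l (goldenVec v) = goldenVec (l.foldr reflH v) := by
  induction l with
  | nil => rfl
  | cons i l ih => rw [wordProd_cons, LinearEquiv.mul_apply, ih, refl_goldenVec, List.foldr_cons]

/-- The simple roots of type `H 3`. -/
def simpleH (i : Fin 3) : Fin 3 → ℤ × ℤ := fun j => if j = i then (1, 0) else (0, 0)

theorem simpleRoot_typeH3 (i : Fin 3) : simpleRoot ℝ i = goldenVec (simpleH i) := by
  ext j
  rw [simpleRoot, Pi.single_apply, goldenVec, simpleH]
  split_ifs
  · exact goldenVal_one.symm
  · exact goldenVal_zero.symm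

/-- The positive roots of type `H 3`. -/
def rootH : Fin 15 → Fin 3 → ℤ × ℤ :=
  ![![(0, 0), (1, 0), (0, 0)], ![(1, 0), (0, 1), (0, 0)], ![(0, 1), (0, 1), (0, 0)],
  ![(0, 1), (1, 0), (0, 0)], ![(1, 0), (0, 0), (0, 0)], ![(0, 0), (0, 0), (1, 0)],
  ![(0, 0), (1, 0), (1, 0)], ![(1, 0), (0, 1), (0, 1)], ![(0, 1), (0, 1), (0, 1)],
  ![(0, 1), (1, 0), (1, 0)], ![(0, 1), (1, 1), (0, 1)], ![(1, 1), (1, 1), (0, 1)],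
  ![(1, 1), (0, 2), (0, 1)], ![(0, 1), (1, 1), (1, 0)], ![(1, 1), (1, 1), (1, 0)]]

/-- A reduced word for the longest element of type `H 3`. -/
def longestH : List (Fin 3) := [2, 1, 0, 1, 0, 2, 1, 0, 1, 2, 1, 0, 1, 0, 1]

theorem typeH3_isFiniteType_and : typeH3.IsFiniteType ∧
    typeH3.posRoots = Set.range fun x => goldenVec (rootH x) := by
  have h0 : ∀ x i, 0 ≤ (rootH x i).1 ∧ 0 ≤ (rootH x i).2 := by decide +kernel
  have hpos : ∀ x, 0 ≤ goldenVec (rootH x) := fun x i => goldenVal_nonneg (h0 x i).1 (h0 x i).2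
  have h : typeH3.IsFiniteType ∧ typeH3.posRoots ⊆ Set.range fun x => goldenVec (rootH x) := by
    refine isFiniteType_of_pos (Set.finite_range _) ?_ ?_ ?_ ?_
    · rintro _ ⟨x, rfl⟩
      exact hpos x
    · have key : ∀ i, ∃ x, rootH x = simpleH i := by decide +kernel
      intro i
      obtain ⟨x, hx⟩ := key i
      exact ⟨x, by rw [simpleRoot_typeH3, ← hx]⟩
    · have key : ∀ x i, rootH x = simpleH i ∨ ∃ y, rootH y = reflH i (rootH x) := by
        decide +kernel
      rintro _ ⟨x, rfl⟩ i
      rcases key x i with h | ⟨y, hy⟩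
      · exact Or.inl (by rw [simpleRoot_typeH3, ← h])
      · exact Or.inr ⟨y, by rw [refl_goldenVec, ← hy]⟩
    · have key : ∀ x i, (∀ j ≠ i, rootH x j = (0, 0)) → rootH x i = (1, 0) := by decide +kernel
      rintro i c - ⟨x, hx⟩
      have h1 : ∀ j, goldenVal (rootH x j) = c * simpleRoot ℝ i j := fun j => congrFun hx j
      have h2 := key x i fun j hj => goldenVal_injective (by
        rw [h1, goldenVal_zero, simpleRoot, Pi.single_eq_of_ne hj, mul_zero])
      have h3 := h1 i
      rw [h2, goldenVal_one, simpleRoot, Pi.single_eq_same, mul_one] at h3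
      exact h3.symm
  refine ⟨h.1, h.2.antisymm ?_⟩
  -- Closure only bounds the roots from above; each listed vector is a root because it labels a
  -- letter of the long word.
  have key : ∀ x, ∃ p : Fin 15, (longestH.take p).foldr reflH (simpleH (longestH.get p)) =
      rootH x := by
    decide +kernel
  rintro _ ⟨x, rfl⟩
  refine ⟨?_, hpos x⟩
  obtain ⟨p, hp⟩ := key x
  dsimp only
  rw [← hp, ← wordProd_goldenVec, ← simpleRoot_typeH3]
  exact ⟨_, typeH3.wordProd_mem_W _, _, rfl⟩

theorem typeH3_isFiniteType : typeH3.IsFiniteType := typeH3_isFiniteType_and.1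

theorem posRoots_typeH3 : typeH3.posRoots = Set.range fun x => goldenVec (rootH x) :=
  typeH3_isFiniteType_and.2

theorem wordProd_longestH_apply (v : Fin 3 → ℝ) : typeH3.wordProd longestH v = -v := by
  have key : ∀ i, longestH.foldr reflH (simpleH i) = fun j => (0, 0) - simpleH i j := by
    decide +kernel
  have h : ∀ i, typeH3.wordProd longestH (simpleRoot ℝ i) = -simpleRoot ℝ i := fun i => by
    rw [simpleRoot_typeH3, wordProd_goldenVec, key]
    ext j
    simp only [goldenVec, goldenVal_sub, goldenVal_zero, Pi.neg_apply, zero_sub]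
  rw [eq_sum_smul_simpleRoot v, map_sum, ← Finset.sum_neg_distrib]
  exact Finset.sum_congr rfl fun i _ => by rw [map_smul, h, smul_neg]

theorem isLongest_longestH : typeH3.IsLongest (typeH3.wordProd longestH) :=
  typeH3_isFiniteType.isLongest_neg_one (typeH3.wordProd_mem_W _) wordProd_longestH_apply

theorem numRed_longestH : typeH3.numRed (typeH3.wordProd longestH) = 286 := by
  -- As w₀ = -1, each w₀⁻¹ α_j = -α_j has height -1, so the game starts from the constant position
  -- -1.
  have h1 : ∀ j, goldenVal ((fun _ => (-1, 0) : Fin 3 → ℤ × ℤ) j) =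
      ∑ k, (typeH3.wordProd longestH)⁻¹ (simpleRoot ℝ j) k := by
    intro j
    have e : (typeH3.wordProd longestH)⁻¹ (simpleRoot ℝ j) = -simpleRoot ℝ j := by
      have h := wordProd_longestH_apply (-simpleRoot ℝ j)
      rw [neg_neg] at h
      conv_lhs => rw [← h]
      exact inv_apply_apply _ _
    rw [e]
    simp [simpleRoot, goldenVal]
  have h2 : typeH3.len (typeH3.wordProd longestH) ≤ 15 := typeH3.len_wordProd_le longestH
  rw [typeH3_isFiniteType.numRed_eq_gameCount goldenVal goldenNeg goldenNeg_iff
    (fun i j a b => a - goldenMul (cartanH j i) b)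
    (fun i j a b => by rw [goldenVal_sub, goldenVal_mul, typeH3_A]) 15 _
    (typeH3.wordProd_mem_W _) h2 h1]
  decide +kernel

/-- Adjacency in the Coxeter diagram of type `H 3`. -/
def AdjH (i j : Fin 3) : Prop := (i : ℕ) + 1 = j ∨ (j : ℕ) + 1 = i

instance (i j : Fin 3) : Decidable (AdjH i j) := inferInstanceAs (Decidable (_ ∨ _))

theorem refl_typeH3_not_comm_iff (i j : Fin 3) :
    typeH3.refl i * typeH3.refl j ≠ typeH3.refl j * typeH3.refl i ↔ AdjH i j := by
  constructor
  · intro h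
    by_contra hij
    apply h
    by_cases hne : i = j
    · rw [hne]
    · have key : ∀ i j, i ≠ j → ¬ AdjH i j → cartanH i j = (0, 0) ∧ cartanH j i = (0, 0) := by
        decide +kernel
      obtain ⟨h1, h2⟩ := key i j hne hij
      exact refl_mul_comm_of_eq_zero (by rw [typeH3_A, h1, goldenVal_zero])
        (by rw [typeH3_A, h2, goldenVal_zero])
  · have key : ∀ i j, AdjH i j → ∃ k, reflH i (reflH j (simpleH k)) ≠
        reflH j (reflH i (simpleH k)) := by
      decide +kernel
    intro h e
    obtain ⟨k, hk⟩ := key i j h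
    have := LinearEquiv.congr_fun e (goldenVec (simpleH k))
    simp only [LinearEquiv.mul_apply, refl_goldenVec] at this
    exact hk (goldenVec_injective this)

/-- The root labelling a letter of a word in type `H 3`. -/
def letterH (l : List (Fin 3)) (p : Fin l.length) : Fin 3 → ℤ × ℤ :=
  (l.take p).foldr reflH (simpleH (l.get p))

theorem letterRoot_typeH3 (l : List (Fin 3)) (p : Fin l.length) :
    typeH3.letterRoot l p = goldenVec (letterH l p) := by
  rw [letterRoot, simpleRoot_typeH3, wordProd_goldenVec, letterH]

/-- The relations generating the root poset of type `H 3`, for vectors with coordinates `a + b φ`. -/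
def RelH (u v : Fin 3 → ℤ × ℤ) : Prop :=
  ((∃ p q : Fin (alternatingWord (1 : Fin 3) 0 4).length, p < q ∧
      AdjH ((alternatingWord (1 : Fin 3) 0 4).get p) ((alternatingWord (1 : Fin 3) 0 4).get q) ∧
      u = letterH (alternatingWord (1 : Fin 3) 0 4) p ∧
      v = letterH (alternatingWord (1 : Fin 3) 0 4) q) ∨
    (u = simpleH 0 ∧ v = reflH 1 (simpleH 0))) ∨
  (∃ p q : Fin ([2, 1, 0, 1, 0, 2, 1, 0, 1, 2] : List (Fin 3)).length, p < q ∧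
      AdjH (([2, 1, 0, 1, 0, 2, 1, 0, 1, 2] : List (Fin 3)).get p)
        (([2, 1, 0, 1, 0, 2, 1, 0, 1, 2] : List (Fin 3)).get q) ∧
      u = letterH [2, 1, 0, 1, 0, 2, 1, 0, 1, 2] p ∧
      v = letterH [2, 1, 0, 1, 0, 2, 1, 0, 1, 2] q) ∨
  (u 2 = (0, 0) ∧ reflH 2 u ≠ u ∧ v = reflH 2 u)

instance (u v : Fin 3 → ℤ × ℤ) : Decidable (RelH u v) := inferInstanceAs (Decidable (_ ∨ _))

theorem heapRel_goldenVec_iff (l : List (Fin 3)) (β γ : Fin 3 → ℝ) : typeH3.heapRel l β γ ↔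
    ∃ p q : Fin l.length, p < q ∧ AdjH (l.get p) (l.get q) ∧ β = goldenVec (letterH l p) ∧
      γ = goldenVec (letterH l q) := by
  simp only [heapRel, refl_typeH3_not_comm_iff, letterRoot_typeH3]

/-- Exact coordinates are unique since φ is irrational, so the real relations become the decidable
`RelH`. -/
theorem rootRelH3_goldenVec_iff (x : Fin 15) (γ : Fin 3 → ℝ) :
    rootRelH3 (goldenVec (rootH x)) γ ↔ ∃ v, γ = goldenVec v ∧ RelH (rootH x) v := by
  have hpos : goldenVec (rootH x) ∈ typeH3.posRoots := posRoots_typeH3 ▸ ⟨x, rfl⟩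
  have h2 : goldenVec (rootH x) 2 = 0 ↔ rootH x 2 = (0, 0) := by
    rw [goldenVec, ← goldenVal_zero, goldenVal_injective.eq_iff]
  simp only [rootRelH3, dihedralRel, heapRel_goldenVec_iff, simpleRoot_typeH3, refl_goldenVec, RelH,
    goldenVec_injective.eq_iff, hpos, true_and, h2, ne_eq, Nat.reduceSub]
  constructor
  · rintro ((⟨p, q, h1, h2, h3, rfl⟩ | ⟨h1, rfl⟩) | ⟨p, q, h1, h2, h3, rfl⟩ | ⟨h1, h2, rfl⟩)
    · exact ⟨_, rfl, Or.inl (Or.inl ⟨p, q, h1, h2, h3, rfl⟩)⟩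
    · exact ⟨_, rfl, Or.inl (Or.inr ⟨h1, rfl⟩)⟩
    · exact ⟨_, rfl, Or.inr (Or.inl ⟨p, q, h1, h2, h3, rfl⟩)⟩
    · exact ⟨_, rfl, Or.inr (Or.inr ⟨h1, h2, rfl⟩)⟩
  · rintro ⟨_, rfl, ((⟨p, q, h1, h2, h3, rfl⟩ | ⟨h1, rfl⟩) | ⟨p, q, h1, h2, h3, rfl⟩ |
      ⟨h1, h2, rfl⟩)⟩
    · exact Or.inl (Or.inl ⟨p, q, h1, h2, h3, rfl⟩)
    · exact Or.inl (Or.inr ⟨h1, rfl⟩)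
    · exact Or.inr (Or.inl ⟨p, q, h1, h2, h3, rfl⟩)
    · exact Or.inr (Or.inr ⟨h1, h2, rfl⟩)

/-- The order of the images of two positive roots of type `H 3` in type `E 7`. -/
def LeE (x y : Fin 15) : Prop :=
  ∀ k, ofDigits (idealCodesE7 x) k ≤ ofDigits (idealCodesE7 y) k

instance (x y : Fin 15) : Decidable (LeE x y) := inferInstanceAs (Decidable (∀ _, _))

theorem exists_of_relH {x : Fin 15} {v : Fin 3 → ℤ × ℤ} (h : RelH (rootH x) v) :
    ∃ y, v = rootH y ∧ LeE y x := by
  have k1 : ∀ p q : Fin (alternatingWord (1 : Fin 3) 0 4).length, p < q →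
      AdjH ((alternatingWord (1 : Fin 3) 0 4).get p) ((alternatingWord (1 : Fin 3) 0 4).get q) →
      ∀ x, rootH x = letterH (alternatingWord (1 : Fin 3) 0 4) p →
      ∃ y, letterH (alternatingWord (1 : Fin 3) 0 4) q = rootH y ∧ LeE y x := by
    decide +kernel
  have k2 : ∀ x, rootH x = simpleH 0 → ∃ y, reflH 1 (simpleH 0) = rootH y ∧ LeE y x := by
    decide +kernel
  have k3 : ∀ p q : Fin ([2, 1, 0, 1, 0, 2, 1, 0, 1, 2] : List (Fin 3)).length, p < q →
      AdjH (([2, 1, 0, 1, 0, 2, 1, 0, 1, 2] : List (Fin 3)).get p)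
        (([2, 1, 0, 1, 0, 2, 1, 0, 1, 2] : List (Fin 3)).get q) →
      ∀ x, rootH x = letterH [2, 1, 0, 1, 0, 2, 1, 0, 1, 2] p →
      ∃ y, letterH [2, 1, 0, 1, 0, 2, 1, 0, 1, 2] q = rootH y ∧ LeE y x := by
    decide +kernel
  have k4 : ∀ x, rootH x 2 = (0, 0) → reflH 2 (rootH x) ≠ rootH x →
      ∃ y, reflH 2 (rootH x) = rootH y ∧ LeE y x := by
    decide +kernel
  rcases h with ((⟨p, q, h1, h2, h3, rfl⟩ | ⟨h1, rfl⟩) | ⟨p, q, h1, h2, h3, rfl⟩ | ⟨h1, h2, rfl⟩)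
  · exact k1 p q h1 h2 x h3
  · exact k2 x h1
  · exact k3 p q h1 h2 x h3
  · exact k4 x h1 h2

/-- The covering pairs of the root poset of type `H 3`. -/
def coversH : List (Fin 15 × Fin 15) :=
  [(0, 1), (0, 6), (1, 2), (1, 7), (2, 3), (2, 8), (3, 9), (4, 1), (5, 6), (6, 7), (7, 8), (8, 9),
    (8, 10), (9, 11), (10, 11), (11, 12), (12, 13), (13, 14)]

theorem relH_of_mem_coversH : ∀ c ∈ coversH, RelH (rootH c.1) (rootH c.2) := by
  decide +kernel

/-- The E_7 order is reversed by every generating relation, hence by the closure. Conversely, from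
any comparable pair one can climb along `coversH`; the decimal code of the E_7 root drops at each
climb and serves as induction measure. -/
theorem rootLeH3_iff (x y : Fin 15) :
    rootLeH3 (goldenVec (rootH x)) (goldenVec (rootH y)) ↔ LeE y x := by
  have hinj : Function.Injective rootH := by decide +kernel
  constructor
  · intro h
    have key : ∀ β γ, rootLeH3 β γ → β = goldenVec (rootH x) →
        ∃ z, γ = goldenVec (rootH z) ∧ LeE z x := by
      rintro β γ h rfl
      induction h with
      | refl => exact ⟨x, rfl, fun _ => le_rfl⟩
      | tail _ hr ih =>
        obtain ⟨z, rfl, hz⟩ := ih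
        obtain ⟨v, rfl, hv⟩ := (rootRelH3_goldenVec_iff z _).mp hr
        obtain ⟨t, rfl, ht⟩ := exists_of_relH hv
        exact ⟨t, rfl, fun k => (ht k).trans (hz k)⟩
    obtain ⟨z, hz, hzx⟩ := key _ _ h rfl
    rwa [hinj (goldenVec_injective hz)]
  · have key : ∀ x y, LeE y x → x = y ∨ ∃ c ∈ coversH, c.1 = x ∧ LeE y c.2 ∧
        idealCodesE7 c.2 < idealCodesE7 x := by
      decide +kernel
    induction hc : idealCodesE7 x using Nat.strong_induction_on generalizing x with
    | _ d ih =>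
      intro h
      rcases key x y h with rfl | ⟨c, h1, rfl, h3, h4⟩
      · exact Relation.ReflTransGen.refl
      · refine Relation.ReflTransGen.head ?_ (ih _ (hc ▸ h4) c.2 rfl h3)
        exact (rootRelH3_goldenVec_iff c.1 _).mpr ⟨_, rfl, relH_of_mem_coversH c h1⟩

theorem typeH3_dualEmbeds : DualEmbedsAsIdeal typeH3.posRoots rootLeH3 (typeE7.rootFilter 0)
    (typeE7.inversions (typeE7.elt wordH)) := by
  refine dualEmbedsAsIdeal_of_index (fun x => goldenVec (rootH x))
    (fun x => ofDigits (idealCodesE7 x)) posRoots_typeH3 inversions_wordH inversions_wordH_subset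
    ?_ rootLeH3_iff fun β hβ x => mem_inversions_wordH_of_le hβ x
  have key : ∀ x y, ofDigits (idealCodesE7 x) = ofDigits (idealCodesE7 y) → x = y := by
    decide +kernel
  exact key

theorem typeH3_main : DualEmbedsAsIdeal typeH3.posRoots rootLeH3 (typeE7.rootFilter 0)
      (typeE7.inversions (typeE7.elt wordH)) ∧
    ∃ w₀, typeH3.IsLongest w₀ ∧ Nonempty (typeH3.Red w₀ ≃ typeE7.Red (typeE7.elt wordH)) :=
  ⟨typeH3_dualEmbeds, _, isLongest_longestH,
    nonempty_Red_equiv (numRed_longestH.trans numRed_wordH.symm)⟩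

/-! ### Dihedral groups: roots numbered by integers, and their reduced words -/

theorem CartanDatum.IsFiniteType.numRed_eq_refl_mul {n : ℕ} {R : Type} [CommRing R] [LinearOrder R]
    [IsStrictOrderedRing R] {C : CartanDatum n R} (H : C.IsFiniteType)
    {w : (Fin n → R) ≃ₗ[R] (Fin n → R)} (hw : w ∈ C.W) {i : Fin n}
    (h1 : ¬ 0 ≤ w⁻¹ (simpleRoot R i)) (h2 : ∀ j ≠ i, 0 ≤ w⁻¹ (simpleRoot R j)) :
    C.numRed w = C.numRed (C.refl i * w) := by
  have hne : w ≠ 1 := by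
    rintro rfl
    exact h1 (simpleRoot_nonneg i)
  have hd : C.desc w = {i} := by
    ext j
    rw [H.mem_desc_iff hw, Finset.mem_singleton]
    constructor
    · intro h
      by_contra hj
      exact h (h2 j hj)
    · rintro rfl
      exact h1
  rw [numRed_eq_sum hw hne, hd, Finset.sum_singleton]

theorem alternatingWord_succ {n : ℕ} (a b : Fin n) (p : ℕ) :
    alternatingWord a b (p + 1) = alternatingWord a b p ++ [if Even p then a else b] := by
  simp [alternatingWord, List.range_succ]

theorem length_alternatingWord {n : ℕ} (a b : Fin n) (p : ℕ) :
    (alternatingWord a b p).length = p := by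
  simp [alternatingWord]

/-- The coordinates of the roots of type `I 2 m`. -/
noncomputable def coordI (m : ℕ) (j : ℤ) : ℝ := sin (j * (π / m)) / sin (π / m)

/-- The roots of type `I 2 m`. -/
noncomputable def rootI (m : ℕ) (p : ℤ) : Fin 2 → ℝ := ![coordI m (p + 1), coordI m p]

section TypeI

variable {m : ℕ} (hm : 2 ≤ m)

include hm

theorem sin_pi_div_pos : 0 < sin (π / m) := by
  have : (2 : ℝ) ≤ m := by exact_mod_cast hm
  refine sin_pos_of_pos_of_lt_pi (by positivity) ?_
  rw [div_lt_iff₀ (by linarith)]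
  nlinarith [pi_pos]

theorem coordI_pos {j : ℤ} (h1 : 0 < j) (h2 : j < m) : 0 < coordI m j := by
  have h0 : (2 : ℝ) ≤ m := by exact_mod_cast hm
  have h1' : (0 : ℝ) < j := by exact_mod_cast h1
  have h2' : (j : ℝ) < m := by exact_mod_cast h2
  refine div_pos (sin_pos_of_pos_of_lt_pi (by positivity) ?_) (sin_pi_div_pos hm)
  rw [mul_div_assoc', div_lt_iff₀ (by linarith)]
  nlinarith [pi_pos]

theorem coordI_zero : coordI m 0 = 0 := by simp [coordI]

theorem coordI_one : coordI m 1 = 1 := by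
  simp [coordI, (sin_pi_div_pos hm).ne']

theorem coordI_reflect (j : ℤ) : coordI m (m - j) = coordI m j := by
  have h0 : (m : ℝ) ≠ 0 := by positivity
  rw [coordI, coordI]
  congr 1
  push_cast
  rw [sub_mul, mul_div_cancel₀ _ h0, sin_pi_sub]

theorem coordI_add (j : ℤ) : coordI m (j + m) = -coordI m j := by
  have h0 : (m : ℝ) ≠ 0 := by positivity
  rw [coordI, coordI]
  push_cast
  rw [add_mul, mul_div_cancel₀ _ h0, sin_add_pi, neg_div]

theorem coordI_self : coordI m m = 0 := by
  rw [← coordI_zero hm, ← coordI_reflect hm, sub_self, coordI_zero hm]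

theorem coordI_nonneg {j : ℤ} (h1 : 0 ≤ j) (h2 : j ≤ m) : 0 ≤ coordI m j := by
  rcases h1.eq_or_lt with rfl | h1
  · rw [coordI_zero hm]
  · rcases h2.eq_or_lt with rfl | h2
    · rw [coordI_self hm]
    · exact (coordI_pos hm h1 h2).le

theorem coordI_succ_add_pred (j : ℤ) :
    coordI m (j + 1) + coordI m (j - 1) = 2 * cos (π / m) * coordI m j := by
  rw [coordI, coordI, coordI]
  push_cast
  rw [add_mul, sub_mul, one_mul, sin_add, sin_sub]
  ring

theorem typeI_A (i j : Fin 2) : (typeI m).A i j = if i = j then 2 else -2 * cos (π / m) := by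
  split_ifs with h
  · rw [h, (typeI m).diag]
  · have : (CoxeterMatrix.I (m - 2) i j : ℕ) = m := by
      change (if i = j then 1 else m - 2 + 2) = m
      rw [if_neg h]
      omega
    change -2 * cos (π / ((CoxeterMatrix.I (m - 2) i j : ℕ) : ℝ)) = _
    rw [this]

/-- The sine addition formula in the form `coordI_succ_add_pred` turns reflections into affine maps
of the index. The positive roots are those with index 0, …, m - 1, and a shift by m is negation. -/
theorem refl_zero_rootI (p : ℤ) : (typeI m).refl 0 (rootI m p) = rootI m (m - p) := by
  have h1 := coordI_succ_add_pred hm p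
  have h2 := coordI_reflect hm (p - 1)
  have h3 := coordI_reflect hm p
  rw [show (m : ℤ) - (p - 1) = m - p + 1 by ring] at h2
  ext j
  rw [refl_apply_coord]
  fin_cases j
  · simp [typeI_A hm, rootI, Fin.sum_univ_two]
    linarith
  · simp [rootI, h3]

theorem refl_one_rootI (p : ℤ) : (typeI m).refl 1 (rootI m p) = rootI m (m - 2 - p) := by
  have h1 := coordI_succ_add_pred hm (p + 1)
  have h2 := coordI_reflect hm (p + 1)
  have h3 := coordI_reflect hm (p + 2)
  rw [show (m : ℤ) - (p + 1) = m - 2 - p + 1 by ring] at h2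
  rw [show (m : ℤ) - (p + 2) = m - 2 - p by ring] at h3
  rw [show p + 1 + 1 = p + 2 by ring, show p + 1 - 1 = p by ring] at h1
  ext j
  rw [refl_apply_coord]
  fin_cases j
  · simp [rootI, h2]
  · simp [typeI_A hm, rootI, Fin.sum_univ_two]
    linarith

theorem simpleRoot_zero_typeI : simpleRoot ℝ 0 = rootI m 0 := by
  ext j
  fin_cases j <;> simp [simpleRoot, rootI, coordI_zero hm, coordI_one hm]

theorem simpleRoot_one_typeI : simpleRoot ℝ 1 = rootI m (m - 1) := by
  have := coordI_reflect hm 1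
  ext j
  fin_cases j <;> simp [simpleRoot, rootI, coordI_self hm, coordI_one hm, this]

theorem rootI_add (p : ℤ) : rootI m (p + m) = -rootI m p := by
  ext j
  fin_cases j
  · simpa [rootI, show p + m + 1 = p + 1 + m by ring] using coordI_add hm (p + 1)
  · simpa [rootI] using coordI_add hm p

theorem rootI_nonneg {p : ℤ} (h1 : 0 ≤ p) (h2 : p < m) : 0 ≤ rootI m p := by
  intro j
  fin_cases j
  · exact coordI_nonneg hm (by omega) (by omega)
  · exact coordI_nonneg hm h1 h2.le

theorem rootI_nonpos {p : ℤ} (h1 : 0 ≤ p + m) (h2 : p < 0) : rootI m p ≤ 0 := by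
  have := rootI_nonneg hm h1 (by omega)
  rwa [rootI_add hm, Left.nonneg_neg_iff] at this

theorem rootI_nonpos' {p : ℤ} (h1 : m ≤ p) (h2 : p < 2 * m) : rootI m p ≤ 0 := by
  have := rootI_nonneg hm (p := p - m) (by omega) (by omega)
  rw [← sub_add_cancel p (m : ℤ), rootI_add hm]
  exact neg_nonpos.mpr this

theorem wordProd_zero_one_rootI (p : ℕ) (q : ℤ) :
    (typeI m).wordProd (alternatingWord 0 1 p) (rootI m q) =
      rootI m (if Even p then q + p else m - q + p - 1) := by
  induction p generalizing q with
  | zero => simp [alternatingWord]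
  | succ p ih =>
    rw [alternatingWord_succ, wordProd_append, LinearEquiv.mul_apply, wordProd_cons, wordProd_nil,
      mul_one]
    by_cases h : Even p
    · simp only [h, if_true, Nat.even_add_one, not_true, if_false]
      rw [refl_zero_rootI hm, ih, if_pos h]
      congr 1
      push_cast
      ring
    · simp only [h, if_true, Nat.even_add_one, not_false_iff, if_false]
      rw [refl_one_rootI hm, ih, if_neg h]
      congr 1
      push_cast
      ring

theorem wordProd_one_zero_rootI (p : ℕ) (q : ℤ) :
    (typeI m).wordProd (alternatingWord 1 0 p) (rootI m q) =
      rootI m (if Even p then q - p else m - 1 - q - p) := by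
  induction p generalizing q with
  | zero => simp [alternatingWord]
  | succ p ih =>
    rw [alternatingWord_succ, wordProd_append, LinearEquiv.mul_apply, wordProd_cons, wordProd_nil,
      mul_one]
    by_cases h : Even p
    · simp only [h, if_true, Nat.even_add_one, not_true, if_false]
      rw [refl_one_rootI hm, ih, if_pos h]
      congr 1
      push_cast
      ring
    · simp only [h, if_true, Nat.even_add_one, not_false_iff, if_false]
      rw [refl_zero_rootI hm, ih, if_neg h]
      congr 1
      push_cast
      ring

theorem letterRoot_typeI (k : ℕ) (p : Fin (alternatingWord (0 : Fin 2) 1 k).length) :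
    (typeI m).letterRoot (alternatingWord 0 1 k) p = rootI m (p : ℕ) := by
  have hp : (p : ℕ) < k := by simpa [length_alternatingWord] using p.2
  have h1 : (alternatingWord (0 : Fin 2) 1 k).take p = alternatingWord 0 1 p := by
    unfold alternatingWord
    rw [← List.map_take, List.take_range, min_eq_left hp.le]
  have h2 : (alternatingWord (0 : Fin 2) 1 k).get p = if Even (p : ℕ) then 0 else 1 := by
    rw [List.get_eq_getElem]
    simp [alternatingWord]
  rw [letterRoot, h1, h2]
  split_ifs with h
  · rw [simpleRoot_zero_typeI hm, wordProd_zero_one_rootI hm, if_pos h, zero_add]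
  · rw [simpleRoot_one_typeI hm, wordProd_zero_one_rootI hm, if_neg h]
    congr 1
    ring

theorem typeI_isFiniteType_and : (typeI m).IsFiniteType ∧
    (typeI m).posRoots = Set.range fun x : Fin m => rootI m (x : ℕ) := by
  have hpos : ∀ x : Fin m, 0 ≤ rootI m (x : ℕ) := fun x => by
    have := x.2
    exact rootI_nonneg hm (by omega) (by omega)
  have h : (typeI m).IsFiniteType ∧
      (typeI m).posRoots ⊆ Set.range fun x : Fin m => rootI m (x : ℕ) := by
    refine isFiniteType_of_pos (Set.finite_range _) ?_ ?_ ?_ ?_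
    · rintro _ ⟨x, rfl⟩
      exact hpos x
    · intro i
      fin_cases i
      · exact ⟨⟨0, by omega⟩, (simpleRoot_zero_typeI hm).symm⟩
      · refine ⟨⟨m - 1, by omega⟩, Eq.trans ?_ (simpleRoot_one_typeI hm).symm⟩
        dsimp only
        congr 1
        omega
    · rintro _ ⟨⟨x, hx⟩, rfl⟩ i
      fin_cases i
      · by_cases h : x = 0
        · subst h
          exact Or.inl (simpleRoot_zero_typeI hm).symm
        · refine Or.inr ⟨⟨m - x, by omega⟩, Eq.trans ?_ (refl_zero_rootI hm _).symm⟩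
          dsimp only
          congr 1
          omega
      · by_cases h : x = m - 1
        · subst h
          refine Or.inl (Eq.trans ?_ (simpleRoot_one_typeI hm).symm)
          dsimp only
          congr 1
          omega
        · refine Or.inr ⟨⟨m - 2 - x, by omega⟩, Eq.trans ?_ (refl_one_rootI hm _).symm⟩
          dsimp only
          congr 1
          omega
    · rintro i c - ⟨⟨x, hx⟩, h⟩
      have e0 : coordI m (x + 1) = c * simpleRoot ℝ i 0 := congrFun h 0
      have e1 : coordI m x = c * simpleRoot ℝ i 1 := congrFun h 1
      fin_cases i
      · simp [simpleRoot] at e0 e1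
        have : x = 0 := by
          by_contra h0
          exact (coordI_pos hm (by omega) (by omega)).ne' e1
        subst this
        rw [← e0]
        simpa using coordI_one hm
      · simp [simpleRoot] at e0 e1
        have : (x : ℤ) = m - 1 := by
          by_contra h0
          exact (coordI_pos hm (by omega) (by omega)).ne' e0
        rw [← e1, this, coordI_reflect hm, coordI_one hm]
  refine ⟨h.1, h.2.antisymm ?_⟩
  rintro _ ⟨x, rfl⟩
  refine ⟨?_, hpos x⟩
  have := letterRoot_typeI hm m ⟨x, by rw [length_alternatingWord]; exact x.2⟩
  dsimp only at this ⊢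
  rw [← this]
  exact ⟨_, (typeI m).wordProd_mem_W _, _, rfl⟩

theorem typeI_isFiniteType : (typeI m).IsFiniteType := (typeI_isFiniteType_and hm).1

theorem posRoots_typeI : (typeI m).posRoots = Set.range fun x : Fin m => rootI m (x : ℕ) :=
  (typeI_isFiniteType_and hm).2

end TypeI

section TypeI

variable {m : ℕ} (hm : 2 ≤ m) (he : Even m)

include hm he

theorem wordProd_longest_typeI_apply (v : Fin 2 → ℝ) :
    (typeI m).wordProd (alternatingWord 0 1 m) v = -v := by
  have h : ∀ q, (typeI m).wordProd (alternatingWord 0 1 m) (rootI m q) = -rootI m q := fun q => by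
    rw [wordProd_zero_one_rootI hm, if_pos he, rootI_add hm]
  rw [eq_sum_smul_simpleRoot v, map_sum, ← Finset.sum_neg_distrib]
  refine Finset.sum_congr rfl fun i _ => ?_
  rw [map_smul, ← smul_neg]
  congr 1
  fin_cases i
  · exact simpleRoot_zero_typeI hm ▸ h 0
  · exact simpleRoot_one_typeI hm ▸ h (m - 1)

theorem isLongest_typeI : (typeI m).IsLongest ((typeI m).wordProd (alternatingWord 0 1 m)) :=
  (typeI_isFiniteType hm).isLongest_neg_one ((typeI m).wordProd_mem_W _)
    (wordProd_longest_typeI_apply hm he)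

theorem inv_inv_mul_longest_apply (u : (Fin 2 → ℝ) ≃ₗ[ℝ] (Fin 2 → ℝ)) (v : Fin 2 → ℝ) :
    (u⁻¹ * (typeI m).wordProd (alternatingWord 0 1 m))⁻¹ v = -u v := by
  have h := wordProd_longest_typeI_apply hm he (-u v)
  rw [neg_neg] at h
  rw [mul_inv_rev, inv_inv, LinearEquiv.mul_apply, ← h, inv_apply_apply, h]

/-- Let u be an alternating prefix with at least one and fewer than m letters. Since w₀ = -1, node i
is a descent of u⁻¹ w₀ exactly when u α_i is positive, and only the next letter of the alternating
word qualifies. So the continuation is forced. -/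
theorem numRed_inv_mul_longest (a b : Fin 2) (hab : a ≠ b)
    (hpos : ∀ k : ℕ, 1 ≤ k → k < m →
      0 ≤ (typeI m).wordProd (alternatingWord a b k) (simpleRoot ℝ (if Even k then a else b)) ∧
      (typeI m).wordProd (alternatingWord a b k) (simpleRoot ℝ (if Even k then b else a)) ≤ 0)
    (hend : (typeI m).wordProd (alternatingWord a b m) =
      (typeI m).wordProd (alternatingWord 0 1 m)) (d k : ℕ) (hk : 1 ≤ k) (hd : k + d = m) :
    (typeI m).numRed (((typeI m).wordProd (alternatingWord a b k))⁻¹ *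
      (typeI m).wordProd (alternatingWord 0 1 m)) = 1 := by
  induction d generalizing k with
  | zero =>
    rw [add_zero] at hd
    rw [hd, hend, inv_mul_cancel, numRed_one]
  | succ d ih =>
    obtain ⟨h1, h2⟩ := hpos k hk (by omega)
    have hW := (typeI m).W.mul_mem ((typeI m).W.inv_mem
      ((typeI m).wordProd_mem_W (alternatingWord a b k)))
      ((typeI m).wordProd_mem_W (alternatingWord 0 1 m))
    rw [(typeI_isFiniteType hm).numRed_eq_refl_mul hW (i := if Even k then a else b), ← mul_assoc,
      ← refl_inv, ← mul_inv_rev]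
    · have h := ih (k + 1) (by omega) (by omega)
      rwa [alternatingWord_succ, wordProd_append, wordProd_cons, wordProd_nil, mul_one] at h
    · rw [inv_inv_mul_longest_apply hm he]
      refine not_nonneg_neg (C := typeI m) ?_ h1
      exact apply_mem_roots ((typeI m).wordProd_mem_W _) (simpleRoot_mem_roots _)
    · intro j hj
      have : j = if Even k then b else a := by
        split_ifs at hj ⊢ <;> omega
      rw [inv_inv_mul_longest_apply hm he, this]
      exact neg_nonneg.mpr h2

theorem numRed_longest_typeI :
    (typeI m).numRed ((typeI m).wordProd (alternatingWord 0 1 m)) = 2 := by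
  have hW := (typeI m).wordProd_mem_W (alternatingWord 0 1 m)
  have h0 : (typeI m).wordProd (alternatingWord 0 1 m) ≠ 1 := by
    intro h
    have h1 := wordProd_longest_typeI_apply hm he (simpleRoot ℝ 0)
    rw [h] at h1
    have h2 := congrFun h1 0
    simp [simpleRoot] at h2
    linarith
  have hd : (typeI m).desc ((typeI m).wordProd (alternatingWord 0 1 m)) = Finset.univ := by
    ext i
    rw [(typeI_isFiniteType hm).mem_desc_iff hW]
    have := inv_inv_mul_longest_apply hm he 1 (simpleRoot ℝ i)
    rw [inv_one, one_mul] at this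
    rw [this]
    exact iff_of_true (not_nonneg_neg (C := typeI m) (simpleRoot_mem_roots i) (simpleRoot_nonneg i))
      (Finset.mem_univ i)
  have e1 : (typeI m).numRed ((typeI m).refl 0 * (typeI m).wordProd (alternatingWord 0 1 m)) = 1 := by
    have := numRed_inv_mul_longest hm he 0 1 (by decide) (fun k h1 h2 => ?_) rfl (m - 1) 1 le_rfl
      (by omega)
    · simpa [alternatingWord_succ, alternatingWord] using this
    · by_cases h : Even k
      · simp only [h, if_true, simpleRoot_zero_typeI hm, simpleRoot_one_typeI hm,
          wordProd_zero_one_rootI hm]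
        refine ⟨rootI_nonneg hm (by omega) (by omega), rootI_nonpos' hm (by omega) (by omega)⟩
      · simp only [h, if_false, simpleRoot_zero_typeI hm, simpleRoot_one_typeI hm,
          wordProd_zero_one_rootI hm]
        refine ⟨rootI_nonneg hm (by omega) (by omega), rootI_nonpos' hm (by omega) (by omega)⟩
  have e2 : (typeI m).numRed ((typeI m).refl 1 * (typeI m).wordProd (alternatingWord 0 1 m)) = 1 := by
    have := numRed_inv_mul_longest hm he 1 0 (by decide) (fun k h1 h2 => ?_) ?_ (m - 1) 1 le_rfl
      (by omega)
    · simpa [alternatingWord_succ, alternatingWord] using this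
    · by_cases h : Even k
      · simp only [h, if_true, simpleRoot_zero_typeI hm, simpleRoot_one_typeI hm,
          wordProd_one_zero_rootI hm]
        refine ⟨rootI_nonneg hm (by omega) (by omega), rootI_nonpos hm (by omega) (by omega)⟩
      · simp only [h, if_false, simpleRoot_zero_typeI hm, simpleRoot_one_typeI hm,
          wordProd_one_zero_rootI hm]
        refine ⟨rootI_nonneg hm (by omega) (by omega), rootI_nonpos hm (by omega) (by omega)⟩
    · refine LinearEquiv.ext fun v => ?_
      rw [wordProd_longest_typeI_apply hm he, eq_sum_smul_simpleRoot v, map_sum,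
        ← Finset.sum_neg_distrib]
      refine Finset.sum_congr rfl fun i _ => ?_
      have h : ∀ q, (typeI m).wordProd (alternatingWord 1 0 m) (rootI m q) = -rootI m q := by
        intro q
        rw [wordProd_one_zero_rootI hm, if_pos he, ← neg_neg (rootI m (q - m)), ← rootI_add hm,
          sub_add_cancel]
      rw [map_smul, ← smul_neg]
      congr 1
      fin_cases i
      · exact simpleRoot_zero_typeI hm ▸ h 0
      · exact simpleRoot_one_typeI hm ▸ h (m - 1)
  rw [numRed_eq_sum hW h0, hd, Fin.sum_univ_two, e1, e2]

end TypeI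

/-- The order of the positive roots of type `I 2 m`, in terms of their indices. -/
def LeI (m : ℕ) (x y : ℕ) : Prop := x = y ∨ (y ≠ 0 ∧ y ≠ m - 1 ∧ (x = m - 1 ∨ x < y))

theorem refl_zero_mul_refl_one_ne {m : ℕ} (hm : 3 ≤ m) :
    (typeI m).refl 0 * (typeI m).refl 1 ≠ (typeI m).refl 1 * (typeI m).refl 0 := by
  intro h
  have hm' : 2 ≤ m := by omega
  have h1 := LinearEquiv.congr_fun h (rootI m 0)
  rw [LinearEquiv.mul_apply, LinearEquiv.mul_apply, refl_one_rootI hm', refl_zero_rootI hm',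
    refl_zero_rootI hm', refl_one_rootI hm'] at h1
  have h2 : coordI m ((m : ℤ) - (m - 2 - 0) + 1) = coordI m ((m : ℤ) - 2 - (m - 0) + 1) :=
    congrFun h1 0
  -- The two products send the first simple root to the roots of index 2 and -2, whose first
  -- coordinates are nonnegative and negative respectively.
  have h3 : 0 ≤ coordI m ((m : ℤ) - (m - 2 - 0) + 1) := coordI_nonneg hm' (by omega) (by omega)
  have h4 := coordI_add hm' ((m : ℤ) - 2 - (m - 0) + 1)
  have h5 : 0 < coordI m ((m : ℤ) - 2 - (m - 0) + 1 + m) := coordI_pos hm' (by omega) (by omega)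
  linarith

/-- This is the determinant of two roots; it is nonzero for distinct indices in 0, …, m - 1, which
separates the positive roots. -/
theorem coordI_mul_sub_mul {m : ℕ} (hm : 2 ≤ m) (x y : ℤ) :
    coordI m (x + 1) * coordI m y - coordI m x * coordI m (y + 1) = coordI m (y - x) := by
  have h0 := (sin_pi_div_pos hm).ne'
  unfold coordI
  generalize π / m = t at h0 ⊢
  push_cast
  rw [add_mul, add_mul, sub_mul, one_mul, sin_add, sin_add, sin_sub]
  field_simp
  ring

theorem rootI_injOn {m : ℕ} (hm : 2 ≤ m) {x y : ℕ} (hx : x < m) (hy : y < m)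
    (h : rootI m x = rootI m y) : x = y := by
  have h0 : coordI m (x + 1) = coordI m (y + 1) := congrFun h 0
  have h1 : coordI m x = coordI m y := congrFun h 1
  rcases lt_trichotomy x y with hxy | hxy | hxy
  · have h2 := coordI_mul_sub_mul hm x y
    rw [h0, h1, mul_comm, sub_self] at h2
    exact absurd h2.symm (coordI_pos hm (by omega) (by omega)).ne'
  · exact hxy
  · have h2 := coordI_mul_sub_mul hm y x
    rw [h0, h1, mul_comm, sub_self] at h2
    exact absurd h2.symm (coordI_pos hm (by omega) (by omega)).ne'

/-- The heap gives the chain 0 < 1 < ⋯ < m - 2, and the extra relation puts the other simple root,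
of index m - 1, below index 1. So the poset is a chain with two minimal elements. -/
theorem rootLeI_iff {m : ℕ} (hm : 3 ≤ m) (x y : Fin m) :
    rootLeI m (rootI m (x : ℕ)) (rootI m (y : ℕ)) ↔ LeI m x y := by
  have hm' : 2 ≤ m := by omega
  have e1 : (typeI m).refl 0 (simpleRoot ℝ 1) = rootI m (1 : ℕ) := by
    rw [simpleRoot_one_typeI hm', refl_zero_rootI hm']
    congr 1
    push_cast
    ring
  have e2 : simpleRoot ℝ 1 = rootI m (m - 1 : ℕ) := by
    rw [simpleRoot_one_typeI hm']
    congr 1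
    omega
  constructor
  · intro h
    have key : ∀ β γ, rootLeI m β γ → β = rootI m (x : ℕ) →
        ∃ z : ℕ, z < m ∧ γ = rootI m z ∧ LeI m x z := by
      rintro β γ h rfl
      induction h with
      | refl => exact ⟨x, x.2, rfl, Or.inl rfl⟩
      | tail _ hr ih =>
        obtain ⟨z, hz, rfl, hxz⟩ := ih
        unfold LeI at hxz
        rcases hr with ⟨p, q, hpq, -, h1, h2⟩ | ⟨h1, h2⟩
        · have hq : (q : ℕ) < m - 1 := by simpa [length_alternatingWord] using q.2
          have hpq' : (p : ℕ) < q := hpq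
          rw [letterRoot_typeI hm'] at h1 h2
          have := rootI_injOn hm' hz (by omega) h1
          refine ⟨q, by omega, h2, ?_⟩
          unfold LeI
          omega
        · rw [e2] at h1
          rw [e1] at h2
          have := rootI_injOn hm' hz (by omega) h1
          refine ⟨1, by omega, h2, ?_⟩
          unfold LeI
          omega
    obtain ⟨z, hz, h1, h2⟩ := key _ _ h rfl
    rwa [rootI_injOn hm' y.2 hz h1]
  · have hstep : ∀ p : ℕ, p + 1 < m - 1 →
        (typeI m).dihedralRel 0 1 m (rootI m p) (rootI m (p + 1 : ℕ)) := by
      intro p hp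
      refine Or.inl ⟨⟨p, by rw [length_alternatingWord]; omega⟩,
        ⟨p + 1, by rw [length_alternatingWord]; omega⟩, Nat.lt_succ_self p, ?_, ?_, ?_⟩
      · rw [List.get_eq_getElem, List.get_eq_getElem]
        by_cases h : Even p
        · simpa [alternatingWord, h, Nat.even_add_one] using refl_zero_mul_refl_one_ne hm
        · simpa [alternatingWord, h, Nat.even_add_one] using (refl_zero_mul_refl_one_ne hm).symm
      · rw [letterRoot_typeI hm']
      · rw [letterRoot_typeI hm']
    have hchain : ∀ p d : ℕ, p + d < m - 1 → rootLeI m (rootI m p) (rootI m (p + d : ℕ)) := by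
      intro p d hd
      induction d with
      | zero => exact Relation.ReflTransGen.refl
      | succ d ih => exact (ih (by omega)).tail (hstep (p + d) (by omega))
    have hx := x.2
    have hy := y.2
    rintro (h | ⟨h1, h2, h3⟩)
    · rw [h]
      exact Relation.ReflTransGen.refl
    · by_cases hx' : (x : ℕ) = m - 1
      · have := hchain 1 (y - 1) (by omega)
        rw [show 1 + ((y : ℕ) - 1) = y by omega] at this
        refine Relation.ReflTransGen.head (Or.inr ⟨?_, e1.symm⟩) this
        rw [hx', e2]
      · have := hchain x (y - x) (by omega)
        rwa [show (x : ℕ) + (y - x) = y by omega] at this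

/-! ### The quadric word in type D -/

theorem CartanDatum.s_inv {n : ℕ} {R : Type} [CommRing R] (C : CartanDatum n R) (i : ℕ) :
    (C.s i)⁻¹ = C.s i := by
  unfold s
  split_ifs
  · exact C.refl_inv _
  · exact inv_one

theorem CartanDatum.elt_reverse {n : ℕ} {R : Type} [CommRing R] (C : CartanDatum n R)
    (l : List ℕ) : C.elt l.reverse = (C.elt l)⁻¹ := by
  induction l with
  | nil => exact inv_one.symm
  | cons i l ih =>
    rw [List.reverse_cons, elt_append, elt_cons, elt_cons, elt_nil, mul_one, ih, mul_inv_rev, s_inv]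

/-- The word `s_(L + 2) ⋯ s_4 s_3 s_1 s_2`. -/
def quadricWord (L : ℕ) : List ℕ := (List.range' 3 L).reverse ++ [1, 2]

theorem quadricWord_succ (L : ℕ) : quadricWord (L + 1) = (L + 3) :: quadricWord L := by
  rw [quadricWord, quadricWord, List.range'_concat, List.reverse_append]
  simp [add_comm]

theorem elt_range'_typeD_apply {m : ℕ} (L : ℕ) (hL : L + 2 ≤ m) {a : ℤ} (h1 : 1 ≤ a)
    (h2 : a ≤ m) : (typeD m).elt (List.range' 3 L) (vecD m a) =
      vecD m (if a = 1 then 1 else if a = L + 2 then 2 else if a ≤ L + 2 then a + 1 else a) := by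
  have key : ∀ b c : ℤ, 1 ≤ b → b ≤ m →
      (if b = 1 then (1 : ℤ) else if b = 2 then L + 2 else if b ≤ L + 2 then b - 1 else b) = c →
      (typeD m).elt (List.range' 3 L) (vecD m c) = vecD m b := by
    intro b c hb hb' hc
    have := elt_range'_typeD_inv_apply L hL hb hb'
    rw [hc] at this
    rw [← this, apply_inv_apply]
  apply key
  · split_ifs <;> omega
  · split_ifs <;> omega
  · split_ifs <;> omega

theorem elt_quadricWord_inv_apply {m : ℕ} (L : ℕ) (hL : L + 2 ≤ m) {a : ℤ} (h1 : 1 ≤ a)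
    (h2 : a ≤ m) : ((typeD m).elt (quadricWord L))⁻¹ (vecD m a) =
      vecD m (if a = 1 then -1 else if a = L + 2 then -2 else if a ≤ L + 2 then a + 1 else a) := by
  have hs : ∀ b : ℤ, 1 ≤ b → b ≤ m → (typeD m).s 2 ((typeD m).s 1 (vecD m b)) =
      vecD m (if b = 1 then -1 else if b = 2 then -2 else b) := by
    intro b hb hb'
    rw [s_succ (y := 1) _ (by omega), s_succ (y := 0) _ (by omega),
      refl_vecD' (by omega) _ (by omega), refl_vecD' (by omega) _ (tauD_mem (by omega) _ (by omega))]
    congr 1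
    change tauD 1 (tauD 0 b) = _
    grind [tauD]
  rw [quadricWord, elt_append, elt_reverse, mul_inv_rev, inv_inv, elt_cons, elt_cons, elt_nil,
    mul_one, mul_inv_rev, s_inv, s_inv, LinearEquiv.mul_apply, LinearEquiv.mul_apply,
    elt_range'_typeD_apply L hL h1 h2, hs _ (by split_ifs <;> omega) (by split_ifs <;> omega)]
  congr 1
  split_ifs <;> omega

theorem exists_actsD_quadricWord {m : ℕ} (L : ℕ) (hL : L + 2 ≤ m) :
    ∃ ω, ActsD m ((typeD m).elt (quadricWord L))⁻¹ ω ∧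
      IsSignedPerm m ω ∧ ∀ a : ℤ, 1 ≤ a → a ≤ m → ω a =
        if a = 1 then -1 else if a = L + 2 then -2 else if a ≤ L + 2 then a + 1 else a := by
  have hW := Subgroup.inv_mem _ ((typeD m).elt_mem_W (quadricWord L))
  obtain ⟨ω, hω⟩ := ActsD.exists_of_mem (by omega) hW
  refine ⟨ω, hω, hω.isSignedPerm (by omega) hW, fun a h1 h2 => ?_⟩
  obtain ⟨h3, h4⟩ := hω a (by omega)
  rw [elt_quadricWord_inv_apply L hL h1 h2] at h4
  exact (vecD_injective (by omega) (by split_ifs <;> omega) h3 h4).symm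

theorem elt_quadricWord_inv_simpleRoot_nonneg_iff {m : ℕ} (L : ℕ) (hL : L + 2 ≤ m) (i : Fin m) :
    0 ≤ ((typeD m).elt (quadricWord L))⁻¹ (simpleRoot ℤ i) ↔
      if L = 0 then 2 ≤ (i : ℕ) else (i : ℕ) ≠ L + 1 := by
  obtain ⟨ω, hω, hs, h⟩ := exists_actsD_quadricWord L hL
  have hi' := i.2
  have hm : 2 ≤ m := by omega
  by_cases hi : (i : ℕ) = 0
  · have e : i = ⟨0, by omega⟩ := Fin.ext hi
    obtain ⟨hI, e'⟩ := hω.apply_rootD hs (a := 1) (b := 2)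
      ⟨by omega, by omega, by omega, by omega, by omega, by omega⟩
    have h1 := h 1 (by omega) (by omega)
    have h2 := h 2 (by omega) (by omega)
    rw [e, simpleRoot_typeD_zero hm, e', rootD_nonneg_iff hm hI]
    dsimp only
    split_ifs at h1 h2 ⊢ <;> omega
  · obtain ⟨hI, e'⟩ := hω.apply_rootD hs (a := (i : ℕ) + 1) (b := -(i : ℕ))
      ⟨by omega, by omega, by omega, by omega, by omega, by omega⟩
    have h1 := h ((i : ℕ) + 1) (by omega) (by omega)
    have h2 := h (i : ℕ) (by omega) (by omega)
    have h3 := hs.neg (i : ℕ) (by omega)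
    rw [simpleRoot_typeD_succ i hi, e', rootD_nonneg_iff hm hI]
    split_ifs at h1 h2 ⊢ <;> omega

theorem CartanDatum.IsFiniteType.numRed_refl {n : ℕ} {C : CartanDatum n ℤ}
    (H : C.IsFiniteType) (i : Fin n) : C.numRed (C.refl i) = 1 := by
  rw [H.numRed_eq_refl_mul (C.refl_mem_W i) (i := i), refl_mul_self, numRed_one]
  · rw [refl_inv, refl_simpleRoot_self]
    exact not_nonneg_neg (C := C) (simpleRoot_mem_roots i) (simpleRoot_nonneg i)
  · intro j hj
    rw [refl_inv]
    refine H.refl_nonneg (simpleRoot_mem_roots j) (simpleRoot_nonneg j) fun h => hj ?_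
    by_contra hne
    have := congrFun h j
    simp [simpleRoot, hne] at this

/-- For L > 0 the only descent is the first letter, which is stripped off. What is left at L = 0 is
the product of the two commuting fork reflections, with its two orders. -/
theorem numRed_quadricWord {m : ℕ} (L : ℕ) (hL : L + 2 ≤ m) :
    (typeD m).numRed ((typeD m).elt (quadricWord L)) = 2 := by
  have hm : 2 ≤ m := by omega
  have H := typeD_isFiniteType hm
  induction L with
  | zero =>
    set i : Fin m := ⟨0, by omega⟩ with hi
    set j : Fin m := ⟨1, by omega⟩ with hj
    have hij : i ≠ j := by simp [hi, hj]
    have hW := (typeD m).elt_mem_W (quadricWord 0)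
    have e : (typeD m).elt (quadricWord 0) = (typeD m).refl i * (typeD m).refl j := by
      change (typeD m).elt [1, 2] = _
      rw [elt_cons, elt_cons, elt_nil, mul_one, s_succ (y := 0), s_succ (y := 1)]
    have hc : (typeD m).refl i * (typeD m).refl j = (typeD m).refl j * (typeD m).refl i := by
      apply refl_mul_comm_of_eq_zero
      · rw [← simpleCoroot_simpleRoot_eq, simpleCoroot_typeD hm]
        simp [hi, hj, simpleRoot, extZero]
      · rw [← simpleCoroot_simpleRoot_eq, simpleCoroot_typeD hm]
        simp [hi, hj, simpleRoot, extZero]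
    have hd : (typeD m).desc ((typeD m).elt (quadricWord 0)) = {i, j} := by
      ext k
      rw [H.mem_desc_iff hW, elt_quadricWord_inv_simpleRoot_nonneg_iff 0 hL, if_pos rfl,
        Finset.mem_insert, Finset.mem_singleton, Fin.ext_iff, Fin.ext_iff]
      simp only [hi, hj]
      omega
    have h1 : (typeD m).elt (quadricWord 0) ≠ 1 := by
      intro h
      have := elt_quadricWord_inv_simpleRoot_nonneg_iff 0 hL i
      rw [h] at this
      have h2 := this.mp (simpleRoot_nonneg i)
      simp [hi] at h2
    rw [numRed_eq_sum hW h1, hd, Finset.sum_pair hij, e, refl_mul_cancel, hc, refl_mul_cancel,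
      H.numRed_refl, H.numRed_refl]
  | succ L ih =>
    have hL' : L + 2 < m := by omega
    rw [← ih (by omega), H.numRed_eq_refl_mul (elt_mem_W _ _) (i := ⟨L + 2, hL'⟩), quadricWord_succ,
      elt_cons, s_succ _ hL', refl_mul_cancel]
    · rw [elt_quadricWord_inv_simpleRoot_nonneg_iff _ hL, if_neg (by omega)]
      simp
    · intro j hj
      rw [elt_quadricWord_inv_simpleRoot_nonneg_iff _ hL, if_neg (by omega)]
      exact fun h => hj (Fin.ext h)

theorem inversions_quadricWord {m : ℕ} (hm : 3 ≤ m) :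
    (typeD m).inversions ((typeD m).elt (quadricWord (m - 2))) =
      {β | ∃ p : ℤ, -m < p ∧ p ≤ 1 ∧ p ≠ 0 ∧ β = rootD m m p} := by
  have hm2 : 2 ≤ m := by omega
  obtain ⟨ω, hω, hs, h⟩ := exists_actsD_quadricWord (m - 2) (show m - 2 + 2 ≤ m by omega)
  have key : ∀ q p : ℤ, -q < p → p < q → q ≤ m → p ≠ 0 →
      (¬ 0 ≤ ((typeD m).elt (quadricWord (m - 2)))⁻¹ (rootD m q p) ↔ q = m ∧ p ≤ 1) := by
    intro q p hq hp hqm hp0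
    obtain ⟨hI, e⟩ := hω.apply_rootD hs (a := q) (b := p)
      ⟨by omega, by omega, by omega, by omega, by omega, by omega⟩
    rw [e, rootD_nonneg_iff hm2 hI]
    have e1 := h q (by omega) hqm
    rcases lt_or_gt_of_ne hp0 with h0 | h0
    · have e2 := h (-p) (by omega) (by omega)
      rw [hs.neg p (by omega)] at e2
      split_ifs at e1 e2 <;> omega
    · have e2 := h p (by omega) (by omega)
      split_ifs at e1 e2 <;> omega
  ext β
  rw [(typeD_isFiniteType hm2).mem_inversions_iff (elt_mem_W _ _), posRoots_typeD hm2]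
  constructor
  · rintro ⟨⟨q, p, h3, h4, h5, h6, rfl⟩, h7⟩
    obtain ⟨rfl, h8⟩ := (key q p h3 h4 h5 h6).mp h7
    exact ⟨p, h3, h8, h6, rfl⟩
  · rintro ⟨p, h3, h4, h5, rfl⟩
    exact ⟨⟨m, p, h3, by omega, le_rfl, h5, rfl⟩,
      (key m p h3 (by omega) le_rfl h5).mpr ⟨rfl, h4⟩⟩

/-! ### The dihedral root poset as an ideal in type D -/

theorem rootD_self_le_iff {m : ℕ} (hm : 3 ≤ m) {p p' : ℤ} (h1 : -m < p) (h2 : p < m) (h3 : p ≠ 0)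
    (h1' : -m < p') (h2' : p' < m) (h3' : p' ≠ 0) :
    rootD m m p ≤ rootD m m p' ↔ p ≤ p' ∧ ¬ (p = -1 ∧ p' = 1) := by
  constructor
  · intro h
    have h' : ∀ t : ℕ, t < m → (unitD m t + unitD p t) / 2 ≤ (unitD m t + unitD p' t) / 2 :=
      fun t ht => h ⟨t, ht⟩
    have e0 := h' 0 (by omega)
    have e1 := h' 1 (by omega)
    clear h
    refine ⟨?_, ?_⟩
    · by_contra hlt
      by_cases h4 : p' ≤ -3
      · obtain ⟨t, ht⟩ : ∃ t : ℕ, (t : ℤ) = -p' - 1 := ⟨(-p' - 1).toNat, by omega⟩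
        have e2 := h' t (by omega)
        clear e0 e1 h'
        grind (splits := 40) [unitD]
      · by_cases h5 : 1 ≤ p'
        · obtain ⟨t, ht⟩ : ∃ t : ℕ, (t : ℤ) = p - 1 := ⟨(p - 1).toNat, by omega⟩
          have e2 := h' t (by omega)
          clear e0 h'
          grind (splits := 40) [unitD]
        · clear h'
          have h6 : p' = -1 ∨ p' = -2 := by omega
          rcases h6 with rfl | rfl
          · grind (splits := 40) [unitD]
          · grind (splits := 40) [unitD]
    -- The roots e_m + e_1 and e_m - e_1 differ by 2e_1, the difference of the two fork roots, so
    -- they are incomparable. They are the images of the two simple roots of the dihedral system.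
    · rintro ⟨rfl, rfl⟩
      clear h'
      grind (splits := 40) [unitD]
  · rintro ⟨h4, h5⟩ t
    have : unitD p t ≤ unitD p' t := by grind (splits := 40) [unitD]
    simp only [rootD]
    omega

/-- The image of the positive root of type `I 2 m` with index `x` is `e m + e (quadricIdx m x)`. -/
def quadricIdx (m x : ℕ) : ℤ := if x = 0 then 1 else if x = m - 1 then -1 else -(x + 1)

theorem typeI_dualEmbeds {m : ℕ} (hm : 3 ≤ m) :
    DualEmbedsAsIdeal (typeI m).posRoots (rootLeI m) ((typeD m).rootFilter ⟨m - 1, by omega⟩)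
      ((typeD m).inversions ((typeD m).elt (quadricWord (m - 2)))) := by
  have hm2 : 2 ≤ m := by omega
  have hpos : ∀ β ∈ (typeD m).rootFilter ⟨m - 1, by omega⟩, ∃ p : ℤ, -m < p ∧ p < m ∧ p ≠ 0 ∧
      β = rootD m m p := by
    rintro β ⟨hβ, h0⟩
    rw [posRoots_typeD hm2] at hβ
    obtain ⟨q, p, h1, h2, h3, h4, rfl⟩ := hβ
    have hq : q = m := by
      by_contra h
      apply h0
      have e1 : unitD q (m - 1) = 0 := by grind [unitD]
      have e2 : unitD p (m - 1) = 0 := by grind [unitD]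
      simp only [rootD, e1, e2]
      rfl
    subst hq
    exact ⟨p, h1, h2, h4, rfl⟩
  have hidx : ∀ x : Fin m, -(m : ℤ) < quadricIdx m x ∧ quadricIdx m x ≤ 1 ∧ quadricIdx m x ≠ 0 := by
    intro x
    have := x.2
    unfold quadricIdx
    split_ifs <;> omega
  have hle : ∀ x y : Fin m, rootD m m (quadricIdx m x) ≤ rootD m m (quadricIdx m y) ↔
      quadricIdx m x ≤ quadricIdx m y ∧ ¬ (quadricIdx m x = -1 ∧ quadricIdx m y = 1) := by
    intro x y
    have h1 := hidx x
    have h2 := hidx y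
    exact rootD_self_le_iff hm h1.1 (by omega) h1.2.2 h2.1 (by omega) h2.2.2
  refine dualEmbedsAsIdeal_of_index (fun x : Fin m => rootI m (x : ℕ))
    (fun x : Fin m => rootD m m (quadricIdx m x)) (posRoots_typeI hm2) ?_ ?_ ?_ ?_ ?_
  · rw [inversions_quadricWord hm]
    ext β
    constructor
    · rintro ⟨p, h1, h2, h3, rfl⟩
      obtain ⟨x, hx, hx'⟩ : ∃ x : ℕ, x < m ∧ quadricIdx m x = p := by
        by_cases hp1 : p = 1
        · exact ⟨0, by omega, by rw [hp1]; rfl⟩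
        · by_cases hp2 : p = -1
          · refine ⟨m - 1, by omega, ?_⟩
            unfold quadricIdx
            split_ifs <;> omega
          · refine ⟨(-p - 1).toNat, by omega, ?_⟩
            unfold quadricIdx
            split_ifs <;> omega
      exact ⟨⟨x, hx⟩, congrArg (rootD m m) hx'⟩
    · rintro ⟨x, rfl⟩
      obtain ⟨h1, h2, h3⟩ := hidx x
      exact ⟨_, h1, h2, h3, rfl⟩
  · rw [inversions_quadricWord hm]
    rintro β ⟨p, h1, h2, h3, rfl⟩
    refine ⟨?_, ?_⟩
    · rw [posRoots_typeD hm2]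
      exact ⟨m, p, h1, by omega, le_rfl, h3, rfl⟩
    · have e1 : unitD m (m - 1) = 2 := by grind [unitD]
      have e2 : unitD p (m - 1) = 0 := by grind [unitD]
      simp only [rootD, e1, e2]
      norm_num
  · intro x y h
    have h1 := (hle x y).mp h.le
    have h2 := (hle y x).mp h.ge
    have hx := x.2
    have hy := y.2
    have e : quadricIdx m x = quadricIdx m y := le_antisymm h1.1 h2.1
    unfold quadricIdx at e
    ext
    split_ifs at e <;> omega
  · intro x y
    have hx := x.2
    have hy := y.2
    rw [rootLeI_iff hm, hle, LeI, quadricIdx, quadricIdx]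
    split_ifs
    all_goals first | omega | simp_all
  · rintro β hβ x hβx
    obtain ⟨p, h1, h2, h3, rfl⟩ := hpos β hβ
    obtain ⟨h4, h5, h6⟩ := hidx x
    have := (rootD_self_le_iff hm h1 h2 h3 h4 (by omega) h6).mp hβx
    rw [inversions_quadricWord hm]
    exact ⟨p, h1, by omega, h3, rfl⟩

theorem typeI_main {n : ℕ} (hn : 2 ≤ n) (h : 2 * n - 1 < 2 * n) :
    DualEmbedsAsIdeal (typeI (2 * n)).posRoots (rootLeI (2 * n))
      ((typeD (2 * n)).rootFilter ⟨2 * n - 1, h⟩)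
      ((typeD (2 * n)).inversions ((typeD (2 * n)).elt (wordI n))) ∧
    ∃ w₀, (typeI (2 * n)).IsLongest w₀ ∧
      Nonempty ((typeI (2 * n)).Red w₀ ≃ (typeD (2 * n)).Red ((typeD (2 * n)).elt (wordI n))) :=
  ⟨typeI_dualEmbeds (by omega), _, isLongest_typeI (by omega) (even_two_mul n),
    nonempty_Red_equiv ((numRed_longest_typeI (by omega) (even_two_mul n)).trans
      (numRed_quadricWord (2 * n - 2) (by omega)).symm)⟩

end RootPosetEmbedding

theorem mainTheorem6 :
    (∀ k n : ℕ, ∀ _hk : 1 ≤ k, ∀ _hn : 2 * k ≤ n,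
      RootPosetEmbedding.DualEmbedsAsIdeal
        (RootPosetEmbedding.trapezoid k n) (fun β γ => β ≤ γ)
        ((RootPosetEmbedding.typeD n).rootFilter ⟨0, by omega⟩)
        ((RootPosetEmbedding.typeD n).inversions
          ((RootPosetEmbedding.typeD n).elt (RootPosetEmbedding.wordB k n))) ∧
      Nonempty
        ((RootPosetEmbedding.typeB (n - k)).Red (RootPosetEmbedding.bElt k n) ≃
          (RootPosetEmbedding.typeD n).Red
            ((RootPosetEmbedding.typeD n).elt (RootPosetEmbedding.wordB k n)))) ∧
    (RootPosetEmbedding.DualEmbedsAsIdeal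
        RootPosetEmbedding.typeH3.posRoots RootPosetEmbedding.rootLeH3
        (RootPosetEmbedding.typeE7.rootFilter 0)
        (RootPosetEmbedding.typeE7.inversions
          (RootPosetEmbedding.typeE7.elt RootPosetEmbedding.wordH)) ∧
      ∃ w₀, RootPosetEmbedding.typeH3.IsLongest w₀ ∧
        Nonempty
          (RootPosetEmbedding.typeH3.Red w₀ ≃
            RootPosetEmbedding.typeE7.Red
              (RootPosetEmbedding.typeE7.elt RootPosetEmbedding.wordH))) ∧
    (∀ n : ℕ, ∀ _hn : 2 ≤ n,
      RootPosetEmbedding.DualEmbedsAsIdeal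
        (RootPosetEmbedding.typeI (2 * n)).posRoots (RootPosetEmbedding.rootLeI (2 * n))
        ((RootPosetEmbedding.typeD (2 * n)).rootFilter ⟨2 * n - 1, by omega⟩)
        ((RootPosetEmbedding.typeD (2 * n)).inversions
          ((RootPosetEmbedding.typeD (2 * n)).elt (RootPosetEmbedding.wordI n))) ∧
      ∃ w₀, (RootPosetEmbedding.typeI (2 * n)).IsLongest w₀ ∧
        Nonempty
          ((RootPosetEmbedding.typeI (2 * n)).Red w₀ ≃
            (RootPosetEmbedding.typeD (2 * n)).Red
              ((RootPosetEmbedding.typeD (2 * n)).elt (RootPosetEmbedding.wordI n)))) := by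
  exact ⟨fun _ _ hk hn => RootPosetEmbedding.trapezoid_main hk hn _,
    RootPosetEmbedding.typeH3_main, fun _ hn => RootPosetEmbedding.typeI_main hn _⟩
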